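/- **Setting.** Let $\bar s,\bar d,\bar\mu\in\{1,2,\dots\}^r$. For $\bar\nu\in\mathbb Z^r$ with all components positive or all negative, and a sequence $\eta$ of complex random variables, the generalized multiple (GM) increment is $\chi_{\bar\nu,\bar s}(\eta(m))=\prod_i(1-B^{\nu_is_i})^{d_i}\eta(m)$, $B$ being the backward shift. Put $\chi_{\bar\nu}(e^{-i\lambda})=\prod_j(1-e^{-i\lambda\nu_js_j})^{d_j}$ and $\beta(i\lambda)=\prod_j\prod_{k=-[s_j/2]}^{[s_j/2]}(i\lambda-2\pi ik/s_j)^{d_j}$. Write $\prod_i(1-x^{\mu_is_i})^{d_i}=\sum_{k=0}^{n}e(k)x^k$, $n=\sum_i\mu_is_id_i$, and $\prod_i\bigl(\sum_{j\ge0}x^{\mu_is_ij}\bigr)^{d_i}=\sum_{k\ge0}d(k)x^k$. Let $T\ge1$ and let $\zeta(k)$, $k\in\mathbb Z$, have periodically stationary GM increments with period $T$: for all $\bar\nu,\bar\nu'$ the increments $\chi_{\bar\nu,T\bar s}(\zeta(m))$ are square integrable, and $E\chi_{\bar\nu,T\bar s}(\zeta(m))$ and $E\chi_{\bar\nu,T\bar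 s}(\zeta(m))\overline{\chi_{\bar\nu',T\bar s}(\zeta(k))}$ do not change when $T$ is added to the times. Put $\xi_p(m)=\zeta(mT+p-1)$, $\vec\xi=(\xi_1,\dots,\xi_T)^\top$. Let $f$ be the spectral density matrix of the increments of $\vec\xi$, that is, an integrable, positive semidefinite matrix function with $$E\,\chi_{\bar\nu,\bar s}(\xi_p(m_0+m))\overline{\chi_{\bar\nu',\bar s}(\xi_q(m_0))}=\frac1{2\pi}\int_{-\pi}^{\pi}e^{i\lambda m}\chi_{\bar\nu}(e^{-i\lambda})\chi_{\bar\nu'}(e^{i\lambda})\frac{f_{pq}(\lambda)}{|\beta(i\lambda)|^2}d\lambda$$ for all $\bar\nu,\bar\nu',p,q,m_0,m$. Assume the minimality condition: $f$ is invertible a.e. and $\int_{-\pi}^{\pi}\mathrm{Tr}\bigl[\tfrac{|\beta(i\lambda)|^2}{|\chi_{\bar\mu}(e^{-i\lambda})|^2}f^{-1}(\lambda)\bigr]d\lambda<\infty$. Let $a^{(\zeta)}(k)\in\mathbb C$, $k\ge0$, $\vec a(m)=(a^{(\zeta)}(mT+p-1))_{p=1}^T$, and let the series $\vec b(k)=(D\mathbf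 a)_k:=\sum_{m\ge k}d(m-k)\vec a(m)$ converge, with $\sum\|\vec a(k)\|$, $\sum(k+1)\|\vec a(k)\|^2$, $\sum\|\vec b(k)\|$, $\sum(k+1)\|\vec b(k)\|^2$ all finite. Put $\vec B(e^{i\lambda})=\sum_{k\ge0}\vec b(k)e^{i\lambda k}$ and $V\vec\xi=\sum_{k=-n}^{-1}\vec v(k)^\top\vec\xi(k)$ with $\vec v(k)=\sum_{l=0}^{k+n}e(l-k)\vec b(l)$. *The functional* $A\zeta=\sum_{k\ge0}a^{(\zeta)}(k)\zeta(k)=\sum_{m\ge0}\vec a(m)^\top\vec\xi(m)$ is the limit in probability of finite sums $\sum_k\alpha_n(k)\zeta(k)$ whose coefficients $\alpha_n$ converge to $a^{(\zeta)}$ in $\ell^1$ while $D$ of the blocked $\alpha_n$ converges to $D\mathbf a$ in $\ell^1$. *Linear estimates* of $A\zeta$ from the observations $\zeta(m)$, $m\le-1$, are the mean square limits of finite sums $\sum_{k\le-1}w(k)\zeta(k)$ for which $\sum_{k\ge0}a^{(\zeta)}(k)\zeta(k)-\sum_{k\le-1}w(k)\zeta(k)$ is formally a combination $\sum_mc(m)\chi_{\bar\mu,T\bar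 s}(\zeta(m))$ with $\sum|c(m)|<\infty$. The optimal estimate $\widehat A\zeta$ minimizes $E|A\zeta-\widehat A\zeta|^2$ among them. *Stochastic integral.* $\int\vec h^\top d\vec Z$ denotes the isometry from $L_2(f)$, with $\|\vec h\|^2=\frac1{2\pi}\int\vec h^\top f\,\overline{\vec h}\,d\lambda$, that takes $e^{i\lambda m}\chi_{\bar\mu}(e^{-i\lambda})\beta(i\lambda)^{-1}\boldsymbol\delta_p$ to $\chi_{\bar\mu,\bar s}(\xi_p(m))$; $L_2^{0-}(f)$ is the closed span of these functions with $m\le-1$. The *spectral characteristic* of an estimate $X$ is the $\vec h\in L_2^{0-}(f)$ with $X=\int\vec h^\top d\vec Z-V\vec\xi$. *The operator $\mathbf F$* has the matrix blocks $F(j,k)=\frac1{2\pi}\int_{-\pi}^{\pi}e^{i\lambda(k-j)}\frac{|\beta(i\lambda)|^2}{|\chi_{\bar\mu}(e^{-i\lambda})|^2}(f^{-1}(\lambda))^{\top}d\lambda$, $j,k\ge0$. It acts on the completion of the finitely supported sequences $\mathbf c=(\vec c(k))_{k\ge0}$ in the norm $\langle\mathbf c,\mathbf F\mathbf c\rangle^{1/2}$,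 which is the norm of $\sum_k\vec c(k)e^{i\lambda k}$ in $L_2$ with weight $\frac1{2\pi}\frac{|\beta|^2}{|\chi_{\bar\mu}|^2}f^{-1}$: $\mathbf F\mathbf c=\mathbf b$ means that there are finitely supported $\mathbf c_n\to\mathbf c$ in this norm with $(\mathbf F\mathbf c_n)_j\to\vec b(j)$ for every $j$. Elements of the completion are identified with their Fourier coefficient sequences, and $\vec C(e^{i\lambda})=\sum_k\vec c(k)e^{i\lambda k}$ denotes the corresponding function. **Theorem.** $A\zeta$ exists and is unique a.s., and if all $\zeta(k)$ are square integrable and the partial sums of $\sum a^{(\zeta)}(k)\zeta(k)$ converge in mean square, it is their limit. The equation $\mathbf F\mathbf c=D\mathbf a$ has exactly one solution $\mathbf c=\mathbf F^{-1}D\mathbf a$; the function $\vec C$ is integrable and has the Fourier coefficients $\vec c(k)$ for $k\ge0$ and $0$ for $k<0$; if the matrix $(F(j,k))$ defines a bounded operator on $\ell^2$, any solution in $\ell^2$ of $\mathbf F\mathbf c'=D\mathbf a$ equals $\mathbf c$. The optimal linear estimate exists, is unique a.s., and is $$\widehat A\zeta=\int_{-\pi}^{\pi}\vec h(\lambda)^\top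 d\vec Z(\lambda)-V\vec\xi,$$ where its (a.e. unique) spectral characteristic and mean square error are $$\vec h(\lambda)^\top=\vec B(e^{i\lambda})^\top\frac{\chi_{\bar\mu}(e^{-i\lambda})}{\beta(i\lambda)}-\frac{\overline{\beta(i\lambda)}}{\chi_{\bar\mu}(e^{i\lambda})}\Bigl(\sum_{k\ge0}(\mathbf F^{-1}D\mathbf a)_ke^{i\lambda k}\Bigr)^{\top}f^{-1}(\lambda),$$ $$E|A\zeta-\widehat A\zeta|^2=\frac1{2\pi}\int_{-\pi}^{\pi}\frac{|\beta(i\lambda)|^2}{|\chi_{\bar\mu}(e^{-i\lambda})|^2}\,\vec C(e^{i\lambda})^\top f^{-1}(\lambda)\overline{\vec C(e^{i\lambda})}\,d\lambda=\langle D\mathbf a,\mathbf F^{-1}D\mathbf a\rangle .$$ Suppose moreover that $f$ admits the canonical factorization, that is: there are $q\ge0$, an innovation sequence $\vec\varepsilon(u)\in\mathbb C^q$ (square integrable, $E\varepsilon_k(u)\overline{\varepsilon_j(v)}=\delta_{kj}\delta_{uv}$, and for each $m$ the increments $\chi_{\bar\mu,\bar s}(\xi_p(k))$, $k\le m$, and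 the $\varepsilon_j(u)$, $u\le m$, generate the same closed subspace of $L_2(\Omega)$) and $T\times q$ matrices $\varphi(k),\varphi_{\bar\mu}(k)$ with square summable entries such that $\chi_{\bar\mu,\bar s}(\vec\xi(m))=\sum_{k\ge0}\varphi_{\bar\mu}(k)\vec\varepsilon(m-k)$ in mean square and, with $\Phi(e^{-i\lambda})=\sum\varphi(k)e^{-i\lambda k}$, $\Phi_{\bar\mu}(e^{-i\lambda})=\sum\varphi_{\bar\mu}(k)e^{-i\lambda k}$, $f=\Phi\Phi^*$ and $\frac{|\chi_{\bar\mu}|^2}{|\beta|^2}f=\Phi_{\bar\mu}\Phi_{\bar\mu}^*$ a.e. Let $\Psi_{\bar\mu}\Phi_{\bar\mu}=E_q$ a.e. (the identity matrix). Then also $$\vec h(\lambda)=\frac{\chi_{\bar\mu}(e^{-i\lambda})}{\beta(i\lambda)}\Bigl(\vec B(e^{i\lambda})-\Psi_{\bar\mu}(e^{-i\lambda})^\top\vec r(e^{i\lambda})\Bigr),\qquad \vec r(e^{i\lambda})=\sum_{k\ge0}\vec r_k\,e^{i\lambda k}\ \text{ in }L_2,$$ $$\vec r_k=\sum_{m\ge0}\sum_{l\ge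 k}\varphi_{\bar\mu}(m)^\top\vec a(m+l)d(l-k),\qquad E|A\zeta-\widehat A\zeta|^2=\frac1{2\pi}\int_{-\pi}^{\pi}\|\vec r(e^{i\lambda})\|^2d\lambda=\sum_{k\ge0}\|\vec r_k\|^2 .$$ -/

import Mathlib

open MeasureTheory Filter Topology
open scoped ENNReal Matrix ComplexOrder

noncomputable section

namespace GM

/-! ### Generalized multiple (GM) increments -/

/-- Admissible steps: all components positive, or all components negative. -/
def AdmissibleStep {r : ℕ} (μ : Fin r → ℤ) : Prop :=
  (∀ i, 0 < μ i) ∨ (∀ i, μ i < 0)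

/-- The GM increment
`χ η (m) = ∑_{l₁ ≤ d₁} … ∑_{l_r ≤ d_r} (-1)^{∑ lᵢ} ∏ᵢ C(dᵢ, lᵢ) η(m - ∑ᵢ μᵢ sᵢ lᵢ)`,
that is, `∏ᵢ (1 - B^{μᵢ sᵢ})^{dᵢ}` applied to `η`, where `B` is the backward shift. -/
def increment {Ω : Type*} {r : ℕ} (μ : Fin r → ℤ) (s d : Fin r → ℕ)
    (η : ℤ → Ω → ℂ) (m : ℤ) (ω : Ω) : ℂ :=
  ∑ l ∈ Fintype.piFinset (fun i => Finset.range (d i + 1)),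
    ((-1 : ℂ) ^ (∑ i, l i) * ∏ i, ((d i).choose (l i) : ℂ)) *
      η (m - ∑ i, μ i * (s i : ℤ) * (l i : ℤ)) ω

/-- `ζ` has periodically stationary GM increments with period `T`: for all admissible steps the
first and the mixed second moments of the increments with seasonal vector `T s` exist and are
`T`-periodic in time. -/
def PeriodicallyStationary {Ω : Type*} [MeasurableSpace Ω] (P : Measure Ω) (T : ℕ) {r : ℕ}
    (s d : Fin r → ℕ) (ζ : ℤ → Ω → ℂ) : Prop :=
  (∀ μ : Fin r → ℤ, AdmissibleStep μ → ∀ m : ℤ,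
    MemLp (increment μ (fun i => T * s i) d ζ m) 2 P ∧
    ∫ ω, increment μ (fun i => T * s i) d ζ (m + T) ω ∂P =
      ∫ ω, increment μ (fun i => T * s i) d ζ m ω ∂P) ∧
  ∀ μ₁ μ₂ : Fin r → ℤ, AdmissibleStep μ₁ → AdmissibleStep μ₂ → ∀ m k : ℤ,
    ∫ ω, increment μ₁ (fun i => T * s i) d ζ (m + T) ω *
        star (increment μ₂ (fun i => T * s i) d ζ (k + T) ω) ∂P =
      ∫ ω, increment μ₁ (fun i => T * s i) d ζ m ω *
        star (increment μ₂ (fun i => T * s i) d ζ k ω) ∂P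

/-- Blocking: the components `ξ_p(m) = ζ(mT + p)`, with `p = 0, …, T - 1`. -/
def blocked {Ω : Type*} (T : ℕ) (ζ : ℤ → Ω → ℂ) (p : Fin T) (m : ℤ) : Ω → ℂ :=
  ζ (m * (T : ℤ) + ((p : ℕ) : ℤ))

/-- Blocking of the coefficients: `a_p(m) = a(mT + p)`. -/
def blockCoef (T : ℕ) (a : ℕ → ℂ) (m : ℕ) : Fin T → ℂ := fun p => a (m * T + p)

/-! ### Spectral notions.  Frequencies carry the measure `dλ / (2π)` on `(-π, π]`. -/

/-- The normalized Lebesgue measure `dλ / (2π)` on `(-π, π]`. -/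
def freq : Measure ℝ :=
  ENNReal.ofReal (1 / (2 * Real.pi)) • volume.restrict (Set.Ioc (-Real.pi) Real.pi)

/-- `e^{i k λ}`. -/
def expi (k : ℤ) (l : ℝ) : ℂ := Complex.exp (Complex.I * (k : ℂ) * (l : ℂ))

/-- `χ_μ(e^{-iλ}) = ∏ⱼ (1 - e^{-iλ μⱼ sⱼ})^{dⱼ}`; its conjugate is `χ_μ(e^{iλ})`. -/
def chi {r : ℕ} (μ : Fin r → ℤ) (s d : Fin r → ℕ) (l : ℝ) : ℂ :=
  ∏ j, (1 - expi (-(μ j * (s j : ℤ))) l) ^ d j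

/-- `β(iλ) = ∏ⱼ ∏_{k = -[sⱼ/2]}^{[sⱼ/2]} (iλ - 2πi k / sⱼ)^{dⱼ}`. -/
def beta {r : ℕ} (s d : Fin r → ℕ) (l : ℝ) : ℂ :=
  ∏ j, ∏ k ∈ Finset.Icc (-((s j / 2 : ℕ) : ℤ)) ((s j / 2 : ℕ) : ℤ),
    (Complex.I * (l : ℂ) - 2 * (Real.pi : ℂ) * Complex.I * (k : ℂ) / ((s j : ℕ) : ℂ)) ^ d j

/-- `f` is the spectral density (with respect to `dλ / (2π)`) of the stationary GM increments of
the vector sequence `ξ`: it is integrable, positive semidefinite, and represents the structural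
function,
`E χ_{μ₁}(ξ_p(m₀ + m)) conj(χ_{μ₂}(ξ_q(m₀)))
  = (2π)⁻¹ ∫ e^{iλm} χ_{μ₁}(e^{-iλ}) χ_{μ₂}(e^{iλ}) |β(iλ)|⁻² f_{pq}(λ) dλ`. -/
structure IsSpectralDensity {Ω : Type*} [MeasurableSpace Ω] (P : Measure Ω) {T r : ℕ}
    (s d : Fin r → ℕ) (ξ : Fin T → ℤ → Ω → ℂ) (f : ℝ → Matrix (Fin T) (Fin T) ℂ) : Prop where
  integrable : ∀ p q, Integrable (fun l => f l p q) freq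
  posSemidef : ∀ᵐ l ∂freq, (f l).PosSemidef
  structural : ∀ μ₁ μ₂ : Fin r → ℤ, AdmissibleStep μ₁ → AdmissibleStep μ₂ →
    ∀ (p q : Fin T) (m₀ m : ℤ),
      ∫ ω, increment μ₁ s d (ξ p) (m₀ + m) ω * star (increment μ₂ s d (ξ q) m₀ ω) ∂P =
        ∫ l, expi m l * chi μ₁ s d l * star (chi μ₂ s d l) /
          ((‖beta s d l‖ ^ 2 : ℝ) : ℂ) * f l p q ∂freq

/-- The integral `∫ u(λ)ᵀ W(λ) conj(u(λ)) dλ / (2π)`: the square of the norm of `u` in `L₂(W)`. -/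
def weightedSq {T : ℕ} (W : ℝ → Matrix (Fin T) (Fin T) ℂ) (u : ℝ → Fin T → ℂ) : ℝ≥0∞ :=
  ∫⁻ l, ENNReal.ofReal (((u l) ᵥ* (W l) ⬝ᵥ star (u l)).re) ∂freq

/-! ### A fixed positive step -/

/-- Seasons, orders and a positive step, all components positive integers. -/
structure Params (r : ℕ) where
  s : Fin r → ℕ
  d : Fin r → ℕ
  μ : Fin r → ℕ
  s_pos : ∀ i, 0 < s i
  d_pos : ∀ i, 0 < d i
  μ_pos : ∀ i, 0 < μ i

namespace Params

variable {r : ℕ} (γ : Params r)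

/-- The step, as an integer vector. -/
def step : Fin r → ℤ := fun i => (γ.μ i : ℤ)

/-- `χ_μ(e^{-iλ})`. -/
def chi (l : ℝ) : ℂ := GM.chi γ.step γ.s γ.d l

/-- `β(iλ)`. -/
def beta (l : ℝ) : ℂ := GM.beta γ.s γ.d l

/-- `|β(iλ)|² / |χ_μ(e^{-iλ})|²`. -/
def ratio (l : ℝ) : ℝ := ‖γ.beta l‖ ^ 2 / ‖γ.chi l‖ ^ 2

/-- `n(γ) = ∑ᵢ μᵢ sᵢ dᵢ`. -/
def n : ℕ := ∑ i, γ.μ i * γ.s i * γ.d i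

/-- The coefficients in `∏ᵢ (1 - x^{μᵢ sᵢ})^{dᵢ} = ∑ₖ e(k) x^k`. -/
def e (k : ℕ) : ℂ :=
  (∏ i, (1 - Polynomial.X ^ (γ.μ i * γ.s i)) ^ γ.d i : Polynomial ℂ).coeff k

/-- The coefficients in `∏ᵢ (∑ⱼ x^{μᵢ sᵢ j})^{dᵢ} = ∑ₖ d(k) x^k`. -/
def dCoef (k : ℕ) : ℂ :=
  PowerSeries.coeff k
    (∏ i, (PowerSeries.mk (fun j => if γ.μ i * γ.s i ∣ j then (1 : ℂ) else 0)) ^ γ.d i)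

/-- The series defining `(D a)_k` converge. -/
def DConverges {T : ℕ} (a : ℕ → Fin T → ℂ) : Prop :=
  ∀ k, Summable (fun j => γ.dCoef j • a (k + j)) (SummationFilter.conditional ℕ)

/-- `(D a)_k = ∑_{m ≥ k} d(m - k) a(m)`, as the limit of the partial sums. -/
def D {T : ℕ} (a : ℕ → Fin T → ℂ) (k : ℕ) : Fin T → ℂ :=
  ∑'[SummationFilter.conditional ℕ] j, γ.dCoef j • a (k + j)

/-- `v(-k) = ∑_{l=0}^{n(γ)-k} e(l + k) b(l)` for `k = 1, …, n(γ)`. -/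
def v {T : ℕ} (b : ℕ → Fin T → ℂ) (k : ℕ) : Fin T → ℂ :=
  ∑ l ∈ Finset.range (γ.n - k + 1), γ.e (l + k) • b l

/-- The initial value functional `V ξ = ∑_{k=-n(γ)}^{-1} v(k)ᵀ ξ(k)`. -/
def V {Ω : Type*} {T : ℕ} (b : ℕ → Fin T → ℂ) (ξ : Fin T → ℤ → Ω → ℂ) (ω : Ω) : ℂ :=
  ∑ k ∈ Finset.Icc 1 γ.n, ∑ p, γ.v b k p * ξ p (-(k : ℤ)) ω

/-- The increments `χ_μ(ξ_p(m))` with the fixed step. -/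
def inc {Ω : Type*} {T : ℕ} (ξ : Fin T → ℤ → Ω → ℂ) (p : Fin T) (m : ℤ) : Ω → ℂ :=
  increment γ.step γ.s γ.d (ξ p) m

/-- Conditions on the (blocked) coefficients. -/
structure CoefCond {T : ℕ} (a : ℕ → Fin T → ℂ) : Prop where
  summable : Summable (fun k => ‖a k‖)
  summable_sq : Summable (fun k : ℕ => ((k : ℝ) + 1) * ‖a k‖ ^ 2)
  converges : γ.DConverges a
  summable_D : Summable (fun k => ‖γ.D a k‖)
  summable_sq_D : Summable (fun k : ℕ => ((k : ℝ) + 1) * ‖γ.D a k‖ ^ 2)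

/-- The minimality condition: `f` is invertible almost everywhere and
`∫ Tr [ |β(iλ)|² |χ_μ(e^{-iλ})|⁻² f⁻¹(λ) ] dλ < ∞`. -/
def Minimality {T : ℕ} (f : ℝ → Matrix (Fin T) (Fin T) ℂ) : Prop :=
  (∀ᵐ l ∂freq, (f l).PosDef) ∧
    Integrable (fun l => γ.ratio l * ((f l)⁻¹).trace.re) freq

/-! ### The functional and its linear estimates -/

/-- `X` is the value of the functional `Aζ = ∑_{k ≥ 0} a(k) ζ(k)`: the limit in probability of
finite functionals `∑ αₙ(k) ζ(k)` whose coefficients converge to `a` in the norm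
`‖a‖_{ℓ¹} + ‖D a‖_{ℓ¹}`.  (The variables `ζ(k)` need not have second moments, and the partial sums
of the series need not converge.) -/
def IsFunctionalValue {Ω : Type*} [MeasurableSpace Ω] (P : Measure Ω) (T : ℕ)
    (ζ : ℤ → Ω → ℂ) (a : ℕ → ℂ) (X : Ω → ℂ) : Prop :=
  AEMeasurable X P ∧ ∃ α : ℕ → (ℕ →₀ ℂ),
    Tendsto (fun n => ∑' k, ‖α n k - a k‖ₑ) atTop (𝓝 0) ∧
    Tendsto (fun n => ∑' k, ‖γ.D (blockCoef T (α n)) k - γ.D (blockCoef T a) k‖ₑ) atTop (𝓝 0) ∧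
    TendstoInMeasure P (fun n ω => (α n).sum fun k z => z * ζ (k : ℤ) ω) atTop X

/-- A finite linear combination `∑_{k ≤ -1} w(k) ζ(k)` of the observations is admissible for the
functional with coefficients `a` if the error `∑_{k ≥ 0} a(k) ζ(k) - ∑_{k ≤ -1} w(k) ζ(k)` is
formally a combination `∑ₘ c(m) χ(ζ(m))`, `∑ₘ |c(m)| < ∞`, of GM increments
`χ(ζ(m)) = ∑ⱼ e(j) ζ(m - jT)` of `ζ`. -/
def Admissible (T : ℕ) (a : ℕ → ℂ) (w : ℤ →₀ ℂ) : Prop :=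
  (∀ k, 0 ≤ k → w k = 0) ∧
  ∃ c : ℤ → ℂ, Summable (fun m => ‖c m‖) ∧
    ∀ k : ℤ, (if 0 ≤ k then a k.toNat else -w k) =
      ∑ j ∈ Finset.range (γ.n + 1), γ.e j * c (k + (T : ℤ) * (j : ℤ))

/-- Linear estimates of the functional from the observations `ζ(m)`, `m ≤ -1`: mean square limits
of admissible finite linear combinations of the observations. -/
def IsLinearEstimate {Ω : Type*} [MeasurableSpace Ω] (P : Measure Ω) (T : ℕ)
    (ζ : ℤ → Ω → ℂ) (a : ℕ → ℂ) (X : Ω → ℂ) : Prop :=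
  AEMeasurable X P ∧ ∃ w : ℕ → (ℤ →₀ ℂ), (∀ n, γ.Admissible T a (w n)) ∧
    Tendsto (fun n => eLpNorm (fun ω => ((w n).sum fun k z => z * ζ k ω) - X ω) 2 P)
      atTop (𝓝 0)

/-- The mean square error `E |Y - X|²`. -/
def _root_.GM.mse {Ω : Type*} [MeasurableSpace Ω] (P : Measure Ω) (Y X : Ω → ℂ) : ℝ≥0∞ :=
  ∫⁻ ω, ‖Y ω - X ω‖ₑ ^ 2 ∂P

/-- `X` is a mean square optimal linear estimate of `Y = Aζ`. -/
def IsOptimalEstimate {Ω : Type*} [MeasurableSpace Ω] (P : Measure Ω) (T : ℕ)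
    (ζ : ℤ → Ω → ℂ) (a : ℕ → ℂ) (Y X : Ω → ℂ) : Prop :=
  γ.IsLinearEstimate P T ζ a X ∧
    ∀ X', γ.IsLinearEstimate P T ζ a X' → mse P Y X ≤ mse P Y X'

/-! ### Stochastic integrals and spectral characteristics -/

/-- The element `∑_{m,p} c(m,p) e^{iλm} χ_μ(e^{-iλ}) β(iλ)⁻¹ δ_p` of `L₂(f)`. -/
def trig {T : ℕ} (c : (ℤ × Fin T) →₀ ℂ) (l : ℝ) : Fin T → ℂ :=
  fun q => c.sum fun x z => if x.2 = q then z * (expi x.1 l * γ.chi l / γ.beta l) else 0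

/-- The corresponding combination `∑_{m,p} c(m,p) χ_μ(ξ_p(m))` of increments. -/
def incComb {Ω : Type*} {T : ℕ} (ξ : Fin T → ℤ → Ω → ℂ) (c : (ℤ × Fin T) →₀ ℂ) (ω : Ω) : ℂ :=
  c.sum fun x z => z * γ.inc ξ x.2 x.1 ω

/-- `X = ∫ h(λ)ᵀ dZ(λ)`, where `Z` is the random spectral measure of the increments.  The integral
is the linear isometry from `L₂(f)` which sends `e^{iλm} χ_μ(e^{-iλ}) β(iλ)⁻¹ δ_p` to
`χ_μ(ξ_p(m))`; thus `Z_p(λ)` itself is the integral of the indicator of `[-π, λ)` times `δ_p`. -/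
def IsSpectralIntegral {Ω : Type*} [MeasurableSpace Ω] (P : Measure Ω) {T : ℕ}
    (ξ : Fin T → ℤ → Ω → ℂ) (f : ℝ → Matrix (Fin T) (Fin T) ℂ) (h : ℝ → Fin T → ℂ)
    (X : Ω → ℂ) : Prop :=
  AEMeasurable X P ∧ ∃ c : ℕ → ((ℤ × Fin T) →₀ ℂ),
    Tendsto (fun n => weightedSq f (fun l => h l - γ.trig (c n) l)) atTop (𝓝 0) ∧
    Tendsto (fun n => eLpNorm (fun ω => X ω - γ.incComb ξ (c n) ω) 2 P) atTop (𝓝 0)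

/-- `h` belongs to the closed subspace of `L₂(f)` generated by the functions
`e^{iλk} χ_μ(e^{-iλ}) β(iλ)⁻¹ δ_p`, `k ≤ -1`. -/
def MemPast {T : ℕ} (f : ℝ → Matrix (Fin T) (Fin T) ℂ) (h : ℝ → Fin T → ℂ) : Prop :=
  ∃ c : ℕ → ((ℤ × Fin T) →₀ ℂ), (∀ n, ∀ x ∈ (c n).support, x.1 ≤ -1) ∧
    Tendsto (fun n => weightedSq f (fun l => h l - γ.trig (c n) l)) atTop (𝓝 0)

/-- `h` is the spectral characteristic of the estimate `X`: it lies in the closed subspace of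
`L₂(f)` that corresponds to the observations, and `X = ∫ h(λ)ᵀ dZ(λ) - V ξ`. -/
def IsSpectralCharacteristic {Ω : Type*} [MeasurableSpace Ω] (P : Measure Ω) {T : ℕ}
    (ξ : Fin T → ℤ → Ω → ℂ) (f : ℝ → Matrix (Fin T) (Fin T) ℂ) (b : ℕ → Fin T → ℂ)
    (X : Ω → ℂ) (h : ℝ → Fin T → ℂ) : Prop :=
  AEMeasurable h freq ∧ γ.MemPast f h ∧
    ∃ Y : Ω → ℂ, γ.IsSpectralIntegral P ξ f h Y ∧ X =ᵐ[P] fun ω => Y ω - γ.V b ξ ω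

/-! ### The operator `F` -/

/-- The matrix Fourier coefficients
`F(j,k) = (2π)⁻¹ ∫ e^{iλ(k-j)} |β(iλ)|² |χ_μ(e^{-iλ})|⁻² (f⁻¹(λ))ᵀ dλ`. -/
def F {T : ℕ} (f : ℝ → Matrix (Fin T) (Fin T) ℂ) (j k : ℕ) : Matrix (Fin T) (Fin T) ℂ :=
  Matrix.of fun p q =>
    ∫ l, expi ((k : ℤ) - (j : ℤ)) l * ((γ.ratio l : ℝ) : ℂ) * ((f l)⁻¹)ᵀ p q ∂freq

/-- The weight `|β(iλ)|² |χ_μ(e^{-iλ})|⁻² f⁻¹(λ)`. -/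
def invWeight {T : ℕ} (f : ℝ → Matrix (Fin T) (Fin T) ℂ) (l : ℝ) : Matrix (Fin T) (Fin T) ℂ :=
  ((γ.ratio l : ℝ) : ℂ) • (f l)⁻¹

/-- `c = F⁻¹ b`, where `F` is the closed operator determined by the block matrix `F(j,k)` on its
energy space: the completion of the finite sequences in the norm `⟨c, F c⟩^{1/2}`, which is the
norm of `∑ₖ c(k) e^{iλk}` in `L₂` with the weight `|β|² |χ|⁻² f⁻¹`.  The function `C` is the sum
of the series `∑ₖ c(k) e^{iλk}` in that space. -/
def IsFInverse {T : ℕ} (f : ℝ → Matrix (Fin T) (Fin T) ℂ) (b c : ℕ → Fin T → ℂ)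
    (C : ℝ → Fin T → ℂ) : Prop :=
  AEMeasurable C freq ∧ ∃ g : ℕ → (ℕ →₀ (Fin T → ℂ)),
    Tendsto (fun n => weightedSq (γ.invWeight f)
      (fun l => C l - (g n).sum fun k z => expi k l • z)) atTop (𝓝 0) ∧
    (∀ k, Tendsto (fun n => g n k) atTop (𝓝 (c k))) ∧
    ∀ j, Tendsto (fun n => (g n).sum fun k z => γ.F f j k *ᵥ z) atTop (𝓝 (b j))

/-- The operator `Fop` on `ℓ²` is determined by the block matrix `F(j,k)`. -/
def HasMatrixF {T : ℕ} (f : ℝ → Matrix (Fin T) (Fin T) ℂ)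
    (Fop : lp (fun _ : ℕ => EuclideanSpace ℂ (Fin T)) 2 →L[ℂ]
      lp (fun _ : ℕ => EuclideanSpace ℂ (Fin T)) 2) : Prop :=
  ∀ (j k : ℕ) (z : EuclideanSpace ℂ (Fin T)) (p : Fin T),
    Fop (lp.single 2 k z) j p = ∑ q, γ.F f j k p q * z q

/-- `B(e^{iλ}) = ∑ₖ b(k) e^{iλk}`. -/
def _root_.GM.Bfun {T : ℕ} (b : ℕ → Fin T → ℂ) (l : ℝ) : Fin T → ℂ :=
  ∑' k : ℕ, expi k l • b k

/-- `hᵀ = Bᵀ χ_μ(e^{-iλ}) / β(iλ) - (conj β(iλ) / χ_μ(e^{iλ})) Cᵀ f⁻¹(λ)`. -/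
def charFormula {T : ℕ} (f : ℝ → Matrix (Fin T) (Fin T) ℂ) (b : ℕ → Fin T → ℂ)
    (C : ℝ → Fin T → ℂ) (l : ℝ) : Fin T → ℂ :=
  (γ.chi l / γ.beta l) • Bfun b l - (star (γ.beta l) / star (γ.chi l)) • (C l ᵥ* (f l)⁻¹)

/-! ### Canonical factorization -/

/-- `U(λ) = ∑_{k ≥ 0} u(k) e^{iσλk}`, the series converging in `L₂(dλ / (2π))`. -/
def _root_.GM.IsL2Series (σ : ℤ) (u : ℕ → ℂ) (U : ℝ → ℂ) : Prop :=
  MemLp U 2 freq ∧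
    Tendsto (fun N => eLpNorm
      (fun l => U l - ∑ k ∈ Finset.range N, u k * expi (σ * (k : ℤ)) l) 2 freq) atTop (𝓝 0)

/-- The closed linear subspace of `L₂(Ω)` generated by a set of random variables. -/
def _root_.GM.closedSpan {Ω : Type*} [MeasurableSpace Ω] (P : Measure Ω) (S : Set (Ω → ℂ)) :
    Set (Ω → ℂ) :=
  {X | MemLp X 2 P ∧ ∀ δ : ℝ≥0∞, 0 < δ →
    ∃ Y ∈ Submodule.span ℂ S, eLpNorm (fun ω => X ω - Y ω) 2 P < δ}

/-- The canonical factorization of the spectral density: `ε` is an innovation sequence of the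
increments, `φμ` are the coefficients of their canonical one-sided moving average representation,
`f = Φ Φ*` and `|χ_μ|² |β|⁻² f = Φμ Φμ*` with `Φ(e^{-iλ}) = ∑ₖ φ(k) e^{-iλk}` and
`Φμ(e^{-iλ}) = ∑ₖ φμ(k) e^{-iλk}`. -/
structure CanonicalFactorization {Ω : Type*} [MeasurableSpace Ω] (P : Measure Ω) {T q : ℕ}
    (ξ : Fin T → ℤ → Ω → ℂ) (f : ℝ → Matrix (Fin T) (Fin T) ℂ)
    (ε : Fin q → ℤ → Ω → ℂ) (φ φμ : ℕ → Matrix (Fin T) (Fin q) ℂ)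
    (Φ Φμ : ℝ → Matrix (Fin T) (Fin q) ℂ) : Prop where
  memLp : ∀ k u, MemLp (ε k u) 2 P
  orthonormal : ∀ k j u v,
    ∫ ω, ε k u ω * star (ε j v ω) ∂P = if k = j ∧ u = v then 1 else 0
  same_past : ∀ m : ℤ, closedSpan P {X | ∃ p, ∃ k ≤ m, X = γ.inc ξ p k} =
    closedSpan P {X | ∃ j, ∃ u ≤ m, X = ε j u}
  summable : ∀ p j, Summable (fun k => ‖φμ k p j‖ ^ 2)
  moving_average : ∀ p m, Tendsto (fun N => eLpNorm
    (fun ω => γ.inc ξ p m ω - ∑ k ∈ Finset.range N, ∑ j, φμ k p j * ε j (m - (k : ℤ)) ω) 2 P)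
      atTop (𝓝 0)
  series : ∀ p j, IsL2Series (-1) (fun k => φ k p j) (fun l => Φ l p j)
  seriesμ : ∀ p j, IsL2Series (-1) (fun k => φμ k p j) (fun l => Φμ l p j)
  factor : ∀ᵐ l ∂freq, f l = Φ l * (Φ l)ᴴ
  factorμ : ∀ᵐ l ∂freq,
    ((‖γ.chi l‖ ^ 2 / ‖γ.beta l‖ ^ 2 : ℝ) : ℂ) • f l = Φμ l * (Φμ l)ᴴ

/-- `(D A φμ)_k = ∑_{m ≥ 0} ∑_{l ≥ k} φμ(m)ᵀ a(m + l) d(l - k) = ∑_{m ≥ 0} φμ(m)ᵀ (D a)_{m+k}`. -/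
def DA {T q : ℕ} (a : ℕ → Fin T → ℂ) (φμ : ℕ → Matrix (Fin T) (Fin q) ℂ) (k : ℕ) : Fin q → ℂ :=
  ∑' m, (φμ m)ᵀ *ᵥ (∑'[SummationFilter.conditional ℕ] l, γ.dCoef l • a (m + (k + l)))

/-- `h = χ_μ(e^{-iλ}) β(iλ)⁻¹ (B(e^{iλ}) - Ψ(e^{-iλ})ᵀ R(e^{iλ}))`. -/
def charFormula' {T q : ℕ} (b : ℕ → Fin T → ℂ) (Ψ : ℝ → Matrix (Fin q) (Fin T) ℂ)
    (R : ℝ → Fin q → ℂ) (l : ℝ) : Fin T → ℂ :=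
  (γ.chi l / γ.beta l) • (Bfun b l - (Ψ l)ᵀ *ᵥ R l)

end Params

end GM

end

/-!
The theorem is Hilbert space projection, once the random variables are replaced by functions of the
frequency.  A function `h` in `L₂(f)` is represented by `(f^{1/2})ᵀ h` in the unweighted space `Spec T`
of square integrable `ℂᵀ`-valued functions.  Put `G = χ_μ β⁻¹ (f^{1/2})ᵀ` (`Params.incRoot`) and
`N = (Gᴴ)⁻¹` (`Params.dualRoot`).  The increment `χ_μ(ξ_p(k))` corresponds to `e^{ikλ} G δ_p` under an
isometry (`Params.exists_isSpectralIsometry`), and the functions `e^{ikλ} N δ_p`, which are square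
integrable precisely by the minimality condition, form a system biorthogonal to these.

*Duality.*  The main analytic fact is that the orthogonal complement of the past, the closed span of
`e^{ikλ} G δ_p` with `k < 0`, is the future of the dual system, the closed span of `e^{ikλ} N δ_p` with
`k ≥ 0` (`DualPair.mem_future_of_mem_past_orthogonal`).  It comes down to the vanishing of the mean of
`∑ₚ vₚ Cₚ` for integrable `vₚ` with positive frequencies and integrable `Cₚ` with nonnegative ones,
where only the whole sum is known to be integrable (`integral_sum_mul_eq_zero_of_one_sided`).  The
`Cₚ` extend to holomorphic functions in the disc that are dominated there by the Poisson integral of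
`∑ₚ |Cₚ|`, the real part of a holomorphic function `K`.  The multipliers `(1 + ε K)⁻¹` are bounded by
`1` and make the extensions of the `Cₚ` bounded, so that the mean of the damped sum vanishes, and they
tend to `1` as `ε → 0`.

*Algebra of the increments.*  `D` inverts the difference operator `b ↦ ∑ⱼ e(j) b(· + j)` (`Params.E_D`,
`Params.D_E`), and summation by parts writes a finite functional as a combination of increments less
its initial values `V` (`Params.sum_eq_incComb_sub_V`); passing to the limit,
`Aζ = ∫ Bᵀ χ_μ β⁻¹ dZ - Vξ` (`Params.isFunctionalValue_iff`).  As all the characteristic roots of the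
difference operator lie on the unit circle, it has no summable null solutions on a half-line.  So the
error of an admissible combination of the observations has the coefficients `D a` at nonnegative times
and only finitely many others (`Params.admissible_iff`), and the linear estimates are the variables
`∫ x dZ - Vξ` with `x` in the past (`Params.isLinearEstimate_iff`).

*The optimal estimate* is therefore given by the orthogonal projection on the past, and the error `E`
lies in the future.  Its inner products with the dual system are the coefficients of `D a`, because
the dual system with nonnegative indices is orthogonal to the past.  The blocks of `F` form the Gram
matrix of the dual system, hence `F c = D a` says that `C = Gᴴ E`, and `c` consists of the inner products
of `E` with the columns `e^{ikλ} G δ_p` (`Params.isFInverse_iff`).  The formula for the spectral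
characteristic is the identity `G B - N C = G B - E`, and the mean square error is `‖E‖²`.

*The canonical factorization.*  The columns of `e^{iuλ} N (Φ_μᵀ)ᴴ` represent the innovations, and
those with `u < 0` belong to the past (`Params.innov_mem_past`).  The coordinates of `E` in the
innovations therefore have no negative frequencies, and their other Fourier coefficients are those of
the functional (`DualPair.integral_innovFun_error`).  The second formula for the error is Parseval's
identity.
-/


noncomputable section

namespace GM

/-! ### Fourier analysis on the frequency interval -/

lemma norm_expi (k : ℤ) (l : ℝ) : ‖expi k l‖ = 1 := by
  have : Complex.I * (k : ℂ) * (l : ℂ) = ((k * l : ℝ) : ℂ) * Complex.I := by push_cast; ring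
  rw [expi, this, Complex.norm_exp_ofReal_mul_I]

@[simp] lemma expi_zero (l : ℝ) : expi 0 l = 1 := by simp [expi]

lemma expi_add (j k : ℤ) (l : ℝ) : expi (j + k) l = expi j l * expi k l := by
  rw [expi, expi, expi, ← Complex.exp_add]; congr 1; push_cast; ring

lemma star_expi (k : ℤ) (l : ℝ) : star (expi k l) = expi (-k) l := by
  rw [expi, expi, Complex.star_def, ← Complex.exp_conj]; congr 1; simp

lemma expi_natCast (n : ℕ) (l : ℝ) : expi n l = expi 1 l ^ n := by
  rw [expi, expi, ← Complex.exp_nat_mul]; congr 1; push_cast; ring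

lemma continuous_expi (k : ℤ) : Continuous (expi k) := by unfold expi; fun_prop

instance : IsProbabilityMeasure freq := by
  constructor
  rw [freq, Measure.smul_apply, Measure.restrict_apply_univ, Real.volume_Ioc, smul_eq_mul,
    ← ENNReal.ofReal_mul (by positivity)]
  rw [show 1 / (2 * Real.pi) * (Real.pi - -Real.pi) = 1 by field_simp; ring, ENNReal.ofReal_one]

lemma memLp_expi (k : ℤ) (p : ℝ≥0∞) : MemLp (expi k) p freq :=
  MemLp.of_bound (continuous_expi k).aestronglyMeasurable 1
    (ae_of_all _ fun l => (norm_expi k l).le)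

lemma ae_freq_of_ae {p : ℝ → Prop} (h : ∀ᵐ l, p l) : ∀ᵐ l ∂freq, p l :=
  (Measure.ae_smul_measure (ae_restrict_of_ae h) _)

lemma ae_freq_mem : ∀ᵐ l ∂freq, l ∈ Set.Ioc (-Real.pi) Real.pi :=
  Measure.ae_smul_measure (ae_restrict_mem measurableSet_Ioc) _

section circle

/-- Positivity of the length of the circle `ℝ / 2πℤ`. -/
local instance : Fact (0 < 2 * Real.pi) := ⟨Real.two_pi_pos⟩

lemma measurePreserving_coe_freq :
    MeasurePreserving (fun l : ℝ => (l : AddCircle (2 * Real.pi))) freq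
      AddCircle.haarAddCircle := by
  have h := AddCircle.measurePreserving_mk (2 * Real.pi) (-Real.pi)
  refine ⟨h.measurable, ?_⟩
  rw [freq, Measure.map_smul]
  have h2 := h.map_eq
  rw [show -Real.pi + 2 * Real.pi = Real.pi by ring] at h2
  rw [h2, AddCircle.volume_eq_smul_haarAddCircle, smul_smul,
    ← ENNReal.ofReal_mul (by positivity)]
  rw [show 1 / (2 * Real.pi) * (2 * Real.pi) = 1 by field_simp, ENNReal.ofReal_one, one_smul]

lemma fourier_coe_eq_expi (k : ℤ) (l : ℝ) :
    fourier k (l : AddCircle (2 * Real.pi)) = expi k l := by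
  rw [fourier_coe_apply, expi]
  congr 1
  have : (Real.pi : ℂ) ≠ 0 := by exact_mod_cast Real.pi_ne_zero
  push_cast
  field_simp

/-- The representative in `(-π, π]` of a point of the circle. -/
def circleRep (x : AddCircle (2 * Real.pi)) : ℝ := AddCircle.equivIoc (2 * Real.pi) (-Real.pi) x

lemma measurePreserving_circleRep :
    MeasurePreserving circleRep AddCircle.haarAddCircle freq := by
  have hm : Measurable circleRep :=
    measurable_subtype_coe.comp
      (AddCircle.measurableEquivIoc (2 * Real.pi) (-Real.pi)).measurable
  refine ⟨hm, ?_⟩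
  rw [← measurePreserving_coe_freq.map_eq, Measure.map_map hm measurePreserving_coe_freq.measurable]
  have : (circleRep ∘ fun l : ℝ => (l : AddCircle (2 * Real.pi))) =ᵐ[freq] id := by
    filter_upwards [ae_freq_mem] with l hl
    have hl' : l ∈ Set.Ioc (-Real.pi) (-Real.pi + 2 * Real.pi) := by
      rwa [show -Real.pi + 2 * Real.pi = Real.pi by ring]
    simp only [Function.comp, circleRep, AddCircle.equivIoc_coe_of_mem hl', id]
  rw [Measure.map_congr this, Measure.map_id]

lemma integral_expi (k : ℤ) : ∫ l, expi k l ∂freq = if k = 0 then 1 else 0 := by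
  have h := fourierCoeff_fourier (T := 2 * Real.pi) k
  have h2 := congrFun h 0
  rw [fourierCoeff] at h2
  simp only [neg_zero, fourier_zero, one_smul] at h2
  rw [← measurePreserving_coe_freq.map_eq, integral_map measurePreserving_coe_freq.aemeasurable
    (by fun_prop)] at h2
  simp only [fourier_coe_eq_expi] at h2
  rw [h2, Pi.single_apply]
  simp [eq_comm]

/-- Trigonometric polynomials are dense in `L₁`. -/
lemma exists_trigPoly_eLpNorm_sub_lt {φ : ℝ → ℂ} (hφ : Integrable φ freq) {δ : ℝ≥0∞}
    (hδ : 0 < δ) :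
    ∃ c : ℤ →₀ ℂ, eLpNorm (fun l => φ l - c.sum fun k z => z * expi k l) 1 freq < δ := by
  have hφ' : MemLp (φ ∘ circleRep) 1 AddCircle.haarAddCircle :=
    (memLp_one_iff_integrable.2 hφ).comp_measurePreserving measurePreserving_circleRep
  have hd : hφ'.toLp _ ∈ (Submodule.span ℂ (Set.range
      (fourierLp (T := 2 * Real.pi) 1))).topologicalClosure := by
    rw [span_fourierLp_closure_eq_top ENNReal.one_ne_top]; trivial
  rw [← SetLike.mem_coe, Submodule.topologicalClosure_coe, EMetric.mem_closure_iff] at hd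
  obtain ⟨y, hy, hlt⟩ := hd δ hδ
  obtain ⟨c, rfl⟩ := (Finsupp.mem_span_range_iff_exists_finsupp).1 hy
  refine ⟨c, ?_⟩
  rw [Lp.edist_def] at hlt
  refine lt_of_eq_of_lt ?_ hlt
  have hcont : Continuous fun l : ℝ => c.sum fun k z => z * expi k l :=
    continuous_finsetSum _ fun k _ => continuous_const.mul (continuous_expi k)
  refine (eLpNorm_comp_measurePreserving (f := circleRep)
    (hφ.aestronglyMeasurable.sub hcont.aestronglyMeasurable)
    measurePreserving_circleRep).symm.trans ?_
  refine eLpNorm_congr_ae ?_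
  have h1 := hφ'.coeFn_toLp
  have h2 : ((c.sum fun k z => z • fourierLp (T := 2 * Real.pi) 1 k :
      Lp ℂ 1 (AddCircle.haarAddCircle (T := 2 * Real.pi))) : _ → ℂ) =ᵐ[AddCircle.haarAddCircle]
        fun x => c.sum fun k z => z * fourier k x := by
    rw [Finsupp.sum]
    refine (Lp.coeFn_finsetSum _ _).trans ?_
    have : ∀ k ∈ c.support, ((c k • fourierLp (T := 2 * Real.pi) 1 k :
        Lp ℂ 1 (AddCircle.haarAddCircle (T := 2 * Real.pi))) : _ → ℂ) =ᵐ[AddCircle.haarAddCircle]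
        fun x => c k * fourier k x := fun k _ => by
      filter_upwards [Lp.coeFn_smul (c k) (fourierLp (T := 2 * Real.pi) 1 k),
        coeFn_fourierLp (T := 2 * Real.pi) 1 k] with x h1 h2
      rw [h1, Pi.smul_apply, h2, smul_eq_mul]
    have h3 := (Finset.eventually_all c.support).2 this
    filter_upwards [h3] with x hx
    rw [Finset.sum_apply, Finsupp.sum]
    exact Finset.sum_congr rfl hx
  filter_upwards [h1, h2] with x h1 h2
  simp only [Function.comp, Pi.sub_apply, h1, h2]
  congr 1
  refine Finset.sum_congr rfl fun k _ => ?_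
  simp only [← fourier_coe_eq_expi, circleRep, AddCircle.coe_equivIoc]

end circle

/-! ### Holomorphic functions on the disc and integrals over its circles -/

lemma hasSum_integral_mul_pow {φ u : ℝ → ℂ} (hφ : Integrable φ freq) (hu : Continuous u)
    (hu1 : ∀ l, ‖u l‖ = 1) {c : ℕ → ℂ} (hc : Summable fun n => ‖c n‖) :
    HasSum (fun n => c n * ∫ l, u l ^ n * φ l ∂freq) (∫ l, (∑' n, c n * u l ^ n) * φ l ∂freq) := by
  have hI : ∀ n, Integrable (fun l => u l ^ n * φ l) freq := fun n =>
    hφ.bdd_mul (c := 1) (hu.pow n).aestronglyMeasurable (ae_of_all _ fun l => by simp [hu1])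
  have h := hasSum_integral_of_summable_integral_norm (μ := freq)
    (F := fun n l => c n * (u l ^ n * φ l)) (fun n => (hI n).const_mul _) ?_
  · simp only [integral_const_mul] at h
    have e : (∫ l, (∑' n, c n * u l ^ n) * φ l ∂freq) =
        ∫ l, ∑' n, c n * (u l ^ n * φ l) ∂freq := by
      congr 1; ext l; rw [← tsum_mul_right]; simp only [mul_assoc]
    rwa [e]
  · simp only [norm_mul, norm_pow, hu1, one_pow, one_mul, integral_const_mul]
    exact hc.mul_right _

lemma norm_mul_expi {r : ℝ} (hr : 0 ≤ r) (l : ℝ) : ‖(r : ℂ) * expi 1 l‖ = r := by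
  rw [norm_mul, norm_expi, mul_one, Complex.norm_real, Real.norm_of_nonneg hr]

/-- The integral over the circle of radius `r < 1` of a holomorphic function on the unit disc
against an integrable function depends on the nonnegative frequencies only. -/
lemma hasSum_integral_mul_circle {Φ : ℂ → ℂ} (hΦ : DifferentiableOn ℂ Φ (Metric.ball 0 1))
    {r : ℝ} (hr : 0 ≤ r) (hr1 : r < 1) {φ : ℝ → ℂ} (hφ : Integrable φ freq) :
    ∃ c : ℕ → ℂ, c 0 = Φ 0 ∧ HasSum (fun n => c n * ∫ l, expi n l * φ l ∂freq)
      (∫ l, Φ (r * expi 1 l) * φ l ∂freq) := by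
  have hs : ∀ z ∈ Metric.ball (0 : ℂ) 1,
      HasSum (fun n : ℕ => ((n.factorial : ℂ)⁻¹ * iteratedDeriv n Φ 0) * z ^ n) (Φ z) := by
    intro z hz
    have := Complex.hasSum_taylorSeries_on_ball hΦ hz
    refine this.congr_fun fun n => ?_
    simp only [sub_zero, smul_eq_mul]; ring
  have hmem : ∀ l, (r : ℂ) * expi 1 l ∈ Metric.ball (0 : ℂ) 1 := fun l => by
    rw [mem_ball_zero_iff, norm_mul_expi hr]; exact hr1
  refine ⟨fun n => ((n.factorial : ℂ)⁻¹ * iteratedDeriv n Φ 0) * (r : ℂ) ^ n, by simp, ?_⟩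
  have hc := ((hs r (by
    rw [mem_ball_zero_iff, Complex.norm_real, Real.norm_of_nonneg hr]; exact hr1)).summable).norm
  have h := hasSum_integral_mul_pow hφ (continuous_expi 1) (norm_expi 1) hc
  simp only [expi_natCast]
  have e : ∀ l, Φ (r * expi 1 l) =
      ∑' n : ℕ, ((n.factorial : ℂ)⁻¹ * iteratedDeriv n Φ 0) * (r : ℂ) ^ n * expi 1 l ^ n := fun l => by
    rw [← (hs _ (hmem l)).tsum_eq]
    simp only [mul_pow, mul_assoc]
  simp only [e]
  exact h

lemma continuous_comp_circle {Φ : ℂ → ℂ} (hΦ : DifferentiableOn ℂ Φ (Metric.ball 0 1))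
    {r : ℝ} (hr : 0 ≤ r) (hr1 : r < 1) : Continuous fun l => Φ (r * expi 1 l) :=
  hΦ.continuousOn.comp_continuous (continuous_const.mul (continuous_expi 1)) fun l => by
    rw [mem_ball_zero_iff, norm_mul_expi hr]; exact hr1

lemma integral_circle {Φ : ℂ → ℂ} (hΦ : DifferentiableOn ℂ Φ (Metric.ball 0 1))
    {r : ℝ} (hr : 0 ≤ r) (hr1 : r < 1) : ∫ l, Φ (r * expi 1 l) ∂freq = Φ 0 := by
  obtain ⟨c, hc0, hc⟩ := hasSum_integral_mul_circle hΦ hr hr1 (integrable_const (1 : ℂ))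
  simp only [mul_one] at hc
  refine hc.unique ?_
  have := hasSum_ite_eq (0 : ℕ) (Φ 0)
  refine this.congr_fun fun n => ?_
  rw [integral_expi]
  rcases eq_or_ne n 0 with rfl | hn
  · simp [hc0]
  · simp [hn]

/-- A holomorphic function has nonnegative frequencies on circles, so its product with a function
with positive frequencies only has mean zero. -/
lemma integral_mul_circle_eq_zero {Φ : ℂ → ℂ} (hΦ : DifferentiableOn ℂ Φ (Metric.ball 0 1))
    {r : ℝ} (hr : 0 ≤ r) (hr1 : r < 1) {v : ℝ → ℂ} (hv : Integrable v freq)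
    (hv0 : ∀ k : ℕ, ∫ l, expi k l * v l ∂freq = 0) :
    ∫ l, Φ (r * expi 1 l) * v l ∂freq = 0 := by
  obtain ⟨c, -, hc⟩ := hasSum_integral_mul_circle hΦ hr hr1 hv
  refine hc.unique ?_
  simpa only [hv0, mul_zero] using! (hasSum_zero (α := ℂ) (β := ℕ))

/-! ### Cauchy and Poisson integrals -/

/-- The Cauchy integral `∑ₙ φ̂(n) zⁿ` of an integrable function on the circle. -/
def cauchyInt (φ : ℝ → ℂ) (z : ℂ) : ℂ := ∑' n : ℕ, z ^ n * ∫ l, expi (-n) l * φ l ∂freq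

/-- The Poisson kernel of the unit disc, at the interior point `z` and the boundary point
`e^{it}`. -/
def poissonKer (z : ℂ) (t : ℝ) : ℝ := (2 * (1 - z * expi (-1) t)⁻¹ - 1).re

/-- The Poisson integral of an integrable function on the circle. -/
def poissonInt (φ : ℝ → ℂ) (z : ℂ) : ℂ := ∫ t, (poissonKer z t : ℂ) * φ t ∂freq

lemma norm_integral_expi_mul_le (φ : ℝ → ℂ) (k : ℤ) :
    ‖∫ l, expi k l * φ l ∂freq‖ ≤ ∫ l, ‖φ l‖ ∂freq := by
  refine (norm_integral_le_integral_norm _).trans (le_of_eq ?_)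
  simp [norm_expi]

lemma differentiableOn_cauchyInt (φ : ℝ → ℂ) :
    DifferentiableOn ℂ (cauchyInt φ) (Metric.ball 0 1) := by
  intro z hz
  rw [mem_ball_zero_iff] at hz
  obtain ⟨R, hR, hR1⟩ := exists_between hz
  have hR0 : 0 ≤ R := (norm_nonneg z).trans hR.le
  have : DifferentiableOn ℂ (cauchyInt φ) (Metric.ball 0 R) := by
    refine Complex.differentiableOn_tsum_of_summable_norm
      (u := fun n : ℕ => R ^ n * ∫ l, ‖φ l‖ ∂freq)
      ((summable_geometric_of_lt_one hR0 hR1).mul_right _)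
      (fun n => by fun_prop) Metric.isOpen_ball fun n w hw => ?_
    rw [norm_mul, norm_pow]
    rw [mem_ball_zero_iff] at hw
    exact mul_le_mul (pow_le_pow_left₀ (norm_nonneg _) hw.le _) (norm_integral_expi_mul_le _ _)
      (norm_nonneg _) (pow_nonneg hR0 _)
  exact (this.differentiableAt (Metric.isOpen_ball.mem_nhds
    (mem_ball_zero_iff.2 hR))).differentiableWithinAt

/-- The geometric expansion of the Cauchy kernel, for the frequencies of either sign `σ`. -/
lemma hasSum_cauchyKer {φ : ℝ → ℂ} (hφ : Integrable φ freq) {z : ℂ} (hz : ‖z‖ < 1) {σ : ℤ} :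
    HasSum (fun n : ℕ => z ^ n * ∫ l, expi (σ * n) l * φ l ∂freq)
      (∫ l, (1 - z * expi σ l)⁻¹ * φ l ∂freq) := by
  have h := hasSum_integral_mul_pow hφ (continuous_expi σ) (norm_expi σ) (c := fun n => z ^ n)
    (by simpa using summable_geometric_of_lt_one (norm_nonneg z) hz)
  have h2 : ∀ (n : ℕ) l, expi σ l ^ n = expi (σ * n) l := fun n l => by
    rw [expi, expi, ← Complex.exp_nat_mul]; congr 1; push_cast; ring
  have e : ∀ l, ∑' n : ℕ, z ^ n * expi σ l ^ n = (1 - z * expi σ l)⁻¹ := fun l => by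
    simp only [← mul_pow]
    rw [tsum_geometric_of_norm_lt_one (by rwa [norm_mul, norm_expi, mul_one])]
  simp only [e] at h
  simp only [h2] at h
  exact h

/-- Cauchy's integral formula for the series defining `cauchyInt`. -/
lemma cauchyInt_eq {φ : ℝ → ℂ} (hφ : Integrable φ freq) {z : ℂ} (hz : ‖z‖ < 1) :
    cauchyInt φ z = ∫ l, (1 - z * expi (-1) l)⁻¹ * φ l ∂freq := by
  rw [← (hasSum_cauchyKer hφ hz).tsum_eq, cauchyInt]
  simp

lemma one_sub_ne_zero {w : ℂ} (hw : ‖w‖ < 1) : 1 - w ≠ 0 := by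
  intro h
  rw [sub_eq_zero] at h
  rw [← h] at hw
  simp at hw

/-- The positivity of the Poisson kernel, in terms of `w = z e^{-it}`. -/
lemma re_two_mul_inv_sub_one {w : ℂ} (hw : ‖w‖ < 1) :
    (2 * (1 - w)⁻¹ - 1).re = (1 - ‖w‖ ^ 2) / ‖1 - w‖ ^ 2 := by
  have h0 := one_sub_ne_zero hw
  have h1 : ‖1 - w‖ ^ 2 ≠ 0 := by simpa using h0
  have : (2 * (1 - w)⁻¹ - 1) = (1 + w) * (starRingEnd ℂ) (1 - w) / ((‖1 - w‖ ^ 2 : ℝ) : ℂ) := by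
    rw [Complex.ofReal_pow, ← Complex.mul_conj']
    have : (starRingEnd ℂ) (1 - w) ≠ 0 := by
      rwa [Ne, map_eq_zero]
    field_simp
    ring
  rw [this, Complex.div_ofReal_re, ← Complex.normSq_eq_norm_sq w, Complex.normSq_apply]
  congr 1
  simp
  ring

lemma norm_mul_expi_lt {z : ℂ} (hz : ‖z‖ < 1) (k : ℤ) (l : ℝ) : ‖z * expi k l‖ < 1 := by
  rwa [norm_mul, norm_expi, mul_one]

lemma poissonKer_nonneg {z : ℂ} (hz : ‖z‖ < 1) (t : ℝ) : 0 ≤ poissonKer z t := by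
  have h := norm_mul_expi_lt hz (-1) t
  rw [poissonKer, re_two_mul_inv_sub_one h]
  have : ‖z * expi (-1) t‖ ^ 2 ≤ 1 := pow_le_one₀ (norm_nonneg _) h.le
  exact div_nonneg (by linarith) (by positivity)

lemma poissonKer_eq {z : ℂ} (t : ℝ) : (poissonKer z t : ℂ) =
    (1 - z * expi (-1) t)⁻¹ + (1 - star z * expi 1 t)⁻¹ - 1 := by
  have h : (1 - star z * expi 1 t)⁻¹ = (starRingEnd ℂ) ((1 - z * expi (-1) t)⁻¹) := by
    have := star_expi (-1) t
    rw [Complex.star_def, neg_neg] at this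
    rw [map_inv₀, map_sub, map_mul, map_one, this]; rfl
  rw [h, poissonKer, Complex.add_conj]
  push_cast
  simp

lemma continuous_cauchyKer {z : ℂ} (hz : ‖z‖ < 1) (k : ℤ) :
    Continuous fun t => (1 - z * expi k t)⁻¹ :=
  (continuous_const.sub (continuous_const.mul (continuous_expi k))).inv₀ fun t =>
    one_sub_ne_zero (norm_mul_expi_lt hz k t)

lemma norm_cauchyKer_le {z : ℂ} (hz : ‖z‖ < 1) (k : ℤ) (t : ℝ) :
    ‖(1 - z * expi k t)⁻¹‖ ≤ (1 - ‖z‖)⁻¹ := by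
  rw [norm_inv]
  have : 1 - ‖z‖ ≤ ‖1 - z * expi k t‖ := by
    have := norm_sub_norm_le (1 : ℂ) (z * expi k t)
    rwa [norm_mul, norm_expi, mul_one, norm_one] at this
  exact inv_anti₀ (by linarith) this

lemma integrable_cauchyKer_mul {φ : ℝ → ℂ} (hφ : Integrable φ freq) {z : ℂ} (hz : ‖z‖ < 1) (k : ℤ) :
    Integrable (fun t => (1 - z * expi k t)⁻¹ * φ t) freq :=
  hφ.bdd_mul (continuous_cauchyKer hz k).aestronglyMeasurable
    (ae_of_all _ (norm_cauchyKer_le hz k))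

/-- The Poisson integral is the sum of a holomorphic and an antiholomorphic part. -/
lemma poissonInt_eq {φ : ℝ → ℂ} (hφ : Integrable φ freq) {z : ℂ} (hz : ‖z‖ < 1) :
    poissonInt φ z = cauchyInt φ z + (∫ t, (1 - star z * expi 1 t)⁻¹ * φ t ∂freq)
      - ∫ t, φ t ∂freq := by
  have hz' : ‖star z‖ < 1 := by rwa [norm_star]
  have h1 := integrable_cauchyKer_mul hφ hz (-1)
  have h2 := integrable_cauchyKer_mul hφ hz' 1
  rw [cauchyInt_eq hφ hz, poissonInt, ← integral_add' h1 h2, ← integral_sub' (h1.add h2) hφ]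
  congr 1; ext t
  simp only [poissonKer_eq, Pi.add_apply, Pi.sub_apply]
  ring

/-- A function without negative frequencies: its Poisson integral is its Cauchy integral, and so
is holomorphic. -/
lemma poissonInt_eq_cauchyInt {φ : ℝ → ℂ} (hφ : Integrable φ freq)
    (h0 : ∀ k : ℕ, k ≠ 0 → ∫ l, expi k l * φ l ∂freq = 0) {z : ℂ} (hz : ‖z‖ < 1) :
    poissonInt φ z = cauchyInt φ z := by
  have hz' : ‖star z‖ < 1 := by rwa [norm_star]
  have h := hasSum_cauchyKer hφ hz' (σ := 1)
  have h2 := h.unique ((hasSum_ite_eq (0 : ℕ) (∫ t, φ t ∂freq)).congr_fun fun n => by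
    rcases eq_or_ne n 0 with rfl | hn
    · simp
    · simp [hn, h0 n hn])
  rw [poissonInt_eq hφ hz, h2]; ring

lemma integrable_poissonKer_mul {φ : ℝ → ℂ} (hφ : Integrable φ freq) {z : ℂ} (hz : ‖z‖ < 1) :
    Integrable (fun t => (poissonKer z t : ℂ) * φ t) freq := by
  have hz' : ‖star z‖ < 1 := by rwa [norm_star]
  refine (((integrable_cauchyKer_mul hφ hz (-1)).add
    (integrable_cauchyKer_mul hφ hz' 1)).sub hφ).congr (ae_of_all _ fun t => ?_)
  simp only [poissonKer_eq, Pi.add_apply, Pi.sub_apply]; ring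

lemma norm_poissonInt_le (φ : ℝ → ℂ) {z : ℂ} (hz : ‖z‖ < 1) :
    ‖poissonInt φ z‖ ≤ ∫ t, poissonKer z t * ‖φ t‖ ∂freq := by
  refine (norm_integral_le_integral_norm _).trans (le_of_eq ?_)
  simp only [norm_mul, Complex.norm_real, Real.norm_of_nonneg (poissonKer_nonneg hz _)]

lemma integrable_poissonKer_mul_norm {φ : ℝ → ℂ} (hφ : Integrable φ freq) {z : ℂ} (hz : ‖z‖ < 1) :
    Integrable (fun t => poissonKer z t * ‖φ t‖) freq := by
  refine (integrable_poissonKer_mul hφ hz).norm.congr (ae_of_all _ fun t => ?_)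
  simp only [norm_mul, Complex.norm_real, Real.norm_of_nonneg (poissonKer_nonneg hz _)]

lemma integral_poissonKer_circle {r : ℝ} (hr : 0 ≤ r) (hr1 : r < 1) (t : ℝ) :
    ∫ l, poissonKer (r * expi 1 l) t ∂freq = 1 := by
  have hd : DifferentiableOn ℂ (fun z => 2 * (1 - z * expi (-1) t)⁻¹ - 1) (Metric.ball 0 1) := by
    intro z hz
    rw [mem_ball_zero_iff] at hz
    have := one_sub_ne_zero (norm_mul_expi_lt hz (-1) t)
    exact DifferentiableAt.differentiableWithinAt (by fun_prop (disch := assumption))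
  have h := integral_circle hd hr hr1
  have hi : Integrable (fun l => 2 * (1 - (r : ℂ) * expi 1 l * expi (-1) t)⁻¹ - 1) freq := by
    refine Integrable.of_bound (continuous_comp_circle hd hr hr1).aestronglyMeasurable
      (2 * (1 - r)⁻¹ + 1) (ae_of_all _ fun l => ?_)
    refine (norm_sub_le _ _).trans ?_
    rw [norm_mul, norm_one]
    have := norm_cauchyKer_le (z := r * expi 1 l) (by rwa [norm_mul_expi hr]) (-1) t
    rw [norm_mul_expi hr] at this
    norm_num
    simpa using this
  have h3 := integral_re hi
  rw [h] at h3
  simp only [poissonKer]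
  refine h3.trans ?_
  norm_num

lemma continuous_poissonKer_circle {r : ℝ} (hr : 0 ≤ r) (hr1 : r < 1) :
    Continuous fun x : ℝ × ℝ => poissonKer (r * expi 1 x.1) x.2 := by
  unfold poissonKer
  refine Complex.continuous_re.comp ((continuous_const.mul (Continuous.inv₀ ?_ fun x => ?_)).sub
    continuous_const)
  · exact continuous_const.sub ((continuous_const.mul
      ((continuous_expi 1).comp continuous_fst)).mul ((continuous_expi (-1)).comp continuous_snd))
  · exact one_sub_ne_zero (norm_mul_expi_lt (by rwa [norm_mul_expi hr]) _ _)

lemma poissonKer_le {r : ℝ} (hr : 0 ≤ r) (hr1 : r < 1) (l t : ℝ) :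
    ‖poissonKer (r * expi 1 l) t‖ ≤ 2 * (1 - r)⁻¹ + 1 := by
  refine (Complex.abs_re_le_norm _).trans ((norm_sub_le _ _).trans ?_)
  rw [norm_mul, norm_one]
  have := norm_cauchyKer_le (z := r * expi 1 l) (by rwa [norm_mul_expi hr]) (-1) t
  rw [norm_mul_expi hr] at this
  norm_num
  simpa using this

lemma integrable_prod_poisson {φ : ℝ → ℂ} (hφ : Integrable φ freq) {r : ℝ} (hr : 0 ≤ r)
    (hr1 : r < 1) : Integrable (fun x : ℝ × ℝ => (poissonKer (r * expi 1 x.1) x.2 : ℂ) * φ x.2)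
      (freq.prod freq) := by
  refine (hφ.comp_snd freq).bdd_mul (c := 2 * (1 - r)⁻¹ + 1)
    (Complex.continuous_ofReal.comp (continuous_poissonKer_circle hr hr1)).aestronglyMeasurable
    (ae_of_all _ fun x => ?_)
  simpa only [Complex.norm_real] using poissonKer_le hr hr1 _ _

lemma integrable_poissonInt_circle {φ : ℝ → ℂ} (hφ : Integrable φ freq) {r : ℝ} (hr : 0 ≤ r)
    (hr1 : r < 1) : Integrable (fun l => poissonInt φ (r * expi 1 l)) freq :=
  (integrable_prod_poisson hφ hr hr1).integral_prod_left

lemma integral_norm_poissonInt_le {φ : ℝ → ℂ} (hφ : Integrable φ freq) {r : ℝ} (hr : 0 ≤ r)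
    (hr1 : r < 1) : ∫ l, ‖poissonInt φ (r * expi 1 l)‖ ∂freq ≤ ∫ l, ‖φ l‖ ∂freq := by
  have hp := (integrable_prod_poisson hφ hr hr1).norm
  calc ∫ l, ‖poissonInt φ (r * expi 1 l)‖ ∂freq
      ≤ ∫ l, ∫ t, ‖(poissonKer (r * expi 1 l) t : ℂ) * φ t‖ ∂freq ∂freq :=
        integral_mono (integrable_poissonInt_circle hφ hr hr1).norm hp.integral_prod_left
          fun l => norm_integral_le_integral_norm _
    _ = ∫ t, ∫ l, ‖(poissonKer (r * expi 1 l) t : ℂ) * φ t‖ ∂freq ∂freq :=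
        integral_integral_swap hp
    _ = ∫ l, ‖φ l‖ ∂freq := by
        congr 1; ext t
        have : ∀ l, ‖(poissonKer (r * expi 1 l) t : ℂ) * φ t‖ =
            poissonKer (r * expi 1 l) t * ‖φ t‖ := fun l => by
          rw [norm_mul, Complex.norm_real,
            Real.norm_of_nonneg (poissonKer_nonneg (by rwa [norm_mul_expi hr]) _)]
        simp only [this]
        rw [integral_mul_const, integral_poissonKer_circle hr hr1, one_mul]

lemma poissonInt_expi (k : ℤ) {r : ℝ} (hr : 0 ≤ r) (hr1 : r < 1) (l : ℝ) :
    poissonInt (expi k) (r * expi 1 l) = (r : ℂ) ^ k.natAbs * expi k l := by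
  have hz : ‖(r : ℂ) * expi 1 l‖ < 1 := by rwa [norm_mul_expi hr]
  have hz' : ‖star ((r : ℂ) * expi 1 l)‖ < 1 := by rwa [norm_star]
  have hi : Integrable (expi k) freq := memLp_one_iff_integrable.1 (memLp_expi k 1)
  have h1 := hasSum_cauchyKer hi hz (σ := -1)
  have h2 := hasSum_cauchyKer hi hz' (σ := 1)
  simp only [← expi_add, integral_expi] at h1 h2
  rw [poissonInt_eq hi hz, cauchyInt_eq hi hz, integral_expi]
  have hst : star ((r : ℂ) * expi 1 l) = r * expi (-1) l := by
    rw [star_mul', star_expi]; simp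
  have hpow : ∀ (σ : ℤ) (n : ℕ), expi σ l ^ n = expi (σ * n) l := fun σ n => by
    rw [expi, expi, ← Complex.exp_nat_mul]; congr 1; push_cast; ring
  rw [hst] at h2 ⊢
  rcases Int.eq_nat_or_neg k with ⟨n, rfl | rfl⟩
  · rw [h1.unique (hasSum_single n fun m hm => by
      rw [if_neg (by omega), mul_zero])]
    rw [h2.unique (hasSum_single 0 fun m hm => by rw [if_neg (by omega), mul_zero])]
    simp [mul_pow, hpow]
  · rw [h2.unique (hasSum_single n fun m hm => by
      rw [if_neg (by omega), mul_zero])]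
    rw [h1.unique (hasSum_single 0 fun m hm => by rw [if_neg (by omega), mul_zero])]
    simp [mul_pow, hpow]

lemma exists_trigPoly_integral_norm_sub_lt {φ : ℝ → ℂ} (hφ : Integrable φ freq) {δ : ℝ}
    (hδ : 0 < δ) :
    ∃ c : ℤ →₀ ℂ, ∫ l, ‖φ l - c.sum fun k z => z * expi k l‖ ∂freq < δ := by
  obtain ⟨c, hc⟩ := exists_trigPoly_eLpNorm_sub_lt hφ (ENNReal.ofReal_pos.2 hδ)
  refine ⟨c, ?_⟩
  have hcont : Continuous fun l : ℝ => c.sum fun k z => z * expi k l :=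
    continuous_finsetSum _ fun k _ => continuous_const.mul (continuous_expi k)
  rw [eLpNorm_one_eq_lintegral_enorm] at hc
  refine lt_of_eq_of_lt (integral_norm_eq_lintegral_enorm
    (hφ.aestronglyMeasurable.sub hcont.aestronglyMeasurable)) ?_
  rw [← ENNReal.toReal_ofReal hδ.le]
  exact ENNReal.toReal_strict_mono ENNReal.ofReal_ne_top hc

lemma integrable_trigPoly (c : ℤ →₀ ℂ) :
    Integrable (fun l : ℝ => c.sum fun k z => z * expi k l) freq :=
  integrable_finsetSum _ fun k _ =>
    (memLp_one_iff_integrable.1 (memLp_expi k 1)).const_mul _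

/-- Poisson integrals converge to the boundary function in `L₁`. -/
lemma tendsto_integral_norm_poissonInt_sub {φ : ℝ → ℂ} (hφ : Integrable φ freq) {r : ℕ → ℝ}
    (hr : ∀ n, 0 ≤ r n) (hr1 : ∀ n, r n < 1) (hlim : Tendsto r atTop (𝓝 1)) :
    Tendsto (fun n => ∫ l, ‖poissonInt φ (r n * expi 1 l) - φ l‖ ∂freq) atTop (𝓝 0) := by
  rw [Metric.tendsto_atTop]
  intro δ hδ
  obtain ⟨c, hc⟩ := exists_trigPoly_integral_norm_sub_lt hφ (show 0 < δ / 3 by positivity)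
  set q : ℝ → ℂ := fun l => c.sum fun k z => z * expi k l with hq
  have hqi : Integrable q freq := integrable_trigPoly c
  have hlin : ∀ n l, poissonInt φ (r n * expi 1 l) =
      poissonInt (fun l => φ l - q l) (r n * expi 1 l) + poissonInt q (r n * expi 1 l) := by
    intro n l
    have hz : ‖(r n : ℂ) * expi 1 l‖ < 1 := by rw [norm_mul_expi (hr n)]; exact hr1 n
    rw [poissonInt, poissonInt, poissonInt, ← integral_add
      (f := fun t => (poissonKer (r n * expi 1 l) t : ℂ) * (φ t - q t))
      (integrable_poissonKer_mul (hφ.sub hqi) hz) (integrable_poissonKer_mul hqi hz)]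
    congr 1; ext t; ring
  have hpq : ∀ n l, poissonInt q (r n * expi 1 l) =
      c.sum fun k z => z * ((r n : ℂ) ^ k.natAbs * expi k l) := by
    intro n l
    have hz : ‖(r n : ℂ) * expi 1 l‖ < 1 := by rw [norm_mul_expi (hr n)]; exact hr1 n
    simp only [← poissonInt_expi _ (hr n) (hr1 n) l]
    simp only [poissonInt, hq, Finsupp.sum, Finset.mul_sum]
    rw [integral_finsetSum _ fun k _ => ?_]
    · refine Finset.sum_congr rfl fun k _ => ?_
      rw [← integral_const_mul]; congr 1; ext t; ring
    · exact integrable_poissonKer_mul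
        ((memLp_one_iff_integrable.1 (memLp_expi k 1)).const_mul (c k)) hz
  have hb : ∀ n l, ‖poissonInt q (r n * expi 1 l) - q l‖ ≤
      c.sum fun k z => ‖z‖ * ‖(r n : ℂ) ^ k.natAbs - 1‖ := by
    intro n l
    rw [hpq, hq]
    simp only [Finsupp.sum, ← Finset.sum_sub_distrib]
    refine (norm_sum_le _ _).trans (Finset.sum_le_sum fun k _ => ?_)
    rw [← mul_sub, norm_mul, show (r n : ℂ) ^ k.natAbs * expi k l - expi k l =
      ((r n : ℂ) ^ k.natAbs - 1) * expi k l by ring, norm_mul, norm_expi, mul_one]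
  have hb0 : Tendsto (fun n => c.sum fun k z => ‖z‖ * ‖(r n : ℂ) ^ k.natAbs - 1‖) atTop (𝓝 0) := by
    have : Tendsto (fun n => ∑ k ∈ c.support, ‖c k‖ * ‖(r n : ℂ) ^ k.natAbs - 1‖) atTop
        (𝓝 (∑ k ∈ c.support, ‖c k‖ * ‖((1 : ℝ) : ℂ) ^ k.natAbs - 1‖)) := by
      refine tendsto_finsetSum _ fun k _ => (Tendsto.norm ?_).const_mul _
      exact (((Complex.continuous_ofReal.tendsto 1).comp hlim).pow _).sub_const _
    simpa [Finsupp.sum] using this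
  obtain ⟨N, hN⟩ := (Metric.tendsto_atTop.1 hb0) (δ / 3) (by positivity)
  refine ⟨N, fun n hn => ?_⟩
  have h1 := hN n hn
  rw [Real.dist_eq, sub_zero] at h1 ⊢
  rw [abs_of_nonneg (integral_nonneg fun _ => norm_nonneg _)]
  have hs : Integrable (fun l => φ l - q l) freq := hφ.sub hqi
  have hi1 := integrable_poissonInt_circle hs (hr n) (hr1 n)
  have hi2 := integrable_poissonInt_circle hqi (hr n) (hr1 n)
  calc ∫ l, ‖poissonInt φ (r n * expi 1 l) - φ l‖ ∂freq
      ≤ ∫ l, (‖poissonInt (fun l => φ l - q l) (r n * expi 1 l)‖ +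
          ‖poissonInt q (r n * expi 1 l) - q l‖ + ‖φ l - q l‖) ∂freq := by
        refine integral_mono ((integrable_poissonInt_circle hφ (hr n) (hr1 n)).sub hφ).norm
          ((hi1.norm.add (hi2.sub hqi).norm).add (hφ.sub hqi).norm) fun l => ?_
        simp only [hlin n l]
        refine le_trans (le_of_eq ?_) ((norm_sub_le _ _).trans
          (add_le_add_left (norm_add_le _ _) _))
        congr 1; ring
    _ = (∫ l, ‖poissonInt (fun l => φ l - q l) (r n * expi 1 l)‖ ∂freq) +
          (∫ l, ‖poissonInt q (r n * expi 1 l) - q l‖ ∂freq) + ∫ l, ‖φ l - q l‖ ∂freq := by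
        have e1 := integral_add' (hi1.norm.add (hi2.sub hqi).norm) hs.norm
        have e2 := integral_add' hi1.norm (hi2.sub hqi).norm
        exact e1.trans (congrArg (· + _) e2)
    _ < δ / 3 + δ / 3 + δ / 3 := by
        have h2 := (integral_norm_poissonInt_le (hφ.sub hqi) (hr n) (hr1 n)).trans_lt hc
        have h3 : ∫ l, ‖poissonInt q (r n * expi 1 l) - q l‖ ∂freq < δ / 3 := by
          refine lt_of_le_of_lt ?_ ((le_abs_self _).trans_lt h1)
          refine (integral_mono (hi2.sub hqi).norm (integrable_const _) (hb n)).trans ?_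
          simp
        exact add_lt_add (add_lt_add h2 h3) hc
    _ = δ := by ring

/-- An integrable function is determined by its Fourier coefficients. -/
lemma ae_eq_zero_of_integral_expi_eq_zero {φ : ℝ → ℂ} (hφ : Integrable φ freq)
    (h0 : ∀ k : ℤ, ∫ l, expi k l * φ l ∂freq = 0) : φ =ᵐ[freq] 0 := by
  have hlim := tendsto_one_div_add_atTop_nhds_zero_nat (𝕜 := ℝ)
  have hr : ∀ n : ℕ, 0 < 1 / ((n : ℝ) + 1) := fun n => by positivity
  have hr' : ∀ n : ℕ, 1 / ((n : ℝ) + 1) ≤ 1 := fun n => by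
    rw [div_le_one (by positivity)]; linarith [(Nat.cast_nonneg n : (0 : ℝ) ≤ n)]
  have h := tendsto_integral_norm_poissonInt_sub hφ (r := fun n => 1 - 1 / ((n : ℝ) + 1))
    (fun n => by linarith [hr' n]) (fun n => by linarith [hr n])
    (by simpa using hlim.const_sub 1)
  have hz : ∀ (n : ℕ) l, poissonInt φ (((1 - 1 / ((n : ℝ) + 1) : ℝ) : ℂ) * expi 1 l) = 0 := by
    intro n l
    have hz : ‖((1 - 1 / ((n : ℝ) + 1) : ℝ) : ℂ) * expi 1 l‖ < 1 := by
      rw [norm_mul_expi (by linarith [hr' n])]; linarith [hr n]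
    rw [poissonInt_eq_cauchyInt hφ (fun k _ => h0 k) hz, cauchyInt]
    simp [h0]
  simp only [hz, zero_sub, norm_neg] at h
  have h2 := tendsto_nhds_unique h tendsto_const_nhds
  rw [eq_comm, integral_eq_zero_iff_of_nonneg (fun _ => norm_nonneg _) hφ.norm] at h2
  filter_upwards [h2] with l hl
  simpa using hl

/-! ### Products of functions with one-sided spectra -/

/-- Convergence in mean of nonnegative functions implies convergence almost everywhere along a
subsequence. -/
lemma exists_seq_tendsto_ae_of_tendsto_integral {h : ℕ → ℝ → ℝ} (hi : ∀ n, Integrable (h n) freq)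
    (h0 : ∀ n l, 0 ≤ h n l) (hlim : Tendsto (fun n => ∫ l, h n l ∂freq) atTop (𝓝 0)) :
    ∃ ns : ℕ → ℕ, StrictMono ns ∧ ∀ᵐ l ∂freq, Tendsto (fun n => h (ns n) l) atTop (𝓝 0) := by
  have hm : TendstoInMeasure freq h atTop (0 : ℝ → ℝ) := by
    refine tendstoInMeasure_of_tendsto_eLpNorm one_ne_zero
      (fun n => (hi n).aestronglyMeasurable) aestronglyMeasurable_zero ?_
    have : ∀ n, eLpNorm (h n - 0) 1 freq = ENNReal.ofReal (∫ l, h n l ∂freq) := fun n => by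
      rw [sub_zero, eLpNorm_one_eq_lintegral_enorm, ofReal_integral_eq_lintegral_ofReal (hi n)
        (ae_of_all _ (h0 n))]
      congr 1; ext l
      rw [Real.enorm_of_nonneg (h0 n l)]
    simp only [this]
    simpa [Function.comp_def] using (ENNReal.continuous_ofReal.tendsto 0).comp hlim
  exact hm.exists_seq_tendsto_ae

/-- The holomorphic function on the disc whose real part is the Poisson integral of `κ`. -/
def herglotz (κ : ℝ → ℝ) (z : ℂ) : ℂ := 2 * cauchyInt (fun t => (κ t : ℂ)) z - ∫ t, (κ t : ℂ) ∂freq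

lemma differentiableOn_herglotz (κ : ℝ → ℝ) :
    DifferentiableOn ℂ (herglotz κ) (Metric.ball 0 1) :=
  ((differentiableOn_cauchyInt _).const_mul _).sub_const _

lemma herglotz_zero (κ : ℝ → ℝ) : herglotz κ 0 = ((∫ t, κ t ∂freq : ℝ) : ℂ) := by
  have : cauchyInt (fun t => (κ t : ℂ)) 0 = ∫ t, (κ t : ℂ) ∂freq := by
    rw [cauchyInt, tsum_eq_single 0 (fun n hn => by simp [hn])]; simp
  rw [herglotz, this, integral_complex_ofReal]; ring

lemma re_herglotz {κ : ℝ → ℝ} (hκ : Integrable κ freq) {z : ℂ} (hz : ‖z‖ < 1) :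
    (herglotz κ z).re = ∫ t, poissonKer z t * κ t ∂freq := by
  have hc : Integrable (fun t => (κ t : ℂ)) freq := hκ.ofReal
  have h1 := integrable_cauchyKer_mul hc hz (-1)
  have h2 := (h1.const_mul 2).sub hc
  rw [herglotz, cauchyInt_eq hc hz, ← integral_const_mul, ← integral_sub' (h1.const_mul 2) hc]
  refine (integral_re h2).symm.trans (integral_congr_ae (ae_of_all _ fun t => ?_))
  simp only [poissonKer, Pi.sub_apply]
  rw [show (2 : ℂ) * ((1 - z * expi (-1) t)⁻¹ * (κ t : ℂ)) - (κ t : ℂ) =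
    (2 * (1 - z * expi (-1) t)⁻¹ - 1) * (κ t : ℂ) by ring]
  exact Complex.re_mul_ofReal _ _

/-- The bounded multiplier `(1 + ε K)⁻¹`, where `K` has the Poisson integral of `κ` as its real
part. -/
def damp (κ : ℝ → ℝ) (ε : ℝ) (z : ℂ) : ℂ := (1 + ε * herglotz κ z)⁻¹

section damp

variable {κ : ℝ → ℝ} (hκ : Integrable κ freq) (hκ0 : ∀ t, 0 ≤ κ t) {ε : ℝ} (hε : 0 < ε)
  {z : ℂ} (hz : ‖z‖ < 1)

include hκ hκ0 hz in
lemma re_herglotz_nonneg : 0 ≤ (herglotz κ z).re := by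
  rw [re_herglotz hκ hz]
  exact integral_nonneg fun t => mul_nonneg (poissonKer_nonneg hz t) (hκ0 t)

lemma le_norm_one_add_herglotz :
    1 + ε * (herglotz κ z).re ≤ ‖1 + ε * herglotz κ z‖ := by
  refine le_trans (le_of_eq ?_) (Complex.re_le_norm _)
  simp

include hκ hκ0 hε hz in
lemma norm_damp_le_one : ‖damp κ ε z‖ ≤ 1 := by
  rw [damp, norm_inv]
  have h1 := le_norm_one_add_herglotz (κ := κ) (ε := ε) (z := z)
  have h2 := mul_nonneg hε.le (re_herglotz_nonneg hκ hκ0 hz)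
  exact inv_le_one_of_one_le₀ (by linarith)

include hκ hκ0 hε hz in
/-- The multiplier makes every function dominated by the real part of `K` bounded. -/
lemma norm_damp_mul_le {w : ℂ} (hw : ‖w‖ ≤ (herglotz κ z).re) : ‖damp κ ε z * w‖ ≤ ε⁻¹ := by
  rw [damp, norm_mul, norm_inv]
  have h1 := le_norm_one_add_herglotz (κ := κ) (ε := ε) (z := z)
  have h2 := mul_nonneg hε.le (re_herglotz_nonneg hκ hκ0 hz)
  rw [inv_mul_le_iff₀ (by linarith), ← div_eq_mul_inv, le_div_iff₀ hε]
  nlinarith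

include hκ hκ0 hε in
lemma differentiableOn_damp : DifferentiableOn ℂ (damp κ ε) (Metric.ball 0 1) := by
  refine DifferentiableOn.inv (((differentiableOn_herglotz κ).const_mul _).const_add _)
    fun z hz h => ?_
  rw [mem_ball_zero_iff] at hz
  have h1 := le_norm_one_add_herglotz (κ := κ) (ε := ε) (z := z)
  have h2 := mul_nonneg hε.le (re_herglotz_nonneg hκ hκ0 hz)
  rw [h, norm_zero] at h1
  linarith

include hκ hκ0 hε in
/-- On every circle the multiplier is close to `1` in mean square if `ε` is small. -/
lemma integral_norm_one_sub_damp_sq_le {r : ℝ} (hr : 0 ≤ r) (hr1 : r < 1) :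
    ∫ l, ‖1 - damp κ ε (r * expi 1 l)‖ ^ 2 ∂freq ≤ 2 * ε * ∫ t, κ t ∂freq := by
  have hd := differentiableOn_damp hκ hκ0 hε
  have hz : ∀ l, ‖(r : ℂ) * expi 1 l‖ < 1 := fun l => by rwa [norm_mul_expi hr]
  have hb : ∀ l, ‖damp κ ε (r * expi 1 l)‖ ≤ 1 := fun l => norm_damp_le_one hκ hκ0 hε (hz l)
  have hc := continuous_comp_circle hd hr hr1
  have hi : Integrable (fun l => damp κ ε (r * expi 1 l)) freq :=
    Integrable.of_bound hc.aestronglyMeasurable 1 (ae_of_all _ hb)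
  have h0 : ∫ l, (damp κ ε (r * expi 1 l)).re ∂freq = (1 + ε * ∫ t, κ t ∂freq)⁻¹ := by
    refine (integral_re hi).trans ?_
    rw [integral_circle hd hr hr1, damp, herglotz_zero]
    rw [show (1 + (ε : ℂ) * ((∫ t, κ t ∂freq : ℝ) : ℂ))⁻¹ =
      (((1 + ε * ∫ t, κ t ∂freq)⁻¹ : ℝ) : ℂ) by push_cast; rfl]
    exact Complex.ofReal_re _
  have hk : 0 ≤ ∫ t, κ t ∂freq := integral_nonneg hκ0
  calc ∫ l, ‖1 - damp κ ε (r * expi 1 l)‖ ^ 2 ∂freq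
      ≤ ∫ l, (2 - 2 * (damp κ ε (r * expi 1 l)).re) ∂freq := by
        refine integral_mono ?_ ((integrable_const _).sub (hi.re.const_mul 2)) fun l => ?_
        · refine Integrable.of_bound (((continuous_const.sub hc).norm.pow 2).aestronglyMeasurable)
            4 (ae_of_all _ fun l => ?_)
          rw [Real.norm_of_nonneg (by positivity)]
          have h := norm_sub_le (1 : ℂ) (damp κ ε (r * expi 1 l))
          rw [norm_one] at h
          nlinarith [hb l, norm_nonneg (1 - damp κ ε (r * expi 1 l))]
        · have h := hb l
          have h2 : ‖damp κ ε (r * expi 1 l)‖ ^ 2 ≤ 1 := pow_le_one₀ (norm_nonneg _) h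
          simp only
          rw [← Complex.normSq_eq_norm_sq, Complex.normSq_apply] at h2 ⊢
          simp only [Complex.sub_re, Complex.one_re, Complex.sub_im, Complex.one_im]
          nlinarith
    _ = 2 - 2 * (1 + ε * ∫ t, κ t ∂freq)⁻¹ := by
        have := integral_sub' (integrable_const (μ := freq) (2 : ℝ)) (hi.re.const_mul 2)
        refine this.trans ?_
        rw [integral_const_mul]
        have h0' : ∫ l, RCLike.re (damp κ ε (r * expi 1 l)) ∂freq = _ := h0
        rw [h0']
        simp
    _ ≤ 2 * ε * ∫ t, κ t ∂freq := by
        have h1 : 0 < 1 + ε * ∫ t, κ t ∂freq := by positivity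
        have h2 : 1 - ε * ∫ t, κ t ∂freq ≤ (1 + ε * ∫ t, κ t ∂freq)⁻¹ := by
          rw [← one_div, le_div_iff₀ h1]
          nlinarith [sq_nonneg (ε * ∫ t, κ t ∂freq)]
        linarith

end damp

section product

variable {ι : Type*} [Fintype ι] {v C : ι → ℝ → ℂ}
  (hv : ∀ p, Integrable (v p) freq) (hC : ∀ p, Integrable (C p) freq)
  (hv0 : ∀ p (k : ℕ), ∫ l, expi k l * v p l ∂freq = 0)
  (hC0 : ∀ p (k : ℕ), k ≠ 0 → ∫ l, expi k l * C p l ∂freq = 0)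
  (hH : Integrable (fun l => ∑ p, v p l * C p l) freq)

include hv hC hv0 hC0 hH in
/-- For fixed `ε` the mean of the damped sum tends to `0` along circles: replacing the boundary values
`C p` by their holomorphic extensions makes it vanish, and costs little by dominated convergence,
as the damped extensions are bounded by `ε⁻¹`. -/
lemma exists_norm_integral_damp_mul_lt {ε δ : ℝ} (hε : 0 < ε) (hδ : 0 < δ) :
    ∃ r : ℝ, 0 ≤ r ∧ r < 1 ∧ ‖∫ l, damp (fun t => ∑ p, ‖C p t‖) ε (r * expi 1 l) *
      ∑ p, v p l * C p l ∂freq‖ < δ := by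
  set κ : ℝ → ℝ := fun t => ∑ p, ‖C p t‖ with hκd
  have hκ : Integrable κ freq := integrable_finsetSum _ fun p _ => (hC p).norm
  have hκ0 : ∀ t, 0 ≤ κ t := fun t => Finset.sum_nonneg fun p _ => norm_nonneg _
  have hr0 : ∀ n : ℕ, 0 < 1 / ((n : ℝ) + 1) := fun n => by positivity
  have hr0' : ∀ n : ℕ, 1 / ((n : ℝ) + 1) ≤ 1 := fun n => by
    rw [div_le_one (by positivity)]; linarith [(Nat.cast_nonneg n : (0 : ℝ) ≤ n)]
  set r : ℕ → ℝ := fun n => 1 - 1 / ((n : ℝ) + 1) with hrd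
  have hr : ∀ n, 0 ≤ r n := fun n => by simp only [hrd]; linarith [hr0' n]
  have hr1 : ∀ n, r n < 1 := fun n => by simp only [hrd]; linarith [hr0 n]
  have hlim : Tendsto r atTop (𝓝 1) := by
    simpa [hrd] using (tendsto_one_div_add_atTop_nhds_zero_nat (𝕜 := ℝ)).const_sub 1
  have hz : ∀ n l, ‖(r n : ℂ) * expi 1 l‖ < 1 := fun n l => by
    rw [norm_mul_expi (hr n)]; exact hr1 n
  have hiP : ∀ n p, Integrable (fun l => ‖poissonInt (C p) (r n * expi 1 l) - C p l‖) freq :=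
    fun n p => ((integrable_poissonInt_circle (hC p) (hr n) (hr1 n)).sub (hC p)).norm
  obtain ⟨ns, hns, hae⟩ := exists_seq_tendsto_ae_of_tendsto_integral
    (h := fun n l => ∑ p, ‖poissonInt (C p) (r n * expi 1 l) - C p l‖)
    (fun n => integrable_finsetSum _ fun p _ => hiP n p)
    (fun n l => Finset.sum_nonneg fun p _ => norm_nonneg _) (by
      have : Tendsto (fun n => ∑ p, ∫ l, ‖poissonInt (C p) (r n * expi 1 l) - C p l‖ ∂freq) atTop
          (𝓝 (∑ _p : ι, (0 : ℝ))) := tendsto_finsetSum _ fun p _ =>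
        tendsto_integral_norm_poissonInt_sub (hC p) hr hr1 hlim
      simp only [Finset.sum_const_zero] at this
      refine this.congr fun n => ?_
      rw [integral_finsetSum _ fun p _ => hiP n p])
  have hd := differentiableOn_damp hκ hκ0 hε
  have hCz : ∀ n p l, ‖cauchyInt (C p) (r n * expi 1 l)‖ ≤
      (herglotz κ (r n * expi 1 l)).re := by
    intro n p l
    rw [← poissonInt_eq_cauchyInt (hC p) (hC0 p) (hz n l), re_herglotz hκ (hz n l)]
    refine (norm_poissonInt_le _ (hz n l)).trans ?_
    refine integral_mono (integrable_poissonKer_mul_norm (hC p) (hz n l)) ?_ fun t => ?_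
    · have : Integrable (fun t => ∑ p, poissonKer (r n * expi 1 l) t * ‖C p t‖) freq :=
        integrable_finsetSum _ fun p _ => integrable_poissonKer_mul_norm (hC p) (hz n l)
      simpa only [hκd, Finset.mul_sum] using this
    · exact mul_le_mul_of_nonneg_left (Finset.single_le_sum (f := fun p => ‖C p t‖)
        (fun p _ => norm_nonneg _) (Finset.mem_univ p)) (poissonKer_nonneg (hz n l) t)
  have hΦ : ∀ p, DifferentiableOn ℂ (fun z => damp κ ε z * cauchyInt (C p) z)
      (Metric.ball 0 1) := fun p => hd.mul (differentiableOn_cauchyInt _)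
  have hvb : ∀ n p, Integrable (fun l => damp κ ε (r n * expi 1 l) *
      cauchyInt (C p) (r n * expi 1 l) * v p l) freq := fun n p =>
    (hv p).bdd_mul (c := ε⁻¹)
      (continuous_comp_circle (hΦ p) (hr n) (hr1 n)).aestronglyMeasurable
      (ae_of_all _ fun l => norm_damp_mul_le hκ hκ0 hε (hz n l) (hCz n p l))
  have hHb : ∀ n, Integrable (fun l => damp κ ε (r n * expi 1 l) * ∑ p, v p l * C p l) freq :=
    fun n => hH.bdd_mul (c := 1) (continuous_comp_circle hd (hr n) (hr1 n)).aestronglyMeasurable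
      (ae_of_all _ fun l => norm_damp_le_one hκ hκ0 hε (hz n l))
  -- the integrals do not change if the boundary values `C p` are corrected by their extensions
  have hint : ∀ n, ∫ l, damp κ ε (r n * expi 1 l) * ∑ p, v p l * C p l ∂freq =
      ∫ l, (damp κ ε (r n * expi 1 l) * ∑ p, v p l * C p l -
        ∑ p, damp κ ε (r n * expi 1 l) * cauchyInt (C p) (r n * expi 1 l) * v p l) ∂freq := by
    intro n
    rw [integral_sub (hHb n) (integrable_finsetSum _ fun p _ => hvb n p),
      integral_finsetSum _ fun p _ => hvb n p]
    simp only [integral_mul_circle_eq_zero (hΦ _) (hr n) (hr1 n) (hv _) (hv0 _),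
      Finset.sum_const_zero, sub_zero]
  have hlim0 : Tendsto (fun n => ∫ l, damp κ ε (r (ns n) * expi 1 l) *
      ∑ p, v p l * C p l ∂freq) atTop (𝓝 0) := by
    simp only [hint]
    have := tendsto_integral_of_dominated_convergence (μ := freq)
      (F := fun n l => damp κ ε (r (ns n) * expi 1 l) * ∑ p, v p l * C p l -
        ∑ p, damp κ ε (r (ns n) * expi 1 l) * cauchyInt (C p) (r (ns n) * expi 1 l) * v p l)
      (f := fun _ => 0)
      (fun l => ‖∑ p, v p l * C p l‖ + ∑ p, ε⁻¹ * ‖v p l‖)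
      (fun n => ((hHb _).sub (integrable_finsetSum _ fun p _ => hvb _ p)).aestronglyMeasurable)
      (hH.norm.add (integrable_finsetSum _ fun p _ => (hv p).norm.const_mul _))
      (fun n => ae_of_all _ fun l => ?_) ?_
    · simpa using this
    · refine (norm_sub_le _ _).trans (add_le_add ?_ ((norm_sum_le _ _).trans
        (Finset.sum_le_sum fun p _ => ?_)))
      · rw [norm_mul]
        exact mul_le_of_le_one_left (norm_nonneg _) (norm_damp_le_one hκ hκ0 hε (hz _ l))
      · rw [norm_mul]
        exact mul_le_mul_of_nonneg_right
          (norm_damp_mul_le hκ hκ0 hε (hz _ l) (hCz _ p l)) (norm_nonneg _)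
    · filter_upwards [hae] with l hl
      have hl2 : Tendsto (fun n => (∑ p, ‖v p l‖) *
          ∑ p, ‖poissonInt (C p) (r (ns n) * expi 1 l) - C p l‖) atTop (𝓝 0) := by
        simpa using hl.const_mul (∑ p, ‖v p l‖)
      refine squeeze_zero_norm (fun n => ?_) hl2
      have : damp κ ε (r (ns n) * expi 1 l) * ∑ p, v p l * C p l -
          ∑ p, damp κ ε (r (ns n) * expi 1 l) * cauchyInt (C p) (r (ns n) * expi 1 l) * v p l =
          damp κ ε (r (ns n) * expi 1 l) *
            ∑ p, v p l * (C p l - cauchyInt (C p) (r (ns n) * expi 1 l)) := by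
        rw [Finset.mul_sum, Finset.mul_sum, ← Finset.sum_sub_distrib]
        exact Finset.sum_congr rfl fun p _ => by ring
      rw [this, norm_mul]
      refine (mul_le_of_le_one_left (norm_nonneg _) (norm_damp_le_one hκ hκ0 hε (hz _ l))).trans ?_
      refine (norm_sum_le _ _).trans ?_
      rw [Finset.sum_mul]
      refine Finset.sum_le_sum fun p _ => ?_
      rw [norm_mul, norm_sub_rev, ← poissonInt_eq_cauchyInt (hC p) (hC0 p) (hz _ l)]
      exact mul_le_mul_of_nonneg_left (Finset.single_le_sum
        (f := fun p => ‖poissonInt (C p) (r (ns n) * expi 1 l) - C p l‖)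
        (fun p _ => norm_nonneg _) (Finset.mem_univ p)) (norm_nonneg _)
  obtain ⟨n, hn⟩ := ((Metric.tendsto_nhds.1 hlim0) δ hδ).exists
  exact ⟨r (ns n), hr _, hr1 _, by simpa [dist_zero_right] using hn⟩

include hv hC hv0 hC0 hH in
/-- A sum `∑ₚ vₚ Cₚ` of products of integrable functions, where the `vₚ` have positive frequencies
only and the `Cₚ` nonnegative ones, has mean zero as soon as it is integrable, although the single
products need not be integrable.  The multipliers `damp` make the holomorphic extensions of the `Cₚ`
bounded, and tend to `1`. -/
theorem integral_sum_mul_eq_zero_of_one_sided : ∫ l, ∑ p, v p l * C p l ∂freq = 0 := by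
  set κ : ℝ → ℝ := fun t => ∑ p, ‖C p t‖ with hκd
  have hκ : Integrable κ freq := integrable_finsetSum _ fun p _ => (hC p).norm
  have hκ0 : ∀ t, 0 ≤ κ t := fun t => Finset.sum_nonneg fun p _ => norm_nonneg _
  have hε : ∀ n : ℕ, 0 < 1 / ((n : ℝ) + 1) := fun n => by positivity
  have hlim := tendsto_one_div_add_atTop_nhds_zero_nat (𝕜 := ℝ)
  -- `ε = 1 / (n + 1)`, and a circle depending on `n` on which the damped mean is at most `ε`
  choose r hr hr1 hlt using fun n : ℕ =>
    exists_norm_integral_damp_mul_lt hv hC hv0 hC0 hH (hε n) (hε n)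
  set ω : ℕ → ℝ → ℂ := fun n l => damp κ (1 / ((n : ℝ) + 1)) (r n * expi 1 l) with hω
  have hωc : ∀ n, Continuous (ω n) := fun n =>
    continuous_comp_circle (differentiableOn_damp hκ hκ0 (hε n)) (hr n) (hr1 n)
  have hω1 : ∀ n l, ‖ω n l‖ ≤ 1 := fun n l => norm_damp_le_one hκ hκ0 (hε n) (by
    rw [norm_mul_expi (hr n)]; exact hr1 n)
  obtain ⟨ns, hns, hae⟩ := exists_seq_tendsto_ae_of_tendsto_integral
    (h := fun n l => ‖1 - ω n l‖ ^ 2) (fun n => by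
      refine Integrable.of_bound
        (((continuous_const.sub (hωc n)).norm.pow 2).aestronglyMeasurable) 4
        (ae_of_all _ fun l => ?_)
      rw [Real.norm_of_nonneg (by positivity)]
      have h := norm_sub_le (1 : ℂ) (ω n l)
      rw [norm_one] at h
      nlinarith [hω1 n l, norm_nonneg (1 - ω n l)]) (fun n l => by positivity) (by
      refine squeeze_zero (fun n => integral_nonneg fun l => by positivity)
        (fun n => integral_norm_one_sub_damp_sq_le hκ hκ0 (hε n) (hr n) (hr1 n)) ?_
      simpa using (hlim.const_mul 2).mul_const (∫ t, κ t ∂freq))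
  have h1 : Tendsto (fun n => ∫ l, ω (ns n) l * ∑ p, v p l * C p l ∂freq) atTop
      (𝓝 (∫ l, ∑ p, v p l * C p l ∂freq)) := by
    refine tendsto_integral_of_dominated_convergence (fun l => ‖∑ p, v p l * C p l‖)
      (fun n => (hωc _).aestronglyMeasurable.mul hH.aestronglyMeasurable) hH.norm
      (fun n => ae_of_all _ fun l => ?_) ?_
    · rw [norm_mul]
      exact mul_le_of_le_one_left (norm_nonneg _) (hω1 _ l)
    · filter_upwards [hae] with l hl
      have h2 : Tendsto (fun n => ‖1 - ω (ns n) l‖) atTop (𝓝 0) := by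
        have := (Real.continuous_sqrt.tendsto 0).comp hl
        simpa [Function.comp_def, Real.sqrt_sq (norm_nonneg _)] using this
      have h3 := (tendsto_zero_iff_norm_tendsto_zero.2 h2).const_sub 1
      simp only [sub_sub_cancel, sub_zero] at h3
      simpa using h3.mul_const (∑ p, v p l * C p l)
  have h2 : Tendsto (fun n => ∫ l, ω (ns n) l * ∑ p, v p l * C p l ∂freq) atTop (𝓝 0) := by
    refine squeeze_zero_norm (fun n => (hlt (ns n)).le) (hlim.comp hns.tendsto_atTop)
  exact tendsto_nhds_unique h1 h2

end product

/-! ### Square roots of matrix weights -/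

section sqrt

open scoped Matrix.Norms.L2Operator

variable {T : ℕ}

/-- The square root of a positive semidefinite matrix, extended continuously to all matrices. -/
def matSqrt (A : Matrix (Fin T) (Fin T) ℂ) : Matrix (Fin T) (Fin T) ℂ :=
  cfc (R := ℝ) Real.sqrt ((1 / 2 : ℝ) • (A + star A))

/-- The Hermitian part, which makes `matSqrt` a continuous function of an arbitrary matrix. -/
lemma isSelfAdjoint_half_add_star (A : Matrix (Fin T) (Fin T) ℂ) :
    IsSelfAdjoint ((1 / 2 : ℝ) • (A + star A)) :=
  (IsSelfAdjoint.all (1 / 2 : ℝ)).smul (IsSelfAdjoint.add_star_self A)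

lemma continuous_matSqrt : Continuous (matSqrt (T := T)) := by
  unfold matSqrt
  refine Continuous.cfc_of_mem_nhdsSet (s := Set.univ) Real.sqrt Filter.univ_mem ?_
    (fun A => isSelfAdjoint_half_add_star A) Real.continuous_sqrt.continuousOn
  fun_prop

lemma isHermitian_matSqrt (A : Matrix (Fin T) (Fin T) ℂ) : (matSqrt A).IsHermitian :=
  (cfc_predicate (R := ℝ) Real.sqrt _ : IsSelfAdjoint _)

open scoped MatrixOrder in
lemma matSqrt_mul_self {A : Matrix (Fin T) (Fin T) ℂ} (hA : A.PosSemidef) :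
    matSqrt A * matSqrt A = A := by
  have h1 : (1 / 2 : ℝ) • (A + star A) = A := by
    have : star A = A := hA.1
    rw [this, ← two_smul ℝ, smul_smul]; norm_num
  have hsa : IsSelfAdjoint A := hA.1
  rw [matSqrt, h1, ← cfc_mul Real.sqrt Real.sqrt A]
  have : Set.EqOn (fun x => Real.sqrt x * Real.sqrt x) id (spectrum ℝ A) := fun x hx =>
    Real.mul_self_sqrt (spectrum_nonneg_of_nonneg hA.nonneg hx)
  rw [cfc_congr this, cfc_id ℝ A]

end sqrt

section

variable {T : ℕ}

lemma aemeasurable_matSqrt {f : ℝ → Matrix (Fin T) (Fin T) ℂ}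
    (hf : ∀ p q, AEMeasurable (fun l => f l p q) freq) (p q : Fin T) :
    AEMeasurable (fun l => matSqrt (f l) p q) freq := by
  have hc : Continuous fun A : Fin T → Fin T → ℂ => matSqrt (Matrix.of A) p q :=
    (continuous_apply_apply p q).comp continuous_matSqrt
  have hm : AEMeasurable (fun l p q => f l p q) freq :=
    aemeasurable_pi_lambda _ fun p => aemeasurable_pi_lambda _ fun q => hf p q
  exact hc.measurable.comp_aemeasurable hm

lemma aemeasurable_matInv {f : ℝ → Matrix (Fin T) (Fin T) ℂ}
    (hf : ∀ p q, AEMeasurable (fun l => f l p q) freq) (p q : Fin T) :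
    AEMeasurable (fun l => (f l)⁻¹ p q) freq := by
  have hdet : Continuous fun A : Fin T → Fin T → ℂ => (Matrix.of A).det :=
    Continuous.matrix_det continuous_id
  have hadj : Continuous fun A : Fin T → Fin T → ℂ => (Matrix.of A).adjugate p q :=
    (continuous_apply_apply p q).comp (Continuous.matrix_adjugate continuous_id)
  have hm : AEMeasurable (fun l p q => f l p q) freq :=
    aemeasurable_pi_lambda _ fun p => aemeasurable_pi_lambda _ fun q => hf p q
  have h1 : AEMeasurable (fun l => (f l).det) freq := hdet.measurable.comp_aemeasurable hm
  have h2 : AEMeasurable (fun l => (f l).adjugate p q) freq :=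
    hadj.measurable.comp_aemeasurable hm
  refine (h1.inv.mul h2).congr (ae_of_all _ fun l => ?_)
  simp [Matrix.inv_def, Ring.inverse_eq_inv']

end

/-! ### Matrix columns in the space of square integrable vector functions -/

/-- The space of square integrable `ℂᵀ`-valued functions of the frequency. -/
abbrev Spec (T : ℕ) := Lp (EuclideanSpace ℂ (Fin T)) 2 freq

section vec

variable {T : ℕ} {κ : Type*}

/-- All entries of the matrix function `M` are square integrable. -/
def MemL2 (M : ℝ → Matrix (Fin T) κ ℂ) : Prop := ∀ p j, MemLp (fun l => M l p j) 2 freq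

lemma memLp_column {M : ℝ → Matrix (Fin T) κ ℂ} (hM : MemL2 M) (k : ℤ) (j : κ) :
    MemLp (fun l => WithLp.toLp 2 fun p => expi k l * M l p j :
      ℝ → EuclideanSpace ℂ (Fin T)) 2 freq := by
  refine MemLp.of_eval_piLp fun p => ?_
  refine (hM p j).of_le ((continuous_expi k).aestronglyMeasurable.mul
    (hM p j).aestronglyMeasurable) (ae_of_all _ fun l => ?_)
  simp [norm_expi]

/-- The function `e^{ikλ} M(λ) δⱼ`. -/
def vec {M : ℝ → Matrix (Fin T) κ ℂ} (hM : MemL2 M) (k : ℤ) (j : κ) : Spec T :=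
  (memLp_column hM k j).toLp _

lemma coeFn_vec {M : ℝ → Matrix (Fin T) κ ℂ} (hM : MemL2 M) (k : ℤ) (j : κ) :
    vec hM k j =ᵐ[freq] fun l => WithLp.toLp 2 fun p => expi k l * M l p j :=
  MemLp.coeFn_toLp _

lemma inner_vec_ae {M : ℝ → Matrix (Fin T) κ ℂ} (hM : MemL2 M) (k : ℤ) (j : κ) (E : Spec T) :
    (fun l => inner ℂ (vec hM k j l) (E l)) =ᵐ[freq]
      fun l => expi (-k) l * ((M l)ᴴ *ᵥ (E l).ofLp) j := by
  filter_upwards [coeFn_vec hM k j] with l hl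
  rw [hl, EuclideanSpace.inner_eq_star_dotProduct]
  simp only [dotProduct, Matrix.mulVec, Finset.mul_sum, Pi.star_apply, star_mul',
    star_expi, Matrix.conjTranspose_apply]
  exact Finset.sum_congr rfl fun p _ => by ring

/-- Inner products with the columns of `M` are the Fourier coefficients of `Mᴴ E`. -/
lemma inner_vec {M : ℝ → Matrix (Fin T) κ ℂ} (hM : MemL2 M) (k : ℤ) (j : κ) (E : Spec T) :
    inner ℂ (vec hM k j) E = ∫ l, expi (-k) l * ((M l)ᴴ *ᵥ (E l).ofLp) j ∂freq := by
  rw [L2.inner_def]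
  exact integral_congr_ae (inner_vec_ae hM k j E)

lemma integrable_conjTranspose_mulVec {M : ℝ → Matrix (Fin T) κ ℂ} (hM : MemL2 M) (j : κ)
    (E : Spec T) : Integrable (fun l => ((M l)ᴴ *ᵥ (E l).ofLp) j) freq := by
  have h := (L2.integrable_inner (𝕜 := ℂ) (vec hM 0 j) E).congr (inner_vec_ae hM 0 j E)
  simpa using h

lemma inner_vec_vec {κ' : Type*} {M : ℝ → Matrix (Fin T) κ ℂ} (hM : MemL2 M)
    {M' : ℝ → Matrix (Fin T) κ' ℂ} (hM' : MemL2 M') (k k' : ℤ) (j : κ) (j' : κ') :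
    inner ℂ (vec hM k j) (vec hM' k' j') =
      ∫ l, expi (k' - k) l * ((M l)ᴴ * M' l) j j' ∂freq := by
  rw [inner_vec]
  refine integral_congr_ae ?_
  filter_upwards [coeFn_vec hM' k' j'] with l hl
  rw [hl]
  simp only [Matrix.mulVec, dotProduct, Matrix.mul_apply, Finset.mul_sum, sub_eq_neg_add, expi_add]
  exact Finset.sum_congr rfl fun p _ => by ring

lemma norm_vec_eq {M : ℝ → Matrix (Fin T) κ ℂ} (hM : MemL2 M) (k : ℤ) (j : κ) :
    ‖vec hM k j‖ = ‖vec hM 0 j‖ := by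
  rw [← sq_eq_sq₀ (norm_nonneg _) (norm_nonneg _)]
  have h : ∀ k, (‖vec hM k j‖ : ℂ) ^ 2 = ∫ l, ((M l)ᴴ * M l) j j ∂freq := fun k => by
    have := inner_self_eq_norm_sq_to_K (𝕜 := ℂ) (vec hM k j)
    refine this.symm.trans ?_
    rw [inner_vec_vec]; simp
  have h2 := (h k).trans (h 0).symm
  exact_mod_cast h2

/-- The combination `∑ c(m,j) e^{imλ} M(λ) δⱼ`. -/
def vecComb {M : ℝ → Matrix (Fin T) κ ℂ} (hM : MemL2 M) : ((ℤ × κ) →₀ ℂ) →ₗ[ℂ] Spec T :=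
  Finsupp.linearCombination ℂ fun x => vec hM x.1 x.2

/-- The trigonometric polynomial `∑ c(m,j) e^{imλ} δⱼ`. -/
def trigVec [DecidableEq κ] (c : (ℤ × κ) →₀ ℂ) (l : ℝ) : κ → ℂ :=
  fun q => c.sum fun x z => if x.2 = q then z * expi x.1 l else 0

/-- The function `M(λ) u(λ)`. -/
def act [Fintype κ] (M : ℝ → Matrix (Fin T) κ ℂ) (u : ℝ → κ → ℂ) (l : ℝ) :
    EuclideanSpace ℂ (Fin T) := WithLp.toLp 2 (M l *ᵥ u l)

lemma coeFn_vecComb [Fintype κ] [DecidableEq κ] {M : ℝ → Matrix (Fin T) κ ℂ} (hM : MemL2 M)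
    (c : (ℤ × κ) →₀ ℂ) : vecComb hM c =ᵐ[freq] act M (trigVec c) := by
  rw [vecComb, Finsupp.linearCombination_apply, Finsupp.sum]
  refine (Lp.coeFn_finsetSum _ _).trans ?_
  have : ∀ x ∈ c.support, ((c x • vec hM x.1 x.2 : Spec T) : ℝ → _) =ᵐ[freq]
      fun l => c x • WithLp.toLp 2 fun p => expi x.1 l * M l p x.2 := fun x _ => by
    filter_upwards [Lp.coeFn_smul (c x) (vec hM x.1 x.2), coeFn_vec hM x.1 x.2] with l h1 h2
    rw [h1, Pi.smul_apply, h2]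
  filter_upwards [(Finset.eventually_all c.support).2 this] with l hl
  rw [Finset.sum_apply, Finset.sum_congr rfl hl, act]
  ext p
  simp only [WithLp.ofLp_sum, WithLp.ofLp_smul, Finset.sum_apply, Pi.smul_apply, smul_eq_mul,
    Matrix.mulVec, dotProduct, trigVec, Finsupp.sum, Finset.mul_sum]
  rw [Finset.sum_comm]
  refine Finset.sum_congr rfl fun x _ => ?_
  simp only [mul_ite, mul_zero, Finset.sum_ite_eq, Finset.mem_univ, if_true]
  ring

/-- A bounded analytic trigonometric polynomial `∑ₖ z(k) e^{ikλ}` as an element `∑ₖ e^{ikλ} M z(k)`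
of the space. -/
def polyComb [Fintype κ] {M : ℝ → Matrix (Fin T) κ ℂ} (hM : MemL2 M) :
    (ℕ →₀ (κ → ℂ)) →ₗ[ℂ] Spec T :=
  Finsupp.lsum ℂ fun k => ∑ j, (LinearMap.proj j).smulRight (vec hM k j)

lemma polyComb_apply [Fintype κ] {M : ℝ → Matrix (Fin T) κ ℂ} (hM : MemL2 M)
    (g : ℕ →₀ (κ → ℂ)) : polyComb hM g = g.sum fun k z => ∑ j, z j • vec hM k j := by
  rw [polyComb, Finsupp.lsum_apply]
  refine Finset.sum_congr rfl fun k _ => ?_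
  simp

lemma coeFn_smul_vec_sum [Fintype κ] {M : ℝ → Matrix (Fin T) κ ℂ} (hM : MemL2 M) (k : ℤ)
    (z : κ → ℂ) : ((∑ j, z j • vec hM k j : Spec T) : ℝ → _) =ᵐ[freq]
      act M fun l => expi k l • z := by
  refine (Lp.coeFn_finsetSum _ _).trans ?_
  have : ∀ j ∈ Finset.univ, ((z j • vec hM k j : Spec T) : ℝ → _) =ᵐ[freq]
      fun l => z j • WithLp.toLp 2 fun p => expi k l * M l p j := fun j _ => by
    filter_upwards [Lp.coeFn_smul (z j) (vec hM k j), coeFn_vec hM k j] with l h1 h2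
    rw [h1, Pi.smul_apply, h2]
  filter_upwards [(Finset.eventually_all Finset.univ).2 this] with l hl
  rw [Finset.sum_apply, Finset.sum_congr rfl hl, act]
  ext p
  simp only [WithLp.ofLp_sum, WithLp.ofLp_smul, Finset.sum_apply, Pi.smul_apply, smul_eq_mul,
    Matrix.mulVec, dotProduct]
  exact Finset.sum_congr rfl fun j _ => by ring

lemma act_finset_sum [Fintype κ] (M : ℝ → Matrix (Fin T) κ ℂ) {ι : Type*} (s : Finset ι)
    (u : ι → ℝ → κ → ℂ) (l : ℝ) : act M (fun l => ∑ i ∈ s, u i l) l = ∑ i ∈ s, act M (u i) l := by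
  ext p
  simp only [act, WithLp.ofLp_sum, Finset.sum_apply, Matrix.mulVec_sum]

lemma coeFn_polyComb [Fintype κ] {M : ℝ → Matrix (Fin T) κ ℂ} (hM : MemL2 M)
    (g : ℕ →₀ (κ → ℂ)) :
    polyComb hM g =ᵐ[freq] act M fun l => g.sum fun k z => expi k l • z := by
  rw [polyComb_apply, Finsupp.sum]
  refine (Lp.coeFn_finsetSum _ _).trans ?_
  have : ∀ k ∈ g.support, ((∑ j, g k j • vec hM k j : Spec T) : ℝ → _) =ᵐ[freq]
      act M fun l => expi (k : ℤ) l • g k := fun k _ => coeFn_smul_vec_sum hM k (g k)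
  filter_upwards [(Finset.eventually_all g.support).2 this] with l hl
  rw [Finset.sum_apply, Finset.sum_congr rfl hl]
  simp only [Finsupp.sum, act_finset_sum]

lemma aestronglyMeasurable_act [Fintype κ] {M : ℝ → Matrix (Fin T) κ ℂ} (hM : MemL2 M)
    {u : ℝ → κ → ℂ} (hu : AEMeasurable u freq) : AEStronglyMeasurable (act M u) freq := by
  have : AEMeasurable (fun l => M l *ᵥ u l) freq := by
    refine aemeasurable_pi_lambda _ fun p => ?_
    simp only [Matrix.mulVec, dotProduct]
    exact Finset.aemeasurable_fun_sum _ fun j _ =>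
      (hM p j).aestronglyMeasurable.aemeasurable.mul (aemeasurable_pi_iff.1 hu j)
  have h2 : Continuous (WithLp.toLp 2 : (Fin T → ℂ) → EuclideanSpace ℂ (Fin T)) :=
    PiLp.continuous_toLp 2 _
  exact (h2.measurable.comp_aemeasurable this).aestronglyMeasurable

/-- A matrix function turns a weighted norm into the norm of the space. -/
lemma weightedSq_eq {M W : ℝ → Matrix (Fin T) (Fin T) ℂ}
    (hW : ∀ᵐ l ∂freq, (M l)ᴴ * M l = (W l)ᵀ) (u : ℝ → Fin T → ℂ) :
    weightedSq W u = eLpNorm (act M u) 2 freq ^ 2 := by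
  rw [eLpNorm_eq_lintegral_rpow_enorm_toReal (by norm_num) (by norm_num)]
  have : ∀ x : ℝ≥0∞, (x ^ (1 / (2 : ℝ≥0∞).toReal)) ^ 2 = x := fun x => by
    rw [← ENNReal.rpow_natCast, ← ENNReal.rpow_mul]; norm_num
  rw [this, weightedSq]
  refine lintegral_congr_ae ?_
  filter_upwards [hW] with l hl
  have h1 : u l ᵥ* W l ⬝ᵥ star (u l) = inner ℂ (act M u l) (act M u l) := by
    rw [act, EuclideanSpace.inner_eq_star_dotProduct, dotProduct_comm (M l *ᵥ u l),
      Matrix.star_mulVec, ← Matrix.dotProduct_mulVec (star (u l)), Matrix.mulVec_mulVec, hl,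
      Matrix.mulVec_transpose, dotProduct_comm]
  have h2 : (inner ℂ (act M u l) (act M u l)).re = ‖act M u l‖ ^ 2 :=
    (norm_sq_eq_re_inner (𝕜 := ℂ) (act M u l)).symm
  rw [h1, h2, ENNReal.ofReal_pow (norm_nonneg _), ofReal_norm]
  simp

end vec

/-! ### Dual pairs of matrix functions: past and future -/

/-- Two square matrix functions with square integrable entries and `Gᴴ N = 1`: the columns
`e^{ikλ} G δₚ` and `e^{ikλ} N δₚ` form biorthogonal systems. -/
structure DualPair {T : ℕ} (G N : ℝ → Matrix (Fin T) (Fin T) ℂ) : Prop where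
  left : MemL2 G
  right : MemL2 N
  dual : ∀ᵐ l ∂freq, (G l)ᴴ * N l = 1

namespace DualPair

variable {T : ℕ} {G N : ℝ → Matrix (Fin T) (Fin T) ℂ} (h : DualPair G N)

include h in
lemma dual_symm : ∀ᵐ l ∂freq, (N l)ᴴ * G l = 1 := by
  filter_upwards [h.dual] with l hl
  have := congrArg Matrix.conjTranspose hl
  simpa using this

include h in
lemma symm : DualPair N G := ⟨h.right, h.left, h.dual_symm⟩

include h in
/-- The two systems of columns are biorthogonal. -/
lemma inner_vec_right_left (j k : ℤ) (q p : Fin T) :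
    inner ℂ (vec h.right j q) (vec h.left k p) = if j = k ∧ q = p then 1 else 0 := by
  rw [inner_vec_vec]
  have : ∫ l, expi (k - j) l * ((N l)ᴴ * G l) q p ∂freq =
      ∫ l, expi (k - j) l * (1 : Matrix (Fin T) (Fin T) ℂ) q p ∂freq :=
    integral_congr_ae (by filter_upwards [h.dual_symm] with l hl; rw [hl])
  rw [this, integral_mul_const, integral_expi, Matrix.one_apply]
  by_cases h1 : j = k <;> by_cases h2 : q = p <;> simp [h1, h2, sub_eq_zero, eq_comm]

include h in
/-- The columns of `G` are total. -/
lemma eq_zero_of_inner_vec_eq_zero {E : Spec T}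
    (hE : ∀ k p, inner ℂ (vec h.left k p) E = 0) : E = 0 := by
  have h0 : ∀ p, (fun l => ((G l)ᴴ *ᵥ (E l).ofLp) p) =ᵐ[freq] 0 := fun p =>
    ae_eq_zero_of_integral_expi_eq_zero (integrable_conjTranspose_mulVec h.left p E) fun k => by
      have := hE (-k) p
      rwa [inner_vec, neg_neg] at this
  rw [Lp.eq_zero_iff_ae_eq_zero]
  filter_upwards [ae_all_iff.2 h0, h.dual] with l h1 h2
  have h3 : (G l)ᴴ *ᵥ (E l).ofLp = 0 := funext h1
  have h4 : N l * (G l)ᴴ = 1 := mul_eq_one_comm.1 h2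
  have h5 : (E l).ofLp = 0 := by
    rw [← Matrix.one_mulVec (E l).ofLp, ← h4, ← Matrix.mulVec_mulVec, h3, Matrix.mulVec_zero]
  ext p
  rw [h5]; rfl

/-- The past: the closed span of `e^{ikλ} G δₚ`, `k ≤ -1`. -/
def past : Submodule ℂ (Spec T) :=
  ((Finsupp.supported ℂ ℂ {x : ℤ × Fin T | x.1 ≤ -1}).map (vecComb h.left)).topologicalClosure

/-- The future of the dual system: the closed span of `e^{ikλ} N δₚ`, `k ≥ 0`. -/
def future : Submodule ℂ (Spec T) := (LinearMap.range (polyComb h.right)).topologicalClosure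

instance : h.past.HasOrthogonalProjection :=
  haveI : CompleteSpace h.past :=
    (Submodule.isClosed_topologicalClosure _).completeSpace_coe
  inferInstance

lemma vec_mem_past {k : ℤ} (hk : k ≤ -1) (p : Fin T) : vec h.left k p ∈ h.past := by
  refine Submodule.le_topologicalClosure _ ⟨Finsupp.single (k, p) 1, ?_, ?_⟩
  · exact Finsupp.single_mem_supported ℂ 1 hk
  · simp [vecComb]

lemma vec_mem_future (k : ℕ) (p : Fin T) : vec h.right k p ∈ h.future := by
  refine Submodule.le_topologicalClosure _ ⟨Finsupp.single k (Pi.single p 1), ?_⟩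
  rw [polyComb_apply, Finsupp.sum_single_index (by simp), Finset.sum_eq_single p]
  · simp
  · intro q _ hq; simp [hq]
  · simp

lemma inner_past_eq_zero {D x : Spec T}
    (hD : ∀ k : ℤ, k ≤ -1 → ∀ p, inner ℂ D (vec h.left k p) = 0) (hx : x ∈ h.past) :
    inner ℂ D x = 0 := by
  have hle : h.past ≤ LinearMap.ker (innerSL ℂ D : Spec T →L[ℂ] ℂ).toLinearMap := by
    refine Submodule.topologicalClosure_minimal _ ?_ (ContinuousLinearMap.isClosed_ker _)
    rintro _ ⟨c, hc, rfl⟩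
    rw [LinearMap.mem_ker, vecComb, Finsupp.linearCombination_apply, Finsupp.sum, map_sum]
    refine Finset.sum_eq_zero fun x hx => ?_
    rw [map_smul]
    have := hD x.1 (hc hx) x.2
    simp [this]
  simpa using hle hx

lemma mem_past_orthogonal_iff {E : Spec T} :
    E ∈ h.pastᗮ ↔ ∀ k : ℤ, k ≤ -1 → ∀ p, inner ℂ (vec h.left k p) E = 0 := by
  constructor
  · intro hE k hk p
    exact (Submodule.mem_orthogonal _ _).1 hE _ (h.vec_mem_past hk p)
  · intro hE
    refine (Submodule.mem_orthogonal' _ _).2 fun x hx => h.inner_past_eq_zero ?_ hx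
    intro k hk p
    rw [← inner_conj_symm, hE k hk p, map_zero]

lemma inner_future_eq_zero {D x : Spec T}
    (hD : ∀ (k : ℕ) p, inner ℂ D (vec h.right k p) = 0) (hx : x ∈ h.future) :
    inner ℂ D x = 0 := by
  have hle : h.future ≤ LinearMap.ker (innerSL ℂ D : Spec T →L[ℂ] ℂ).toLinearMap := by
    refine Submodule.topologicalClosure_minimal _ ?_ (ContinuousLinearMap.isClosed_ker _)
    rintro _ ⟨g, rfl⟩
    rw [LinearMap.mem_ker, polyComb_apply, Finsupp.sum, map_sum]
    refine Finset.sum_eq_zero fun k _ => ?_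
    rw [map_sum]
    refine Finset.sum_eq_zero fun p _ => ?_
    rw [map_smul]
    simp [hD k p]
  simpa using hle hx

/-- An element of the future is determined by its inner products with `e^{ikλ} N δₚ`, `k ≥ 0`. -/
lemma eq_of_mem_future {x y : Spec T} (hx : x ∈ h.future) (hy : y ∈ h.future)
    (hxy : ∀ (k : ℕ) p, inner ℂ (vec h.right k p) x = inner ℂ (vec h.right k p) y) : x = y := by
  have h0 : inner ℂ (x - y) (x - y) = 0 := by
    refine h.inner_future_eq_zero (fun k p => ?_) (Submodule.sub_mem _ hx hy)
    rw [← inner_conj_symm, inner_sub_right, hxy, sub_self, map_zero]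
  exact sub_eq_zero.1 (inner_self_eq_zero.1 h0)

/-- The orthogonal complement of the past is the future of the dual system.  If `E` is orthogonal
to the past and `D` to that future, then `⟨D, E⟩` is the mean of `∑ₚ vₚ Cₚ`, where `C = Gᴴ E` has no
negative and `v = conj (Nᴴ D)` has only positive frequencies. -/
theorem mem_future_of_mem_past_orthogonal {E : Spec T} (hE : E ∈ h.pastᗮ) : E ∈ h.future := by
  have hcl : h.future.topologicalClosure = h.future :=
    (Submodule.isClosed_topologicalClosure _).submodule_topologicalClosure_eq
  rw [← hcl, ← Submodule.orthogonal_orthogonal_eq_closure, Submodule.mem_orthogonal]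
  intro D hD
  have hE' := h.mem_past_orthogonal_iff.1 hE
  have hD' : ∀ (k : ℕ) p, inner ℂ (vec h.right k p) D = 0 := fun k p =>
    (Submodule.mem_orthogonal _ _).1 hD _ (h.vec_mem_future k p)
  have hae : (fun l => inner ℂ (D l) (E l)) =ᵐ[freq]
      fun l => ∑ p, star (((N l)ᴴ *ᵥ (D l).ofLp) p) * ((G l)ᴴ *ᵥ (E l).ofLp) p := by
    filter_upwards [h.dual] with l hl
    have h4 : N l * (G l)ᴴ = 1 := mul_eq_one_comm.1 hl
    have : ∑ p, star (((N l)ᴴ *ᵥ (D l).ofLp) p) * ((G l)ᴴ *ᵥ (E l).ofLp) p =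
        star ((N l)ᴴ *ᵥ (D l).ofLp) ⬝ᵥ ((G l)ᴴ *ᵥ (E l).ofLp) := rfl
    rw [this, Matrix.star_mulVec, Matrix.conjTranspose_conjTranspose, ← Matrix.dotProduct_mulVec,
      Matrix.mulVec_mulVec, h4, Matrix.one_mulVec, EuclideanSpace.inner_eq_star_dotProduct,
      dotProduct_comm]
  rw [L2.inner_def, integral_congr_ae hae]
  have hN := fun p => integrable_conjTranspose_mulVec h.right p D
  refine integral_sum_mul_eq_zero_of_one_sided
    (v := fun p l => star (((N l)ᴴ *ᵥ (D l).ofLp) p)) (C := fun p l => ((G l)ᴴ *ᵥ (E l).ofLp) p)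
    (fun p => ?_) (fun p => integrable_conjTranspose_mulVec h.left p E) (fun p k => ?_)
    (fun p k hk => ?_) ((L2.integrable_inner (𝕜 := ℂ) D E).congr hae)
  · exact ((Complex.conjCLE : ℂ →L[ℝ] ℂ).integrable_comp (hN p) :)
  · have h1 := hD' k p
    rw [inner_vec] at h1
    have h2 := congrArg (starRingEnd ℂ) h1
    rw [← integral_conj, map_zero] at h2
    refine (integral_congr_ae (ae_of_all _ fun l => ?_)).trans h2
    have := star_expi (-k) l
    rw [neg_neg] at this
    simp only [map_mul]
    rw [← this]; rfl
  · have h1 := hE' (-k) (by omega) p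
    rwa [inner_vec, neg_neg] at h1

end DualPair

/-! ### Absolutely convergent series of columns -/

section series

variable {T : ℕ} {M : ℝ → Matrix (Fin T) (Fin T) ℂ} (hM : MemL2 M)

lemma norm_sum_smul_vec_le (k : ℤ) (z : Fin T → ℂ) :
    ‖∑ j, z j • vec hM k j‖ ≤ ‖z‖ * ∑ j, ‖vec hM 0 j‖ := by
  rw [Finset.mul_sum]
  refine (norm_sum_le _ _).trans (Finset.sum_le_sum fun j _ => ?_)
  rw [norm_smul, norm_vec_eq]
  exact mul_le_mul_of_nonneg_right (norm_le_pi_norm z j) (norm_nonneg _)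

/-- The sum `∑ₖ e^{ikλ} M b(k)`. -/
def seriesVec (b : ℕ → Fin T → ℂ) : Spec T := ∑' k : ℕ, ∑ j, b k j • vec hM k j

lemma summable_norm_sum_smul_vec {b : ℕ → Fin T → ℂ} (hb : Summable fun k => ‖b k‖) :
    Summable fun k : ℕ => ‖∑ j, b k j • vec hM k j‖ :=
  Summable.of_nonneg_of_le (fun _ => norm_nonneg _) (fun k => norm_sum_smul_vec_le hM k (b k))
    (hb.mul_right _)

lemma hasSum_seriesVec {b : ℕ → Fin T → ℂ} (hb : Summable fun k => ‖b k‖) :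
    HasSum (fun k : ℕ => ∑ j, b k j • vec hM k j) (seriesVec hM b) :=
  (summable_norm_sum_smul_vec hM hb).of_norm.hasSum

lemma seriesVec_finsupp (g : ℕ →₀ (Fin T → ℂ)) : seriesVec hM g = polyComb hM g := by
  rw [seriesVec, polyComb_apply, tsum_eq_sum (s := g.support)]
  · rfl
  · intro k hk
    simp [Finsupp.notMem_support_iff.1 hk]

lemma norm_seriesVec_sub_le {b b' : ℕ → Fin T → ℂ} (hb : Summable fun k => ‖b k‖)
    (hb' : Summable fun k => ‖b' k‖) :
    ‖seriesVec hM b - seriesVec hM b'‖ ≤ (∑' k, ‖b k - b' k‖) * ∑ j, ‖vec hM 0 j‖ := by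
  have h := (hasSum_seriesVec hM hb).sub (hasSum_seriesVec hM hb')
  have hs : Summable fun k => ‖b k - b' k‖ :=
    Summable.of_nonneg_of_le (fun _ => norm_nonneg _) (fun k => norm_sub_le _ _) (hb.add hb')
  rw [← h.tsum_eq, ← tsum_mul_right]
  have hle : ∀ k : ℕ, ‖∑ j, b k j • vec hM k j - ∑ j, b' k j • vec hM k j‖ ≤
      ‖b k - b' k‖ * ∑ j, ‖vec hM 0 j‖ := fun k => by
    have := norm_sum_smul_vec_le hM k (b k - b' k)
    simpa [sub_smul] using this
  exact tsum_of_norm_bounded (hs.mul_right _).hasSum hle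

lemma summable_expi_smul {b : ℕ → Fin T → ℂ} (hb : Summable fun k => ‖b k‖) (l : ℝ) :
    Summable fun k : ℕ => expi k l • b k := by
  refine Summable.of_norm ?_
  simpa only [norm_smul, norm_expi, one_mul] using hb

lemma coeFn_seriesVec {b : ℕ → Fin T → ℂ} (hb : Summable fun k => ‖b k‖) :
    seriesVec hM b =ᵐ[freq] act M (Bfun b) := by
  have hlim := (hasSum_seriesVec hM hb).tendsto_sum_nat
  obtain ⟨ns, hns, hae⟩ := (tendstoInMeasure_of_tendsto_Lp hlim).exists_seq_tendsto_ae
  have hpart : ∀ n : ℕ, ((∑ k ∈ Finset.range n, ∑ j, b k j • vec hM k j : Spec T) : ℝ → _)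
      =ᵐ[freq] act M fun l => ∑ k ∈ Finset.range n, expi k l • b k := fun n => by
    refine (Lp.coeFn_finsetSum _ _).trans ?_
    have : ∀ k ∈ Finset.range n, ((∑ j, b k j • vec hM k j : Spec T) : ℝ → _) =ᵐ[freq]
        act M fun l => expi (k : ℤ) l • b k := fun k _ => coeFn_smul_vec_sum hM k (b k)
    filter_upwards [(Finset.eventually_all (Finset.range n)).2 this] with l hl
    rw [Finset.sum_apply, Finset.sum_congr rfl hl, act_finset_sum]
  filter_upwards [hae, ae_all_iff.2 hpart] with l h1 h2
  simp only [h2] at h1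
  have h3 := ((summable_expi_smul hb l).hasSum.tendsto_sum_nat).comp hns.tendsto_atTop
  have hc : Continuous fun u : Fin T → ℂ =>
      (WithLp.toLp 2 (M l *ᵥ u) : EuclideanSpace ℂ (Fin T)) :=
    (PiLp.continuous_toLp 2 _).comp (by fun_prop)
  exact tendsto_nhds_unique h1 ((hc.tendsto _).comp h3)

end series

/-! ### The dual pair of a spectral density -/

/-- A bounded function which vanishes to first order at finitely many separated points is bounded
by a multiple of the product of the distances from these points. -/
lemma exists_le_mul_prod_abs_sub {ι : Type*} [DecidableEq ι] (Z : Finset ι) (z : ι → ℝ) {δ : ℝ}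
    (hδ : 0 < δ) (hsep : ∀ i ∈ Z, ∀ j ∈ Z, i ≠ j → 2 * δ ≤ |z i - z j|) {u : ℝ → ℝ} {B L : ℝ}
    (hB : 0 ≤ B) (hL : 0 ≤ L) (hu : ∀ l, u l ≤ B) (hu' : ∀ l, ∀ i ∈ Z, u l ≤ L * |l - z i|) :
    ∃ M, 0 ≤ M ∧ ∀ l, u l ≤ M * ∏ i ∈ Z, |l - z i| := by
  refine ⟨B * (δ ^ Z.card)⁻¹ + L * (δ ^ (Z.card - 1))⁻¹, by positivity, fun l => ?_⟩
  have hP : 0 ≤ ∏ i ∈ Z, |l - z i| := Finset.prod_nonneg fun _ _ => abs_nonneg _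
  by_cases hc : ∃ i ∈ Z, |l - z i| < δ
  · obtain ⟨i, hi, hil⟩ := hc
    have hle : |l - z i| * δ ^ (Z.card - 1) ≤ ∏ i ∈ Z, |l - z i| := by
      rw [← Finset.mul_prod_erase Z _ hi, ← Finset.card_erase_of_mem hi, ← Finset.prod_const]
      refine mul_le_mul_of_nonneg_left (Finset.prod_le_prod (fun _ _ => hδ.le) fun j hj => ?_)
        (abs_nonneg _)
      have h1 := hsep j (Finset.mem_of_mem_erase hj) i hi (Finset.ne_of_mem_erase hj)
      have h2 : |z j - z i| ≤ |l - z i| + |l - z j| := by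
        have := abs_sub (l - z i) (l - z j)
        rwa [show l - z i - (l - z j) = z j - z i by ring] at this
      linarith
    have h1 : u l ≤ L * (δ ^ (Z.card - 1))⁻¹ * ∏ i ∈ Z, |l - z i| := by
      refine (hu' l i hi).trans ?_
      rw [mul_assoc]
      refine mul_le_mul_of_nonneg_left ?_ hL
      rw [inv_mul_eq_div, le_div_iff₀ (by positivity)]
      exact hle
    have h2 : 0 ≤ B * (δ ^ Z.card)⁻¹ * ∏ i ∈ Z, |l - z i| := by positivity
    linarith
  · push Not at hc
    have hle : δ ^ Z.card ≤ ∏ i ∈ Z, |l - z i| := by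
      rw [← Finset.prod_const]
      exact Finset.prod_le_prod (fun _ _ => hδ.le) hc
    have h1 : u l ≤ B * (δ ^ Z.card)⁻¹ * ∏ i ∈ Z, |l - z i| := by
      refine (hu l).trans ?_
      rw [mul_assoc]
      refine le_mul_of_one_le_right hB ?_
      rw [inv_mul_eq_div, le_div_iff₀ (by positivity), one_mul]
      exact hle
    have h2 : 0 ≤ L * (δ ^ (Z.card - 1))⁻¹ * ∏ i ∈ Z, |l - z i| := by positivity
    linarith

lemma norm_one_sub_expi_le (k : ℤ) (l : ℝ) : ‖1 - expi k l‖ ≤ |(k : ℝ)| * |l| := by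
  have := Real.norm_exp_I_mul_ofReal_sub_one_le (x := k * l)
  rw [norm_sub_rev, expi]
  push_cast at this
  rw [← mul_assoc] at this
  refine this.trans (le_of_eq ?_)
  rw [Real.norm_eq_abs, abs_mul]

lemma star_mul_self_eq_norm_sq (z : ℂ) : star z * z = ((‖z‖ ^ 2 : ℝ) : ℂ) := by
  rw [Complex.star_def, Complex.conj_mul']
  push_cast
  rfl

namespace Params

variable {r : ℕ} (γ : Params r)

lemma continuous_chi : Continuous γ.chi := by
  unfold chi GM.chi
  exact continuous_finsetProd _ fun j _ => (continuous_const.sub (continuous_expi _)).pow _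

lemma continuous_beta : Continuous γ.beta := by
  unfold beta GM.beta
  fun_prop

/-- The zeros of `β(iλ)` are zeros of `χ_μ(e^{-iλ})`, with at least the same multiplicities. -/
lemma exists_norm_chi_le : ∃ M, ∀ l, ‖γ.chi l‖ ≤ M * ‖γ.beta l‖ := by
  have key : ∀ j, ∃ M, 0 ≤ M ∧ ∀ l : ℝ, ‖1 - expi (-(γ.step j * (γ.s j : ℤ))) l‖ ≤
      M * ∏ k ∈ Finset.Icc (-((γ.s j / 2 : ℕ) : ℤ)) ((γ.s j / 2 : ℕ) : ℤ),
        |l - 2 * Real.pi * k / γ.s j| := by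
    intro j
    have hs : (0 : ℝ) < γ.s j := by exact_mod_cast γ.s_pos j
    have hs' : (γ.s j : ℂ) ≠ 0 := by exact_mod_cast (γ.s_pos j).ne'
    refine exists_le_mul_prod_abs_sub _ (fun k : ℤ => 2 * Real.pi * k / γ.s j)
      (δ := Real.pi / γ.s j) (by positivity) ?_ (B := 2)
      (L := |((-(γ.step j * (γ.s j : ℤ)) : ℤ) : ℝ)|) (by norm_num) (abs_nonneg _)
      (fun l => ?_) (fun l k _ => ?_)
    · intro i _ k _ hik
      have h1 : (1 : ℝ) ≤ |(i : ℝ) - k| := by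
        have : (1 : ℤ) ≤ |i - k| := Int.one_le_abs (sub_ne_zero.2 hik)
        exact_mod_cast this
      have h2 : 2 * Real.pi * i / γ.s j - 2 * Real.pi * k / γ.s j =
          2 * Real.pi / γ.s j * (i - k) := by ring
      rw [h2, abs_mul, abs_of_pos (by positivity : 0 < 2 * Real.pi / γ.s j)]
      have h3 : 0 < 2 * Real.pi / γ.s j := by positivity
      calc 2 * (Real.pi / γ.s j) = 2 * Real.pi / γ.s j * 1 := by ring
        _ ≤ _ := mul_le_mul_of_nonneg_left h1 h3.le
    · refine (norm_sub_le _ _).trans ?_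
      rw [norm_one, norm_expi]; norm_num
    · refine le_trans (le_of_eq ?_) (norm_one_sub_expi_le _ (l - 2 * Real.pi * k / γ.s j))
      congr 2
      rw [expi, expi, Complex.exp_eq_exp_iff_exists_int]
      refine ⟨-(γ.step j * k), ?_⟩
      push_cast
      field_simp
      ring
  choose M hM0 hM using key
  refine ⟨∏ j, M j ^ γ.d j, fun l => ?_⟩
  rw [chi, beta, GM.chi, GM.beta, norm_prod, norm_prod, ← Finset.prod_mul_distrib]
  refine Finset.prod_le_prod (fun _ _ => norm_nonneg _) fun j _ => ?_
  rw [norm_pow, norm_prod]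
  simp only [norm_pow]
  rw [Finset.prod_pow, ← mul_pow]
  refine pow_le_pow_left₀ (norm_nonneg _) ((hM j l).trans (le_of_eq ?_)) _
  congr 1
  refine Finset.prod_congr rfl fun k _ => ?_
  have : Complex.I * (l : ℂ) - 2 * (Real.pi : ℂ) * Complex.I * (k : ℂ) / (γ.s j : ℂ) =
      Complex.I * ((l - 2 * Real.pi * k / γ.s j : ℝ) : ℂ) := by push_cast; ring
  rw [this, norm_mul, Complex.norm_I, one_mul, Complex.norm_real, Real.norm_eq_abs]

lemma ae_chi_ne_zero : ∀ᵐ l ∂freq, γ.chi l ≠ 0 := by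
  refine ae_freq_of_ae ?_
  have hc : (⋃ j, Set.range fun n : ℤ =>
      (2 * Real.pi * n / (-(γ.step j * (γ.s j : ℤ)) : ℤ) : ℝ)).Countable :=
    Set.countable_iUnion fun j => Set.countable_range _
  filter_upwards [hc.ae_notMem volume] with l hl h0
  refine hl ?_
  rw [chi, GM.chi, Finset.prod_eq_zero_iff] at h0
  obtain ⟨j, -, hj⟩ := h0
  have h1 := sub_eq_zero.1 ((pow_eq_zero_iff (γ.d_pos j).ne').1 hj)
  rw [eq_comm, expi, Complex.exp_eq_one_iff] at h1
  obtain ⟨n, hn⟩ := h1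
  refine Set.mem_iUnion.2 ⟨j, n, ?_⟩
  have hN : ((-(γ.step j * (γ.s j : ℤ)) : ℤ) : ℝ) ≠ 0 := by
    have h1 := γ.s_pos j
    have h2 := γ.μ_pos j
    have : (-(γ.step j * (γ.s j : ℤ)) : ℤ) ≠ 0 := by
      simp only [step, neg_ne_zero, mul_ne_zero_iff]
      omega
    exact_mod_cast this
  rw [div_eq_iff hN]
  have h3 : ((2 * Real.pi * n : ℝ) : ℂ) = ((l * (-(γ.step j * (γ.s j : ℤ)) : ℤ) : ℝ) : ℂ) := by
    have hI := Complex.I_ne_zero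
    apply mul_left_cancel₀ hI
    push_cast at hn ⊢
    linear_combination -hn
  exact_mod_cast h3

lemma ae_beta_ne_zero : ∀ᵐ l ∂freq, γ.beta l ≠ 0 := by
  obtain ⟨M, hM⟩ := γ.exists_norm_chi_le
  filter_upwards [γ.ae_chi_ne_zero] with l hl h0
  have := hM l
  rw [h0, norm_zero, mul_zero] at this
  exact hl (norm_le_zero_iff.1 this)

variable {T : ℕ} (f : ℝ → Matrix (Fin T) (Fin T) ℂ)

/-- The transposed square root of the spectral density: an isometry of `L₂(f)` onto the
unweighted space. -/
def rootT (l : ℝ) : Matrix (Fin T) (Fin T) ℂ := (matSqrt (f l))ᵀ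

/-- The matrix function `χ_μ(e^{-iλ}) β(iλ)⁻¹ (f^{1/2})ᵀ`, whose columns represent the
increments. -/
def incRoot (l : ℝ) : Matrix (Fin T) (Fin T) ℂ := (γ.chi l / γ.beta l) • rootT f l

/-- The inverse of the adjoint of `incRoot`. -/
def dualRoot (l : ℝ) : Matrix (Fin T) (Fin T) ℂ :=
  (star (γ.beta l) / star (γ.chi l)) • (rootT f l)⁻¹

variable {f}

lemma rootT_isHermitian (l : ℝ) : (rootT f l).IsHermitian :=
  (isHermitian_matSqrt (f l)).transpose

lemma rootT_mul_self {l : ℝ} (h : (f l).PosSemidef) : rootT f l * rootT f l = (f l)ᵀ := by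
  rw [rootT, ← Matrix.transpose_mul, matSqrt_mul_self h]

lemma isUnit_det_rootT {l : ℝ} (h : (f l).PosDef) : IsUnit (rootT f l).det := by
  have h1 := rootT_mul_self h.posSemidef
  have h2 := congrArg Matrix.det h1
  rw [Matrix.det_mul, Matrix.det_transpose] at h2
  have h3 : (f l).det ≠ 0 := h.det_pos.ne'
  rw [isUnit_iff_ne_zero]
  intro h0
  rw [h0, zero_mul] at h2
  exact h3 h2.symm

lemma ae_incRoot (hmin : γ.Minimality f) : ∀ᵐ l ∂freq,
    (γ.incRoot f l)ᴴ * γ.incRoot f l =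
      (((‖γ.chi l‖ ^ 2 / ‖γ.beta l‖ ^ 2 : ℝ) : ℂ) • f l)ᵀ := by
  filter_upwards [hmin.1] with l h1
  rw [incRoot, Matrix.conjTranspose_smul, (rootT_isHermitian l).eq, Matrix.smul_mul,
    Matrix.mul_smul, rootT_mul_self h1.posSemidef, smul_smul, Matrix.transpose_smul]
  congr 1
  rw [star_mul_self_eq_norm_sq, norm_div, div_pow]

lemma ae_dualRoot (hmin : γ.Minimality f) : ∀ᵐ l ∂freq,
    (γ.dualRoot f l)ᴴ * γ.dualRoot f l = (γ.invWeight f l)ᵀ := by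
  filter_upwards [hmin.1] with l h1
  have h2 : (rootT f l)⁻¹ * (rootT f l)⁻¹ = ((f l)⁻¹)ᵀ := by
    rw [← Matrix.mul_inv_rev, rootT_mul_self h1.posSemidef, Matrix.transpose_nonsing_inv]
  rw [dualRoot, Matrix.conjTranspose_smul, Matrix.conjTranspose_nonsing_inv,
    (rootT_isHermitian l).eq, Matrix.smul_mul, Matrix.mul_smul, h2, smul_smul, invWeight,
    Matrix.transpose_smul, ratio]
  congr 1
  rw [star_mul_self_eq_norm_sq, norm_div, norm_star, norm_star, div_pow]

lemma ae_rootT (hmin : γ.Minimality f) : ∀ᵐ l ∂freq,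
    (rootT f l)ᴴ * rootT f l = (f l)ᵀ := by
  filter_upwards [hmin.1] with l h1
  rw [(rootT_isHermitian l).eq, rootT_mul_self h1.posSemidef]

/-- An entry of `A` is bounded by a diagonal entry of `Aᴴ A`. -/
lemma norm_sq_le_conjTranspose_mul_self (A : Matrix (Fin T) (Fin T) ℂ) (p q : Fin T) :
    ‖A p q‖ ^ 2 ≤ ‖(Aᴴ * A) q q‖ := by
  have h : (Aᴴ * A) q q = ((∑ i, ‖A i q‖ ^ 2 : ℝ) : ℂ) := by
    rw [Matrix.mul_apply]
    push_cast
    refine Finset.sum_congr rfl fun i _ => ?_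
    rw [Matrix.conjTranspose_apply, Complex.star_def, Complex.conj_mul']
  rw [h, Complex.norm_real, Real.norm_of_nonneg (Finset.sum_nonneg fun _ _ => by positivity)]
  exact Finset.single_le_sum (f := fun i => ‖A i q‖ ^ 2) (fun _ _ => by positivity)
    (Finset.mem_univ p)

lemma memL2_of_integrable {M : ℝ → Matrix (Fin T) (Fin T) ℂ}
    (hm : ∀ p q, AEMeasurable (fun l => M l p q) freq)
    (hi : ∀ q, Integrable (fun l => ((M l)ᴴ * M l) q q) freq) : MemL2 M := fun p q =>
  (memLp_two_iff_integrable_sq_norm (hm p q).aestronglyMeasurable).2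
    ((hi q).norm.mono ((hm p q).aestronglyMeasurable.norm.pow 2)
      (ae_of_all _ fun l => by
        rw [Real.norm_of_nonneg (by positivity), norm_norm]
        exact norm_sq_le_conjTranspose_mul_self _ _ _))

lemma aemeasurable_rootT (hf : ∀ p q, Integrable (fun l => f l p q) freq) (p q : Fin T) :
    AEMeasurable (fun l => rootT f l p q) freq :=
  aemeasurable_matSqrt (fun p q => (hf p q).aestronglyMeasurable.aemeasurable) q p

lemma memL2_rootT (hf : ∀ p q, Integrable (fun l => f l p q) freq) (hmin : γ.Minimality f) :
    MemL2 (rootT f) := by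
  refine memL2_of_integrable (aemeasurable_rootT hf) fun q => (hf q q).congr ?_
  filter_upwards [γ.ae_rootT hmin] with l hl
  rw [hl]; rfl

lemma memL2_incRoot (hf : ∀ p q, Integrable (fun l => f l p q) freq) (hmin : γ.Minimality f) :
    MemL2 (γ.incRoot f) := by
  obtain ⟨M, hM⟩ := γ.exists_norm_chi_le
  have hmeas : Measurable fun l => γ.chi l / γ.beta l :=
    γ.continuous_chi.measurable.div γ.continuous_beta.measurable
  intro p q
  have : MemLp (fun l => (γ.chi l / γ.beta l) * rootT f l p q) 2 freq := by
    refine (γ.memL2_rootT hf hmin p q).of_le_mul (c := |M|)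
      (hmeas.aestronglyMeasurable.mul (aemeasurable_rootT hf p q).aestronglyMeasurable)
      (ae_of_all _ fun l => ?_)
    rw [norm_mul, norm_div]
    refine mul_le_mul_of_nonneg_right ?_ (norm_nonneg _)
    refine div_le_of_le_mul₀ (norm_nonneg _) (abs_nonneg _) ((hM l).trans ?_)
    exact mul_le_mul_of_nonneg_right (le_abs_self M) (norm_nonneg _)
  exact this

lemma memL2_dualRoot (hf : ∀ p q, Integrable (fun l => f l p q) freq) (hmin : γ.Minimality f) :
    MemL2 (γ.dualRoot f) := by
  have hmeas : Measurable fun l => star (γ.beta l) / star (γ.chi l) :=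
    γ.continuous_beta.star.measurable.div γ.continuous_chi.star.measurable
  have hfm : ∀ p q, AEMeasurable (fun l => f l p q) freq := fun p q =>
    (hf p q).aestronglyMeasurable.aemeasurable
  refine memL2_of_integrable (fun p q => hmeas.aemeasurable.mul
    (aemeasurable_matInv (aemeasurable_rootT hf) p q)) fun q => ?_
  have hr : Measurable fun l => ((γ.ratio l : ℝ) : ℂ) := by
    refine Complex.measurable_ofReal.comp ?_
    exact (γ.continuous_beta.norm.pow 2).measurable.div (γ.continuous_chi.norm.pow 2).measurable
  have hI : Integrable (fun l => ((γ.ratio l : ℝ) : ℂ) * (f l)⁻¹ q q) freq := by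
    refine hmin.2.mono (hr.aestronglyMeasurable.mul
      (aemeasurable_matInv hfm q q).aestronglyMeasurable) ?_
    filter_upwards [hmin.1] with l hl
    have hps := hl.inv.posSemidef
    have hd : ∀ i, ∃ x : ℝ, 0 ≤ x ∧ (f l)⁻¹ i i = x := fun i => by
      have := hps.diag_nonneg (i := i)
      rw [Complex.nonneg_iff] at this
      exact ⟨((f l)⁻¹ i i).re, this.1, Complex.ext rfl (by simp [this.2])⟩
    choose x hx0 hx using hd
    have htr : ((f l)⁻¹).trace.re = ∑ i, x i := by
      simp only [Matrix.trace, Matrix.diag_apply, hx, Complex.re_sum, Complex.ofReal_re]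
    rw [htr, hx, norm_mul, norm_mul, Complex.norm_real, Complex.norm_real,
      Real.norm_of_nonneg (hx0 q), Real.norm_of_nonneg (Finset.sum_nonneg fun i _ => hx0 i)]
    exact mul_le_mul_of_nonneg_left (Finset.single_le_sum (fun i _ => hx0 i) (Finset.mem_univ q))
      (norm_nonneg _)
  refine hI.congr ?_
  filter_upwards [γ.ae_dualRoot hmin] with l hl
  rw [hl, Matrix.transpose_apply, invWeight, Matrix.smul_apply, smul_eq_mul]

/-- The minimality condition makes the inverse of the adjoint of `incRoot` square integrable. -/
lemma dualPair (hf : ∀ p q, Integrable (fun l => f l p q) freq) (hmin : γ.Minimality f) :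
    DualPair (γ.incRoot f) (γ.dualRoot f) := by
  refine ⟨γ.memL2_incRoot hf hmin, γ.memL2_dualRoot hf hmin, ?_⟩
  filter_upwards [hmin.1, γ.ae_chi_ne_zero, γ.ae_beta_ne_zero] with l h1 h2 h3
  have h2' : star (γ.chi l) ≠ 0 := star_ne_zero.2 h2
  have h3' : star (γ.beta l) ≠ 0 := star_ne_zero.2 h3
  rw [incRoot, dualRoot, Matrix.conjTranspose_smul, (rootT_isHermitian l).eq, Matrix.smul_mul,
    Matrix.mul_smul, Matrix.mul_nonsing_inv _ (isUnit_det_rootT h1), smul_smul, star_div₀,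
    div_mul_div_cancel₀ h3', div_self h2', one_smul]

end Params

/-! ### The difference operator and its inverse -/

namespace Params

variable {r : ℕ} (γ : Params r)

/-- The polynomial `∏ᵢ (1 - X^{μᵢ sᵢ})^{dᵢ}`. -/
def poly : Polynomial ℂ := ∏ i, (1 - Polynomial.X ^ (γ.μ i * γ.s i)) ^ γ.d i

lemma e_eq (k : ℕ) : γ.e k = γ.poly.coeff k := rfl

lemma poly_eq_sum : γ.poly = ∑ l ∈ Fintype.piFinset (fun i => Finset.range (γ.d i + 1)),
    Polynomial.C ((-1 : ℂ) ^ (∑ i, l i) * ∏ i, ((γ.d i).choose (l i) : ℂ)) *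
      Polynomial.X ^ (∑ i, γ.μ i * γ.s i * l i) := by
  have h : ∀ i, ((1 - Polynomial.X ^ (γ.μ i * γ.s i)) ^ γ.d i : Polynomial ℂ) =
      ∑ l ∈ Finset.range (γ.d i + 1), Polynomial.C ((-1 : ℂ) ^ l * ((γ.d i).choose l : ℂ)) *
        Polynomial.X ^ (γ.μ i * γ.s i * l) := fun i => by
    rw [sub_eq_neg_add, add_pow]
    refine Finset.sum_congr rfl fun l _ => ?_
    rw [neg_pow, pow_mul]
    simp
    ring
  rw [poly]
  simp only [h]
  rw [Finset.prod_univ_sum]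
  refine Finset.sum_congr rfl fun l _ => ?_
  rw [Finset.prod_mul_distrib, ← map_prod, Finset.prod_mul_distrib, Finset.prod_pow_eq_pow_sum,
    Finset.prod_pow_eq_pow_sum]

lemma sum_le_n {l : Fin r → ℕ}
    (hl : l ∈ Fintype.piFinset (fun i => Finset.range (γ.d i + 1))) :
    ∑ i, γ.μ i * γ.s i * l i ≤ γ.n := by
  rw [Fintype.mem_piFinset] at hl
  refine Finset.sum_le_sum fun i _ => Nat.mul_le_mul_left _ ?_
  have := Finset.mem_range.1 (hl i)
  omega

/-- An increment with the fixed step is `∑ⱼ e(j) η(m - j)`. -/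
lemma increment_eq_sum {Ω : Type*} (η : ℤ → Ω → ℂ) (m : ℤ) (ω : Ω) :
    increment γ.step γ.s γ.d η m ω = ∑ j ∈ Finset.range (γ.n + 1), γ.e j * η (m - j) ω := by
  simp only [e_eq, poly_eq_sum, Polynomial.finsetSum_coeff, Polynomial.coeff_C_mul,
    Polynomial.coeff_X_pow, Finset.sum_mul]
  rw [Finset.sum_comm, increment]
  refine Finset.sum_congr rfl fun l hl => ?_
  have hn := γ.sum_le_n hl
  rw [Finset.sum_eq_single (∑ i, γ.μ i * γ.s i * l i)]
  · rw [if_pos rfl, mul_one]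
    congr 3
    simp [step]
  · intro j _ hj; simp [hj]
  · intro h0; exact absurd (Finset.mem_range.2 (by omega)) h0

lemma e_eq_zero {k : ℕ} (hk : γ.n < k) : γ.e k = 0 := by
  rw [e_eq, poly_eq_sum, Polynomial.finsetSum_coeff]
  refine Finset.sum_eq_zero fun l hl => ?_
  have := γ.sum_le_n hl
  rw [Polynomial.coeff_C_mul, Polynomial.coeff_X_pow, if_neg (by omega), mul_zero]

/-- The geometric series in `X ^ N`. -/
lemma mk_dvd_mul_one_sub (N : ℕ) (hN : 0 < N) :
    (1 - PowerSeries.X ^ N) * PowerSeries.mk (fun j => if N ∣ j then (1 : ℂ) else 0) = 1 := by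
  ext k
  rw [sub_mul, one_mul, map_sub, PowerSeries.coeff_X_pow_mul', PowerSeries.coeff_mk,
    PowerSeries.coeff_one]
  rcases le_or_gt N k with hk | hk
  · have h : N ∣ k - N ↔ N ∣ k := by
      rw [Nat.dvd_sub_iff_left hk dvd_rfl]
    rw [if_pos hk, PowerSeries.coeff_mk, if_neg (by omega : k ≠ 0)]
    simp only [h, sub_self]
  · have h : N ∣ k ↔ k = 0 := ⟨fun h => Nat.eq_zero_of_dvd_of_lt h hk, fun h => h ▸ dvd_zero N⟩
    rw [if_neg hk.not_ge, sub_zero]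
    simp only [h]

/-- The generating functions of `e` and of `dCoef` are inverse to each other. -/
lemma sum_antidiagonal_e_mul_dCoef (k : ℕ) :
    ∑ x ∈ Finset.HasAntidiagonal.antidiagonal k, γ.e x.1 * γ.dCoef x.2 = if k = 0 then 1 else 0 := by
  have h : (γ.poly : PowerSeries ℂ) *
      ∏ i, (PowerSeries.mk (fun j => if γ.μ i * γ.s i ∣ j then (1 : ℂ) else 0)) ^ γ.d i = 1 := by
    have : (γ.poly : PowerSeries ℂ) = ∏ i, (1 - PowerSeries.X ^ (γ.μ i * γ.s i)) ^ γ.d i := by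
      rw [poly, ← Polynomial.coeToPowerSeries.ringHom_apply, map_prod]
      simp
    rw [this, ← Finset.prod_mul_distrib]
    refine Finset.prod_eq_one fun i _ => ?_
    rw [← mul_pow, mk_dvd_mul_one_sub _ (Nat.mul_pos (γ.μ_pos i) (γ.s_pos i)), one_pow]
  have h2 := congrArg (PowerSeries.coeff k) h
  rw [PowerSeries.coeff_mul, PowerSeries.coeff_one] at h2
  simp only [Polynomial.coeff_coe] at h2
  exact h2

/-- The operator `b ↦ ∑ⱼ e(j) b(· + j)` on one-sided sequences. -/
def E {T : ℕ} (b : ℕ → Fin T → ℂ) (m : ℕ) : Fin T → ℂ :=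
  ∑ j ∈ Finset.range (γ.n + 1), γ.e j • b (m + j)

section D

variable {T : ℕ}

lemma tendsto_D {a : ℕ → Fin T → ℂ} (ha : γ.DConverges a) (k : ℕ) :
    Tendsto (fun N => ∑ j ∈ Finset.range N, γ.dCoef j • a (k + j)) atTop (𝓝 (γ.D a k)) := by
  have h := (ha k).hasSum
  rw [HasSum, SummationFilter.conditional_filter_eq_map_range, tendsto_map'_iff] at h
  exact h

lemma D_eq_of_tendsto {a : ℕ → Fin T → ℂ} {k : ℕ} {x : Fin T → ℂ}
    (h : Tendsto (fun N => ∑ j ∈ Finset.range N, γ.dCoef j • a (k + j)) atTop (𝓝 x)) :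
    Summable (fun j => γ.dCoef j • a (k + j)) (SummationFilter.conditional ℕ) ∧ γ.D a k = x := by
  have hs : HasSum (fun j => γ.dCoef j • a (k + j)) x (SummationFilter.conditional ℕ) := by
    rw [HasSum, SummationFilter.conditional_filter_eq_map_range, tendsto_map'_iff]
    exact h
  exact ⟨hs.summable, hs.tsum_eq⟩

lemma tendsto_of_eq_zero {a : ℕ → Fin T → ℂ} {M : ℕ} (ha : ∀ k, M ≤ k → a k = 0) (k : ℕ) :
    Tendsto (fun N => ∑ j ∈ Finset.range N, γ.dCoef j • a (k + j)) atTop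
      (𝓝 (∑ j ∈ Finset.range (M - k), γ.dCoef j • a (k + j))) := by
  refine tendsto_const_nhds.congr' ?_
  filter_upwards [eventually_ge_atTop M] with N hN
  refine Finset.sum_subset (Finset.range_mono (by omega)) fun j _ hj => ?_
  rw [Finset.mem_range] at hj
  rw [ha _ (by omega), smul_zero]

lemma D_of_eq_zero {a : ℕ → Fin T → ℂ} {M : ℕ} (ha : ∀ k, M ≤ k → a k = 0) (k : ℕ) :
    γ.D a k = ∑ j ∈ Finset.range (M - k), γ.dCoef j • a (k + j) :=
  (γ.D_eq_of_tendsto (γ.tendsto_of_eq_zero ha k)).2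

lemma DConverges_of_eq_zero {a : ℕ → Fin T → ℂ} {M : ℕ} (ha : ∀ k, M ≤ k → a k = 0) :
    γ.DConverges a := fun k => (γ.D_eq_of_tendsto (γ.tendsto_of_eq_zero ha k)).1

/-- `D` is a right inverse of `E`. -/
lemma E_D {a : ℕ → Fin T → ℂ} (ha : γ.DConverges a) (m : ℕ) : γ.E (γ.D a) m = a m := by
  have h1 : Tendsto (fun N => ∑ j ∈ Finset.range (γ.n + 1), γ.e j •
      ∑ i ∈ Finset.range (N - j), γ.dCoef i • a (m + j + i)) atTop (𝓝 (γ.E (γ.D a) m)) :=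
    tendsto_finsetSum _ fun j _ =>
      ((γ.tendsto_D ha (m + j)).comp (tendsto_sub_atTop_nat j)).const_smul _
  refine tendsto_nhds_unique h1 (tendsto_const_nhds.congr' ?_)
  filter_upwards [eventually_gt_atTop γ.n] with N hN
  have h2 : ∀ t, ∑ x ∈ Finset.HasAntidiagonal.antidiagonal t, (γ.e x.1 * γ.dCoef x.2) • a (m + t) =
      if t = 0 then a m else 0 := fun t => by
    rw [← Finset.sum_smul, γ.sum_antidiagonal_e_mul_dCoef]
    split_ifs with h <;> simp [h]
  have h3 : ∑ t ∈ Finset.range N, ∑ x ∈ Finset.HasAntidiagonal.antidiagonal t,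
      (γ.e x.1 * γ.dCoef x.2) • a (m + t) = a m := by
    simp only [h2]
    rw [Finset.sum_ite_eq' (Finset.range N) 0, if_pos (Finset.mem_range.2 (by omega))]
  rw [← h3]
  simp only [Finset.smul_sum, smul_smul]
  rw [Finset.sum_sigma', Finset.sum_sigma']
  have hsub : ∑ x ∈ (Finset.range (γ.n + 1)).sigma fun j => Finset.range (N - j),
      (γ.e x.1 * γ.dCoef x.2) • a (m + x.1 + x.2) =
      ∑ x ∈ (Finset.range N).sigma fun j => Finset.range (N - j),
      (γ.e x.1 * γ.dCoef x.2) • a (m + x.1 + x.2) := by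
    refine Finset.sum_subset (fun x hx => ?_) fun x hx hx' => ?_
    · simp only [Finset.mem_sigma, Finset.mem_range] at hx ⊢; omega
    · simp only [Finset.mem_sigma, Finset.mem_range] at hx hx'
      rw [γ.e_eq_zero (by omega), zero_mul, zero_smul]
  rw [hsub]
  refine Finset.sum_bij' (fun x _ => ⟨x.2.1, x.2.2⟩) (fun x _ => ⟨x.1 + x.2, (x.1, x.2)⟩) ?_ ?_ ?_
    ?_ ?_
  · rintro ⟨t, x, y⟩ h
    simp only [Finset.mem_sigma, Finset.mem_range, Finset.HasAntidiagonal.mem_antidiagonal] at h ⊢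
    omega
  · rintro ⟨x, y⟩ h
    simp only [Finset.mem_sigma, Finset.mem_range, Finset.HasAntidiagonal.mem_antidiagonal] at h ⊢
    exact ⟨by omega, trivial⟩
  · rintro ⟨t, x, y⟩ h
    simp only [Finset.mem_sigma, Finset.mem_range, Finset.HasAntidiagonal.mem_antidiagonal] at h
    obtain ⟨_, rfl⟩ := h
    rfl
  · rintro ⟨x, y⟩ h; rfl
  · rintro ⟨t, x, y⟩ h
    simp only [Finset.mem_sigma, Finset.mem_range, Finset.HasAntidiagonal.mem_antidiagonal] at h
    obtain ⟨_, rfl⟩ := h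
    simp only [add_assoc]

/-- `D` is a left inverse of `E` on finite sequences. -/
lemma D_E {b : ℕ → Fin T → ℂ} {M : ℕ} (hb : ∀ k, M ≤ k → b k = 0) (k : ℕ) :
    γ.D (γ.E b) k = b k := by
  have hE : ∀ k, M ≤ k → γ.E b k = 0 := fun k hk =>
    Finset.sum_eq_zero fun j _ => by rw [hb _ (by omega), smul_zero]
  -- `E` and the finite sums defining `D` commute, so that the right inverse is a left inverse
  have h := γ.E_D (γ.DConverges_of_eq_zero hb) k
  rw [← h, γ.D_of_eq_zero hE, E]
  have hD : ∀ j, γ.D b (k + j) = ∑ i ∈ Finset.range (M - k), γ.dCoef i • b (k + j + i) := fun j => by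
    rw [γ.D_of_eq_zero hb]
    refine Finset.sum_subset (Finset.range_mono (by omega)) fun i _ hi => ?_
    rw [Finset.mem_range] at hi
    rw [hb _ (by omega), smul_zero]
  simp only [hD, E, Finset.smul_sum]
  rw [Finset.sum_comm]
  refine Finset.sum_congr rfl fun j _ => Finset.sum_congr rfl fun i _ => ?_
  rw [smul_comm, add_right_comm]

end D

end Params

/-! ### Finite functionals of the sequence and of its increments -/

namespace Params

variable {r : ℕ} (γ : Params r) {T : ℕ}

/-- The transpose of the difference operator, `c ↦ ∑ⱼ e(j) c(· + j)`, on two-sided sequences. -/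
def fwd (c : ℤ × Fin T → ℂ) (x : ℤ × Fin T) : ℂ :=
  ∑ j ∈ Finset.range (γ.n + 1), γ.e j * c (x.1 + j, x.2)

/-- The extension of a one-sided sequence by zero. -/
def _root_.GM.ext (b : ℕ → Fin T → ℂ) (x : ℤ × Fin T) : ℂ :=
  if 0 ≤ x.1 then b x.1.toNat x.2 else 0

/-- Translation by `j` in time. -/
def _root_.GM.shiftEquiv (T : ℕ) (j : ℤ) : ℤ × Fin T ≃ ℤ × Fin T :=
  (Equiv.addRight j).prodCongr (Equiv.refl _)

lemma hasFiniteSupport_fwd {c : ℤ × Fin T → ℂ} (hc : c.HasFiniteSupport) :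
    (γ.fwd c).HasFiniteSupport := by
  have h : ∀ j : ℕ, (Function.support fun x : ℤ × Fin T => c (x.1 + j, x.2)).Finite := fun j =>
    hc.preimage (f := shiftEquiv T j) (Equiv.injective _).injOn
  refine ((Finset.range (γ.n + 1)).finite_toSet.biUnion fun j _ => h j).subset fun x hx => ?_
  obtain ⟨j, hj, hj'⟩ := Finset.exists_ne_zero_of_sum_ne_zero hx
  exact Set.mem_biUnion hj (right_ne_zero_of_mul hj')

/-- Summation by parts: a finite combination of increments as a combination of the variables. -/
lemma incComb_eq_tsum {Ω : Type*} (ξ : Fin T → ℤ → Ω → ℂ) (c : (ℤ × Fin T) →₀ ℂ) (ω : Ω) :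
    γ.incComb ξ c ω = ∑' x, γ.fwd c x * ξ x.2 x.1 ω := by
  have hs : ∀ (j : ℕ) (g : ℤ × Fin T → ℂ), Summable fun x => c x * g x := fun j g =>
    summable_of_hasFiniteSupport (c.hasFiniteSupport.subset
      fun x hx => left_ne_zero_of_mul hx)
  have hs' : ∀ (j : ℕ) (g : ℤ × Fin T → ℂ),
      Summable fun x : ℤ × Fin T => c (x.1 + j, x.2) * g x := fun j g => by
    refine summable_of_hasFiniteSupport (Set.Finite.subset (c.hasFiniteSupport.preimage
      (f := shiftEquiv T j) (Equiv.injective _).injOn) fun x hx => left_ne_zero_of_mul hx)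
  have h1 : γ.incComb ξ c ω = ∑' x, c x * γ.inc ξ x.2 x.1 ω := by
    rw [tsum_eq_sum (s := c.support)]
    · rfl
    · intro x hx; simp [Finsupp.notMem_support_iff.1 hx]
  have h2 : ∀ x, c x * γ.inc ξ x.2 x.1 ω = ∑ j ∈ Finset.range (γ.n + 1),
      γ.e j * (c x * ξ x.2 (x.1 - j) ω) := fun x => by
    rw [inc, increment_eq_sum, Finset.mul_sum]
    exact Finset.sum_congr rfl fun j _ => by ring
  have h3 : ∀ x, γ.fwd c x * ξ x.2 x.1 ω = ∑ j ∈ Finset.range (γ.n + 1),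
      γ.e j * (c (x.1 + j, x.2) * ξ x.2 x.1 ω) := fun x => by
    rw [fwd, Finset.sum_mul]
    exact Finset.sum_congr rfl fun j _ => by ring
  simp only [h1, h2, h3]
  rw [Summable.tsum_finsetSum fun j _ => (hs j _).mul_left _,
    Summable.tsum_finsetSum fun j _ => (hs' j _).mul_left _]
  refine Finset.sum_congr rfl fun j _ => ?_
  rw [tsum_mul_left, tsum_mul_left, ← (shiftEquiv T j).tsum_eq]
  refine congrArg _ (tsum_congr fun x => ?_)
  simp [shiftEquiv, Prod.map]

lemma fwd_add (c c' : ℤ × Fin T → ℂ) (x : ℤ × Fin T) :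
    γ.fwd (fun y => c y + c' y) x = γ.fwd c x + γ.fwd c' x := by
  simp only [fwd, mul_add, Finset.sum_add_distrib]

/-- At nonnegative times the two-sided difference operator acts on an extension by zero as `E`. -/
lemma fwd_ext_of_nonneg (b : ℕ → Fin T → ℂ) (m : ℕ) (p : Fin T) :
    γ.fwd (ext b) ((m : ℤ), p) = γ.E b m p := by
  simp only [fwd, E, Finset.sum_apply, Pi.smul_apply, smul_eq_mul, ext]
  refine Finset.sum_congr rfl fun j _ => ?_
  rw [if_pos (by positivity)]
  rfl

lemma fwd_eq_zero_of_nonneg {c : ℤ × Fin T → ℂ} (hc : ∀ x, 0 ≤ x.1 → c x = 0) {x : ℤ × Fin T}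
    (hx : 0 ≤ x.1) : γ.fwd c x = 0 :=
  Finset.sum_eq_zero fun j _ => by rw [hc _ (by simp only; positivity), mul_zero]

/-- At the `γ.n` last negative times the two-sided difference operator produces the coefficients of
the initial values; before them it produces zero. -/
lemma fwd_ext_eq_v (b : ℕ → Fin T → ℂ) {k : ℕ} (hk : k ∈ Finset.Icc 1 γ.n) (p : Fin T) :
    γ.fwd (ext b) (-(k : ℤ), p) = γ.v b k p := by
  rw [Finset.mem_Icc] at hk
  simp only [fwd, v, Finset.sum_apply, Pi.smul_apply, smul_eq_mul, ext]
  symm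
  refine Finset.sum_bij_ne_zero (fun l _ _ => l + k) ?_ ?_ ?_ ?_
  · intro l hl _; rw [Finset.mem_range] at hl ⊢; omega
  · intro l _ _ l' _ _ h; omega
  · intro j hj hj'
    rw [Finset.mem_range] at hj
    have hjk : k ≤ j := by
      by_contra hlt
      rw [if_neg (by omega), mul_zero] at hj'
      exact hj' rfl
    refine ⟨j - k, Finset.mem_range.2 (by omega), ?_, by omega⟩
    rw [if_pos (by omega)] at hj'
    convert hj' using 3
    all_goals omega
  · intro l _ _
    rw [if_pos (by push_cast; omega)]
    congr 2
    push_cast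
    omega

lemma fwd_ext_eq_zero (b : ℕ → Fin T → ℂ) {x : ℤ × Fin T} (hx : x.1 < -(γ.n : ℤ)) :
    γ.fwd (ext b) x = 0 := by
  refine Finset.sum_eq_zero fun j hj => ?_
  rw [Finset.mem_range] at hj
  rw [ext, if_neg (by simp only; omega), mul_zero]

/-- The initial value functional collects the terms of negative time. -/
lemma tsum_neg_fwd_ext {Ω : Type*} (ξ : Fin T → ℤ → Ω → ℂ) (b : ℕ → Fin T → ℂ) (ω : Ω) :
    ∑' x, (if 0 ≤ x.1 then 0 else γ.fwd (ext b) x) * ξ x.2 x.1 ω = γ.V b ξ ω := by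
  rw [tsum_eq_sum (s := (Finset.Icc (-(γ.n : ℤ)) (-1)) ×ˢ Finset.univ), Finset.sum_product, V]
  · symm
    refine Finset.sum_bij (fun (k : ℕ) _ => -(k : ℤ)) ?_ ?_ ?_ ?_
    · intro k hk; rw [Finset.mem_Icc] at hk ⊢; omega
    · intro k _ k' _ h; simpa using h
    · intro m hm
      rw [Finset.mem_Icc] at hm
      exact ⟨(-m).toNat, Finset.mem_Icc.2 (by omega), by omega⟩
    · intro k hk
      refine Finset.sum_congr rfl fun p _ => ?_
      rw [γ.fwd_ext_eq_v b hk, if_neg]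
      rw [Finset.mem_Icc] at hk
      simp only
      omega
  · intro x hx
    have : ¬ (-(γ.n : ℤ) ≤ x.1 ∧ x.1 ≤ -1) := by simpa using hx
    split_ifs with h0
    · rw [zero_mul]
    · rw [γ.fwd_ext_eq_zero b (by omega), zero_mul]

/-- The restriction of a one-sided sequence to `k < M`, as a finite combination. -/
def _root_.GM.trunc (b : ℕ → Fin T → ℂ) (M : ℕ) : (ℤ × Fin T) →₀ ℂ :=
  ∑ k ∈ Finset.range M, ∑ p, Finsupp.single ((k : ℤ), p) (b k p)

lemma trunc_apply {b : ℕ → Fin T → ℂ} {M : ℕ} (hb : ∀ k, M ≤ k → b k = 0) (x : ℤ × Fin T) :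
    trunc b M x = ext b x := by
  obtain ⟨m, p⟩ := x
  simp only [trunc, Finsupp.finsetSum_apply, ext, Finsupp.single_apply, Prod.mk.injEq]
  split_ifs with hm
  · lift m to ℕ using hm
    have : ∀ k ∈ Finset.range M, (∑ q, if (k : ℤ) = m ∧ q = p then b k q else 0) =
        if k = m then b m p else 0 := fun k _ => by
      split_ifs with h
      · subst h; simp
      · refine Finset.sum_eq_zero fun q _ => if_neg fun h' => h (by exact_mod_cast h'.1)
    rw [Finset.sum_congr rfl this, Finset.sum_ite_eq']
    split_ifs with h
    · rfl
    · rw [Finset.mem_range] at h; rw [Int.toNat_natCast, hb _ (not_lt.1 h)]; rfl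
  · refine Finset.sum_eq_zero fun k _ => Finset.sum_eq_zero fun q _ => if_neg fun h => hm ?_
    rw [← h.1]
    positivity

/-- The basic identity for finite functionals: `∑ α(k) ζ(k)` is the combination of increments with
the coefficients `b`, less the initial values, if the blocks of `α` are `E b`. -/
lemma sum_eq_incComb_sub_V {Ω : Type*} [NeZero T] (ζ : ℤ → Ω → ℂ) (α : ℕ →₀ ℂ)
    {b : ℕ → Fin T → ℂ} {M : ℕ} (hb : ∀ k, M ≤ k → b k = 0) (hα : γ.E b = blockCoef T α) (ω : Ω) :
    (α.sum fun k z => z * ζ (k : ℤ) ω) =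
      γ.incComb (blocked T ζ) (trunc b M) ω - γ.V b (blocked T ζ) ω := by
  have hfun : (trunc b M : ℤ × Fin T → ℂ) = ext b := funext (trunc_apply hb)
  have hfin : (γ.fwd (ext b)).HasFiniteSupport := by
    rw [← hfun]; exact γ.hasFiniteSupport_fwd (Finsupp.hasFiniteSupport _)
  rw [incComb_eq_tsum, hfun, ← tsum_neg_fwd_ext, ← Summable.tsum_sub]
  rotate_left
  · exact summable_of_hasFiniteSupport (hfin.subset fun x hx => left_ne_zero_of_mul hx)
  · refine summable_of_hasFiniteSupport (hfin.subset fun x hx => ?_)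
    have := left_ne_zero_of_mul hx
    split_ifs at this with h
    · exact absurd rfl this
    · exact this
  have h1 : (α.sum fun k z => z * ζ (k : ℤ) ω) = ∑' k : ℕ, α k * ζ k ω := by
    rw [tsum_eq_sum (s := α.support)]
    · rfl
    · intro k hk; simp [Finsupp.notMem_support_iff.1 hk]
  rw [h1, ← (Nat.divModEquiv T).symm.tsum_eq]
  have hinj : Function.Injective fun x : ℕ × Fin T => ((x.1 : ℤ), x.2) := fun x y h => by
    simp only [Prod.mk.injEq, Nat.cast_inj] at h
    exact Prod.ext h.1 h.2
  rw [← hinj.tsum_eq]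
  · refine tsum_congr fun x => ?_
    simp only
    rw [if_pos (by positivity), zero_mul, sub_zero, fwd_ext_of_nonneg, hα]
    simp [blockCoef, blocked, Nat.divModEquiv]
  · intro x hx
    have h0 : 0 ≤ x.1 := by
      by_contra h0
      simp [if_neg h0] at hx
    exact ⟨(x.1.toNat, x.2), Prod.ext (Int.toNat_of_nonneg h0) rfl⟩

/-! ### Admissible combinations of the observations -/

/-- The evaluation of a polynomial at the shift of two-sided sequences. -/
def _root_.GM.shiftEval (p : Polynomial ℂ) : (ℤ → ℂ) →ₗ[ℂ] (ℤ → ℂ) :=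
  Polynomial.aeval (LinearMap.funLeft ℂ ℂ fun k : ℤ => k + 1) p

lemma _root_.GM.funLeft_pow_apply (j : ℕ) (y : ℤ → ℂ) (k : ℤ) :
    ((LinearMap.funLeft ℂ ℂ fun k : ℤ => k + 1) ^ j) y k = y (k + j) := by
  induction j generalizing k with
  | zero => simp
  | succ j ih =>
    rw [pow_succ', Module.End.mul_apply, LinearMap.funLeft_apply, ih]
    congr 1
    push_cast
    ring

lemma shiftEval_poly (y : ℤ → ℂ) (k : ℤ) :
    shiftEval γ.poly y k = ∑ j ∈ Finset.range (γ.n + 1), γ.e j * y (k + j) := by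
  have hd : γ.poly.natDegree < γ.n + 1 :=
    Nat.lt_succ_of_le (Polynomial.natDegree_le_iff_coeff_eq_zero.2 fun N hN => γ.e_eq_zero hN)
  rw [shiftEval, Polynomial.aeval_eq_sum_range' hd, LinearMap.sum_apply, Finset.sum_apply]
  refine Finset.sum_congr rfl fun j _ => ?_
  rw [LinearMap.smul_apply, Pi.smul_apply, smul_eq_mul, funLeft_pow_apply, e_eq]

/-- On a half-line, a difference operator with characteristic roots on the unit circle has no
nonzero null solutions that vanish at infinity. -/
lemma eqOn_zero_of_shiftEval_poly {y : ℤ → ℂ} (hy : Tendsto y cofinite (𝓝 0)) {R : Set ℤ}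
    {σ : ℤ} (hσ : σ = 1 ∨ σ = -1) (hR : ∀ k ∈ R, ∀ t : ℕ, k + σ * t ∈ R)
    (h : ∀ k ∈ R, shiftEval γ.poly y k = 0) : ∀ k ∈ R, y k = 0 := by
  let Q : Polynomial ℂ → Prop := fun p => ∀ y : ℤ → ℂ, Tendsto y cofinite (𝓝 0) →
    (∀ k ∈ R, shiftEval p y k = 0) → ∀ k ∈ R, y k = 0
  have hmul : ∀ p p', Q p → Q p' → Q (p * p') := fun p p' hp hp' y hy h => by
    refine hp' y hy (hp _ ?_ fun k hk => ?_)
    · have : ∀ k, shiftEval p' y k =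
          ∑ j ∈ Finset.range (p'.natDegree + 1), p'.coeff j * y (k + j) := fun k => by
        rw [shiftEval, Polynomial.aeval_eq_sum_range, LinearMap.sum_apply, Finset.sum_apply]
        refine Finset.sum_congr rfl fun j _ => ?_
        rw [LinearMap.smul_apply, Pi.smul_apply, smul_eq_mul, funLeft_pow_apply]
      rw [funext this, ← Finset.sum_const_zero (s := Finset.range (p'.natDegree + 1))]
      refine tendsto_finsetSum _ fun j _ => ?_
      rw [← mul_zero (p'.coeff j)]
      exact (hy.comp (add_left_injective (j : ℤ)).tendsto_cofinite).const_mul _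
    · have := h k hk
      rwa [shiftEval, map_mul, Module.End.mul_apply] at this
  have hbase : ∀ N : ℕ, 0 < N → Q (1 - Polynomial.X ^ N) := fun N hN y hy h k hk => by
    have hstep : ∀ k ∈ R, y (k + N) = y k := fun k hk => by
      have := h k hk
      rw [shiftEval, map_sub, map_one, map_pow, Polynomial.aeval_X, LinearMap.sub_apply,
        Pi.sub_apply, funLeft_pow_apply, Module.End.one_apply, sub_eq_zero] at this
      exact this.symm
    have hit : ∀ t : ℕ, y (k + σ * (N * t : ℕ)) = y k := fun t => by
      induction t with
      | zero => simp
      | succ t ih =>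
        rw [← ih]
        rcases hσ with rfl | rfl
        · rw [← hstep _ (hR k hk (N * t))]
          congr 1; push_cast; ring
        · rw [← hstep _ (hR k hk (N * (t + 1)))]
          congr 1; push_cast; ring
    have hinj : Function.Injective fun t : ℕ => k + σ * (N * t : ℕ) := fun t t' htt => by
      have hN' : (N : ℤ) ≠ 0 := by exact_mod_cast hN.ne'
      have : σ * ((N : ℤ) * t) = σ * ((N : ℤ) * t') := by
        have := add_left_cancel htt
        push_cast at this
        exact this
      have hσ0 : σ ≠ 0 := by rcases hσ with rfl | rfl <;> decide
      exact_mod_cast mul_left_cancel₀ hN' (mul_left_cancel₀ hσ0 this)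
    have hlim := hy.comp hinj.tendsto_cofinite
    have hconst : (y ∘ fun t : ℕ => k + σ * (N * t : ℕ)) = fun _ => y k := funext hit
    rw [hconst] at hlim
    exact tendsto_nhds_unique tendsto_const_nhds hlim
  have hone : Q 1 := fun y _ h k hk => by
    have := h k hk
    rwa [shiftEval, map_one, Module.End.one_apply] at this
  have hpoly : Q γ.poly := by
    refine Finset.prod_induction _ Q hmul hone fun i _ => ?_
    have hb := hbase _ (Nat.mul_pos (γ.μ_pos i) (γ.s_pos i))
    induction γ.d i with
    | zero => rw [pow_zero]; exact hone
    | succ d ih => rw [pow_succ]; exact hmul _ _ ih hb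
  exact hpoly y hy h

lemma shiftEval_poly_eq_fwd (c : ℤ × Fin T → ℂ) (m : ℤ) (p : Fin T) :
    shiftEval γ.poly (fun k => c (k, p)) m = γ.fwd c (m, p) := by
  rw [shiftEval_poly]; rfl

lemma summable_norm_ext {b : ℕ → Fin T → ℂ} (hb : Summable fun k => ‖b k‖) :
    Summable fun x => ‖ext b x‖ := by
  have hinj : Function.Injective fun x : ℕ × Fin T => ((x.1 : ℤ), x.2) := fun x y h => by
    simp only [Prod.mk.injEq, Nat.cast_inj] at h
    exact Prod.ext h.1 h.2
  rw [← hinj.summable_iff]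
  · refine (summable_prod_of_nonneg fun _ => norm_nonneg _).2 ?_
    refine ⟨fun _ => Summable.of_finite, ?_⟩
    simp only [tsum_fintype]
    refine Summable.of_nonneg_of_le (fun _ => Finset.sum_nonneg fun _ _ => norm_nonneg _)
      (fun k => ?_) (hb.mul_left (T : ℝ))
    calc _ ≤ ∑ _p : Fin T, ‖b k‖ := Finset.sum_le_sum fun p _ => by
          rw [ext, if_pos (by positivity)]
          exact norm_le_pi_norm (b k) p
      _ = T * ‖b k‖ := by simp
  · intro x hx
    rw [ext, if_neg, norm_zero]
    exact fun h0 => hx ⟨(x.1.toNat, x.2), Prod.ext (Int.toNat_of_nonneg h0) rfl⟩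

/-- The admissible combinations of the observations are those whose error has the coefficients
`D a` at nonnegative times, and finitely many coefficients at negative times. -/
lemma admissible_iff [NeZero T] {a : ℕ → ℂ} (ha : γ.CoefCond (blockCoef T a)) (w : ℤ →₀ ℂ) :
    γ.Admissible T a w ↔ ∃ c : (ℤ × Fin T) →₀ ℂ, (∀ x, 0 ≤ x.1 → c x = 0) ∧
      ∀ x, w ((Int.divModEquiv T).symm x) = if 0 ≤ x.1 then 0 else
        -(γ.fwd (ext (γ.D (blockCoef T a))) x + γ.fwd c x) := by
  set φ := (Int.divModEquiv T).symm with hφ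
  set b := γ.D (blockCoef T a) with hb
  have hTpos : 0 < T := Nat.pos_of_ne_zero (NeZero.ne T)
  have hφ0 : ∀ x : ℤ × Fin T, φ x = x.1 * T + ((x.2 : ℕ) : ℤ) := fun x => rfl
  have hφs : ∀ (x : ℤ × Fin T) (j : ℕ), φ x + (T : ℤ) * (j : ℤ) = φ (x.1 + j, x.2) := fun x j => by
    rw [hφ0, hφ0]; ring
  have hφn : ∀ x : ℤ × Fin T, 0 ≤ φ x ↔ 0 ≤ x.1 := fun x => by
    rw [hφ0]
    have h1 : ((x.2 : ℕ) : ℤ) < T := by exact_mod_cast x.2.2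
    constructor
    · intro h; by_contra hneg; nlinarith
    · intro h; positivity
  have hφa : ∀ (m : ℕ) (p : Fin T), a (φ ((m : ℤ), p)).toNat = blockCoef T a m p := fun m p => by
    rw [hφ0, blockCoef]; congr 1
  have hEb : ∀ (m : ℕ) (p : Fin T), γ.fwd (ext b) ((m : ℤ), p) = blockCoef T a m p :=
    fun m p => by rw [fwd_ext_of_nonneg, hb, γ.E_D ha.converges]
  constructor
  · rintro ⟨hw, c, hc, heq⟩
    set c' : ℤ × Fin T → ℂ := fun x => c (φ x) with hc'
    have heq' : ∀ x : ℤ × Fin T, (if 0 ≤ x.1 then a (φ x).toNat else -w (φ x)) = γ.fwd c' x :=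
      fun x => by
        have := heq (φ x)
        simp only [hφn] at this
        rw [this, fwd]
        simp only [hφs, hc']
    have hlim : ∀ (y : ℤ × Fin T → ℂ), Summable (fun x => ‖y x‖) → ∀ p,
        Tendsto (fun k : ℤ => y (k, p)) cofinite (𝓝 0) := fun y hy p => by
      have h1 : Tendsto y cofinite (𝓝 0) :=
        tendsto_zero_iff_norm_tendsto_zero.2 hy.tendsto_cofinite_zero
      exact h1.comp (Function.Injective.tendsto_cofinite fun k k' h => (Prod.mk.inj h).1)
    have hc's : Summable fun x => ‖c' x‖ := (φ.injective.summable_iff (f := fun m => ‖c m‖)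
      (fun x hx => absurd ⟨φ.symm x, φ.apply_symm_apply x⟩ hx)).2 hc
    -- at nonnegative times, the coefficients of the error and `D a` have the same differences
    have hpos : ∀ (p : Fin T) (k : ℤ), 0 ≤ k → c' (k, p) - ext b (k, p) = 0 := fun p => by
      have hsub : Summable fun x => ‖c' x - ext b x‖ :=
        Summable.of_nonneg_of_le (fun _ => norm_nonneg _) (fun _ => norm_sub_le _ _)
          (hc's.add (summable_norm_ext ha.summable_D))
      refine γ.eqOn_zero_of_shiftEval_poly (y := fun k => c' (k, p) - ext b (k, p))
        (hlim _ hsub p) (R := Set.Ici 0) (σ := 1) (Or.inl rfl)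
        (fun k hk t => by simp only [Set.mem_Ici] at hk ⊢; omega) fun k hk => ?_
      have hk' : (0 : ℤ) ≤ k := hk
      lift k to ℕ using hk'
      have h1 : (fun k : ℤ => c' (k, p) - ext b (k, p)) =
        (fun k => c' (k, p)) - fun k => ext b (k, p) := rfl
      rw [h1, map_sub, Pi.sub_apply, shiftEval_poly_eq_fwd, shiftEval_poly_eq_fwd, hEb,
        ← heq', if_pos (by positivity), hφa, sub_self]
    obtain ⟨K, hK⟩ : ∃ K : ℕ, ∀ k ∈ w.support, -(K : ℤ) ≤ k := by
      obtain ⟨K, hK⟩ := (w.support.image fun k => (-k).toNat).exists_le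
      exact ⟨K, fun k hk => by have := hK _ (Finset.mem_image_of_mem _ hk); omega⟩
    -- before all observations in use, the differences vanish
    have hneg : ∀ (p : Fin T) (k : ℤ), k < -(K : ℤ) → c' (k, p) = 0 := fun p => by
      refine γ.eqOn_zero_of_shiftEval_poly (y := fun k => c' (k, p)) (hlim _ hc's p)
        (R := Set.Iio (-(K : ℤ))) (σ := -1) (Or.inr rfl)
        (fun k hk t => by simp only [Set.mem_Iio] at hk ⊢; omega) fun k hk => ?_
      have hk' : k < -(K : ℤ) := hk
      rw [shiftEval_poly_eq_fwd, ← heq', if_neg (by simp only; omega), neg_eq_zero]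
      refine Finsupp.notMem_support_iff.1 fun hmem => ?_
      have h1 := hK _ hmem
      rw [hφ0] at h1
      have h2 : ((p : ℕ) : ℤ) < T := by exact_mod_cast p.2
      simp only at h1
      nlinarith
    have hfin : (Function.support fun x : ℤ × Fin T => if 0 ≤ x.1 then 0 else c' x).Finite := by
      refine ((Finset.Icc (-(K : ℤ)) 0) ×ˢ (Finset.univ : Finset (Fin T))).finite_toSet.subset
        fun x hx => ?_
      have hx' : ¬ (0 ≤ x.1) ∧ c' x ≠ 0 := by
        rw [Function.mem_support] at hx
        split_ifs at hx with h
        · exact absurd rfl hx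
        · exact ⟨h, hx⟩
      have : ¬ x.1 < -(K : ℤ) := fun h => hx'.2 (hneg x.2 x.1 h)
      exact Finset.mem_coe.2 (Finset.mem_product.2
        ⟨Finset.mem_Icc.2 ⟨by omega, by omega⟩, Finset.mem_univ _⟩)
    have hsplit : c' = fun x => ext b x + Finsupp.ofSupportFinite _ hfin x := funext fun x => by
      rw [Finsupp.ofSupportFinite_coe]
      split_ifs with h
      · rw [add_zero, ← sub_eq_zero]; exact hpos x.2 x.1 h
      · rw [ext, if_neg h, zero_add]
    refine ⟨Finsupp.ofSupportFinite _ hfin, fun x hx => ?_, fun x => ?_⟩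
    · rw [Finsupp.ofSupportFinite_coe, if_pos hx]
    · split_ifs with h
      · exact hw _ ((hφn x).2 h)
      · have := heq' x
        rw [if_neg h, hsplit, fwd_add] at this
        rw [← this, neg_neg]
  · rintro ⟨c, hc, hw⟩
    refine ⟨fun k hk => ?_, fun k => ext b (φ.symm k) + c (φ.symm k), ?_, fun k => ?_⟩
    · obtain ⟨x, rfl⟩ := φ.surjective k
      rw [hw, if_pos ((hφn x).1 hk)]
    · have hs : Summable fun x => ‖ext b x + c x‖ :=
        Summable.of_nonneg_of_le (fun _ => norm_nonneg _) (fun _ => norm_add_le _ _)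
          ((summable_norm_ext ha.summable_D).add (summable_of_hasFiniteSupport
            (c.hasFiniteSupport.subset fun x hx => by simpa using hx)))
      exact (φ.symm.injective.summable_iff
        (fun x hx => absurd ⟨φ x, φ.symm_apply_apply x⟩ hx)).2 hs
    · obtain ⟨x, rfl⟩ := φ.surjective k
      have hsum : ∑ j ∈ Finset.range (γ.n + 1), γ.e j *
          (ext b (φ.symm (φ x + (T : ℤ) * (j : ℤ))) + c (φ.symm (φ x + (T : ℤ) * (j : ℤ)))) =
          γ.fwd (ext b) x + γ.fwd c x := by
        rw [← fwd_add, fwd]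
        simp only [hφs, Equiv.symm_apply_apply]
      rw [hsum]
      simp only [hφn]
      split_ifs with h
      · obtain ⟨m, p⟩ := x
        simp only at h
        lift m to ℕ using h
        rw [hφa, hEb, γ.fwd_eq_zero_of_nonneg hc (by positivity), add_zero]
      · rw [hw, if_neg h, neg_neg]

/-- The value of an admissible combination of the observations: the coefficients of `D a` at
nonnegative times contribute the initial values only. -/
lemma sum_eq_neg_incComb_sub_V {Ω : Type*} [NeZero T] (ζ : ℤ → Ω → ℂ) {b : ℕ → Fin T → ℂ}
    {w : ℤ →₀ ℂ} {c : (ℤ × Fin T) →₀ ℂ} (hc : ∀ x, 0 ≤ x.1 → c x = 0)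
    (hw : ∀ x, w ((Int.divModEquiv T).symm x) = if 0 ≤ x.1 then 0 else
        -(γ.fwd (ext b) x + γ.fwd c x)) (ω : Ω) :
    (w.sum fun k z => z * ζ k ω) =
      -γ.incComb (blocked T ζ) c ω - γ.V b (blocked T ζ) ω := by
  have hfin := γ.hasFiniteSupport_fwd (Finsupp.hasFiniteSupport c)
  have hfin' : (fun x : ℤ × Fin T => if 0 ≤ x.1 then 0 else γ.fwd (ext b) x).HasFiniteSupport := by
    refine ((Finset.Icc (-(γ.n : ℤ)) 0) ×ˢ (Finset.univ : Finset (Fin T))).finite_toSet.subset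
        fun x hx => ?_
    have hx' : ¬ (0 ≤ x.1) ∧ γ.fwd (ext b) x ≠ 0 := by
      rw [Function.mem_support] at hx
      split_ifs at hx with h
      · exact absurd rfl hx
      · exact ⟨h, hx⟩
    have : ¬ x.1 < -(γ.n : ℤ) := fun h => hx'.2 (γ.fwd_ext_eq_zero b (x := x) h)
    exact Finset.mem_coe.2 (Finset.mem_product.2
        ⟨Finset.mem_Icc.2 ⟨by omega, by omega⟩, Finset.mem_univ _⟩)
  have h1 : (w.sum fun k z => z * ζ k ω) = ∑' k : ℤ, w k * ζ k ω := by
    rw [tsum_eq_sum (s := w.support)]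
    · rfl
    · intro k hk; simp [Finsupp.notMem_support_iff.1 hk]
  rw [h1, ← (Int.divModEquiv T).symm.tsum_eq, incComb_eq_tsum, ← tsum_neg_fwd_ext, ← tsum_neg,
    ← Summable.tsum_sub]
  rotate_left
  · exact (summable_of_hasFiniteSupport (hfin.subset fun x hx => left_ne_zero_of_mul hx)).neg
  · exact summable_of_hasFiniteSupport (hfin'.subset fun x hx => left_ne_zero_of_mul hx)
  refine tsum_congr fun x => ?_
  rw [hw]
  have : blocked T ζ x.2 x.1 = ζ ((Int.divModEquiv T).symm x) := rfl
  rw [this]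
  split_ifs with h
  · rw [γ.fwd_eq_zero_of_nonneg hc h]; ring
  · ring

/-- Every finite combination of past increments comes from an admissible combination of the
observations. -/
lemma exists_admissible [NeZero T] {a : ℕ → ℂ} (ha : γ.CoefCond (blockCoef T a))
    {c : (ℤ × Fin T) →₀ ℂ} (hc : ∀ x, 0 ≤ x.1 → c x = 0) :
    ∃ w : ℤ →₀ ℂ, γ.Admissible T a w ∧ ∀ x, w ((Int.divModEquiv T).symm x) =
      if 0 ≤ x.1 then 0 else -(γ.fwd (ext (γ.D (blockCoef T a))) x + γ.fwd c x) := by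
  set b := γ.D (blockCoef T a)
  have hfin := γ.hasFiniteSupport_fwd (Finsupp.hasFiniteSupport c)
  have hfin' : (Function.support fun x : ℤ × Fin T =>
      if 0 ≤ x.1 then 0 else -(γ.fwd (ext b) x + γ.fwd c x)).Finite := by
    refine (((Finset.Icc (-(γ.n : ℤ)) 0) ×ˢ
      (Finset.univ : Finset (Fin T))).finite_toSet.union hfin).subset fun x hx => ?_
    have hx' : ¬ (0 ≤ x.1) ∧ -(γ.fwd (ext b) x + γ.fwd c x) ≠ 0 := by
      rw [Function.mem_support] at hx
      split_ifs at hx with h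
      · exact absurd rfl hx
      · exact ⟨h, hx⟩
    by_cases hx2 : γ.fwd c x = 0
    · left
      have : ¬ x.1 < -(γ.n : ℤ) := fun h => hx'.2 (by rw [γ.fwd_ext_eq_zero b (x := x) h, hx2, add_zero, neg_zero])
      exact Finset.mem_coe.2 (Finset.mem_product.2
        ⟨Finset.mem_Icc.2 ⟨by omega, by omega⟩, Finset.mem_univ _⟩)
    · exact Or.inr hx2
  let w := (Finsupp.ofSupportFinite _ hfin').equivMapDomain (Int.divModEquiv T).symm
  have hw : ∀ x, w ((Int.divModEquiv T).symm x) =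
      if 0 ≤ x.1 then 0 else -(γ.fwd (ext b) x + γ.fwd c x) := fun x => by
    rw [Finsupp.equivMapDomain_apply, Equiv.symm_symm, Equiv.apply_symm_apply,
      Finsupp.ofSupportFinite_coe]
  exact ⟨w, (γ.admissible_iff ha w).2 ⟨c, hc, hw⟩, hw⟩

end Params

/-! ### The spectral isometry -/

/-- Two families with the same Gram matrix, the first of them total, are related by an isometry. -/
lemma exists_linearIsometry_of_inner_eq {ι H K : Type*} [NormedAddCommGroup H]
    [InnerProductSpace ℂ H] [NormedAddCommGroup K] [InnerProductSpace ℂ K] [CompleteSpace K]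
    (u : ι → H) (v : ι → K) (huv : ∀ i j, (inner ℂ (u i) (u j) : ℂ) = inner ℂ (v i) (v j))
    (hd : DenseRange (Finsupp.linearCombination ℂ u)) :
    ∃ J : H →ₗᵢ[ℂ] K, ∀ c, J (Finsupp.linearCombination ℂ u c) =
      Finsupp.linearCombination ℂ v c := by
  have hn : ∀ c, ‖Finsupp.linearCombination ℂ v c‖ = ‖Finsupp.linearCombination ℂ u c‖ := fun c => by
    have : (inner ℂ (Finsupp.linearCombination ℂ v c) (Finsupp.linearCombination ℂ v c) : ℂ) =
        inner ℂ (Finsupp.linearCombination ℂ u c) (Finsupp.linearCombination ℂ u c) := by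
      simp only [Finsupp.linearCombination_apply, Finsupp.sum, sum_inner, inner_sum,
        inner_smul_left, inner_smul_right, huv]
    rw [inner_self_eq_norm_sq_to_K, inner_self_eq_norm_sq_to_K] at this
    have h2 : ‖Finsupp.linearCombination ℂ v c‖ ^ 2 = ‖Finsupp.linearCombination ℂ u c‖ ^ 2 := by
      exact_mod_cast this
    exact (sq_eq_sq₀ (norm_nonneg _) (norm_nonneg _)).1 h2
  let J := (Finsupp.linearCombination ℂ v).extendOfNorm (Finsupp.linearCombination ℂ u)
  have hJ : ∀ c, J (Finsupp.linearCombination ℂ u c) = Finsupp.linearCombination ℂ v c :=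
    LinearMap.extendOfNorm_eq hd ⟨1, fun c => by rw [hn, one_mul]⟩
  refine ⟨⟨J.toLinearMap, fun x => ?_⟩, hJ⟩
  refine hd.induction_on (p := fun x => ‖J x‖ = ‖x‖) x
    (isClosed_eq J.continuous.norm continuous_norm) fun c => ?_
  rw [hJ, hn]

/-- The mean square limit of a sequence in `Lp`. -/
lemma exists_Lp_of_tendsto_eLpNorm {α E : Type*} [MeasurableSpace α] {μ : Measure α}
    [NormedAddCommGroup E] (x : ℕ → Lp E 2 μ) {Y : α → E} (hY : AEStronglyMeasurable Y μ)
    (h : Tendsto (fun n => eLpNorm (fun a => x n a - Y a) 2 μ) atTop (𝓝 0)) :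
    ∃ y : Lp E 2 μ, y =ᵐ[μ] Y ∧ Tendsto x atTop (𝓝 y) := by
  have hmem : MemLp Y 2 μ := by
    obtain ⟨n, hn⟩ := (h.eventually_lt_const (u := 1) (by norm_num)).exists
    have h1 : MemLp (fun a => x n a - Y a) 2 μ :=
      ⟨(Lp.aestronglyMeasurable _).sub hY, hn.trans (by norm_num)⟩
    refine ((Lp.memLp (x n)).sub h1).ae_eq (ae_of_all _ fun a => ?_)
    simp
  exact ⟨hmem.toLp Y, hmem.coeFn_toLp, (Lp.tendsto_Lp_iff_tendsto_eLpNorm _ _ hmem).2 h⟩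

/-- If the images of a sequence under an isometry converge, so does the sequence. -/
lemma exists_tendsto_of_tendsto_map {H K : Type*} [NormedAddCommGroup H] [InnerProductSpace ℂ H]
    [CompleteSpace H] [NormedAddCommGroup K] [InnerProductSpace ℂ K] (J : H →ₗᵢ[ℂ] K)
    {x : ℕ → H} {y : K} (h : Tendsto (fun n => J (x n)) atTop (𝓝 y)) :
    ∃ x₀, Tendsto x atTop (𝓝 x₀) ∧ J x₀ = y := by
  have hc : CauchySeq x := by
    have h1 : Cauchy (map J (map x atTop)) := h.cauchySeq
    exact J.isometry.isUniformInducing.cauchy_map_iff.1 h1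
  obtain ⟨x₀, hx₀⟩ := cauchySeq_tendsto_of_complete hc
  exact ⟨x₀, hx₀, tendsto_nhds_unique ((J.continuous.tendsto x₀).comp hx₀) h⟩

namespace DualPair

variable {T : ℕ} {G N : ℝ → Matrix (Fin T) (Fin T) ℂ} (h : DualPair G N)

include h in
/-- The columns of `G` and their translates are total. -/
lemma denseRange_vecComb : DenseRange (vecComb h.left) := by
  have : (LinearMap.range (vecComb h.left)).topologicalClosure = ⊤ := by
    rw [← Submodule.orthogonal_orthogonal_eq_closure, Submodule.orthogonal_eq_top_iff,
      Submodule.eq_bot_iff]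
    intro E hE
    refine h.eq_zero_of_inner_vec_eq_zero fun k p => ?_
    refine (Submodule.mem_orthogonal _ _).1 hE _ ⟨Finsupp.single (k, p) 1, ?_⟩
    simp [vecComb]
  rw [DenseRange, dense_iff_closure_eq]
  have h2 := congrArg (fun S : Submodule ℂ (Spec T) => (S : Set (Spec T))) this
  simpa only [Submodule.topologicalClosure_coe, LinearMap.coe_range, Submodule.top_coe] using h2

end DualPair

namespace Params

variable {r : ℕ} (γ : Params r) {T : ℕ} {Ω : Type*} [MeasurableSpace Ω] {P : Measure Ω}

lemma admissibleStep : AdmissibleStep γ.step :=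
  Or.inl fun i => Int.natCast_pos.2 (γ.μ_pos i)

/-- The increments of the blocked sequence are increments of the sequence itself, with the seasonal
vector `T s`. -/
lemma inc_blocked {Ω : Type*} (ζ : ℤ → Ω → ℂ) (p : Fin T) (m : ℤ) :
    γ.inc (blocked T ζ) p m =
      increment γ.step (fun i => T * γ.s i) γ.d ζ (m * (T : ℤ) + ((p : ℕ) : ℤ)) := by
  funext ω
  refine Finset.sum_congr rfl fun l _ => ?_
  rw [blocked]
  congr 2
  rw [sub_mul, Finset.sum_mul, sub_add_eq_add_sub]
  congr 1
  refine Finset.sum_congr rfl fun i _ => ?_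
  push_cast
  ring

lemma memLp_inc {ζ : ℤ → Ω → ℂ} (hstat : PeriodicallyStationary P T γ.s γ.d ζ) (p : Fin T)
    (m : ℤ) : MemLp (γ.inc (blocked T ζ) p m) 2 P := by
  rw [inc_blocked]
  exact (hstat.1 γ.step γ.admissibleStep _).1

/-- `J` maps `e^{ikλ} χ_μ(e^{-iλ}) β(iλ)⁻¹ δ_p` to the increment `χ_μ(ξ_p(k))`; the functions `h`
in `L₂(f)` are represented by `(f^{1/2})ᵀ h`. -/
def IsSpectralIsometry (P : Measure Ω) (ξ : Fin T → ℤ → Ω → ℂ)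
    {f : ℝ → Matrix (Fin T) (Fin T) ℂ} (hG : MemL2 (γ.incRoot f))
    (J : Spec T →ₗᵢ[ℂ] Lp ℂ 2 P) : Prop :=
  ∀ c, J (vecComb hG c) =ᵐ[P] γ.incComb ξ c

lemma inner_vec_eq_integral_inc {ζ : ℤ → Ω → ℂ} {f : ℝ → Matrix (Fin T) (Fin T) ℂ}
    (hf : IsSpectralDensity P γ.s γ.d (blocked T ζ) f) (hmin : γ.Minimality f)
    (hG : MemL2 (γ.incRoot f)) (k m : ℤ) (q p : Fin T) :
    inner ℂ (vec hG k q) (vec hG m p) =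
      ∫ ω, γ.inc (blocked T ζ) p m ω * star (γ.inc (blocked T ζ) q k ω) ∂P := by
  have h1 := hf.structural γ.step γ.step γ.admissibleStep γ.admissibleStep p q k (m - k)
  rw [add_sub_cancel] at h1
  refine Eq.trans ?_ h1.symm
  rw [inner_vec_vec]
  refine integral_congr_ae ?_
  filter_upwards [γ.ae_incRoot hmin] with l hl
  simp only [hl, Matrix.transpose_apply, Matrix.smul_apply, smul_eq_mul]
  have h2 := star_mul_self_eq_norm_sq (γ.chi l)
  have h3 : expi (m - k) l * GM.chi γ.step γ.s γ.d l * star (GM.chi γ.step γ.s γ.d l) /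
      ((‖GM.beta γ.s γ.d l‖ ^ 2 : ℝ) : ℂ) = expi (m - k) l *
      (star (γ.chi l) * γ.chi l / ((‖γ.beta l‖ ^ 2 : ℝ) : ℂ)) := by
    simp only [chi, beta]; ring
  rw [h3, h2, Complex.ofReal_div]
  ring

/-- The stochastic integral exists: by the definition of the spectral density, the columns of
`incRoot` and the increments have the same Gram matrix. -/
theorem exists_isSpectralIsometry {ζ : ℤ → Ω → ℂ}
    (hstat : PeriodicallyStationary P T γ.s γ.d ζ) {f : ℝ → Matrix (Fin T) (Fin T) ℂ}
    (hf : IsSpectralDensity P γ.s γ.d (blocked T ζ) f) (hmin : γ.Minimality f) :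
    ∃ J : Spec T →ₗᵢ[ℂ] Lp ℂ 2 P,
      γ.IsSpectralIsometry P (blocked T ζ) (γ.dualPair hf.integrable hmin).left J := by
  have h := γ.dualPair hf.integrable hmin
  let v : ℤ × Fin T → Lp ℂ 2 P := fun x => (γ.memLp_inc hstat x.2 x.1).toLp _
  have hv : ∀ x, v x =ᵐ[P] γ.inc (blocked T ζ) x.2 x.1 := fun x => MemLp.coeFn_toLp _
  have hgram : ∀ x y : ℤ × Fin T, (inner ℂ (vec h.left x.1 x.2) (vec h.left y.1 y.2) : ℂ) =
      inner ℂ (v x) (v y) := fun x y => by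
    rw [γ.inner_vec_eq_integral_inc hf hmin, L2.inner_def]
    refine integral_congr_ae ?_
    filter_upwards [hv x, hv y] with ω h1 h2
    rw [h1, h2]
    rfl
  obtain ⟨J, hJ⟩ := exists_linearIsometry_of_inner_eq (fun x : ℤ × Fin T => vec h.left x.1 x.2) v
    hgram h.denseRange_vecComb
  refine ⟨J, fun c => ?_⟩
  have hJc : J (vecComb h.left c) = ∑ x ∈ c.support, c x • v x := hJ c
  rw [hJc]
  refine (Lp.coeFn_finsetSum _ _).trans ?_
  have h1 : ∀ x ∈ c.support, ((c x • v x : Lp ℂ 2 P) : Ω → ℂ) =ᵐ[P]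
      fun ω => c x * γ.inc (blocked T ζ) x.2 x.1 ω := fun x _ => by
    filter_upwards [Lp.coeFn_smul (c x) (v x), hv x] with ω h1 h2
    rw [h1, Pi.smul_apply, h2, smul_eq_mul]
  have h2 := (eventually_all_finset c.support).2 h1
  filter_upwards [h2] with ω hω
  rw [Finset.sum_apply]
  exact Finset.sum_congr rfl hω

end Params

/-! ### The functional -/

namespace Params

variable {r : ℕ} (γ : Params r) {T : ℕ}

/-- The random variable `∫ x dZ - V ξ`. -/
def affineValue {Ω : Type*} [MeasurableSpace Ω] {P : Measure Ω} (J : Spec T →ₗᵢ[ℂ] Lp ℂ 2 P)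
    (b : ℕ → Fin T → ℂ) (ξ : Fin T → ℤ → Ω → ℂ) (x : Spec T) (ω : Ω) : ℂ :=
  J x ω - γ.V b ξ ω

lemma _root_.GM.seriesVec_eq_vecComb {M : ℝ → Matrix (Fin T) (Fin T) ℂ} (hM : MemL2 M)
    {b : ℕ → Fin T → ℂ} {K : ℕ} (hb : ∀ k, K ≤ k → b k = 0) :
    seriesVec hM b = vecComb hM (trunc b K) := by
  rw [seriesVec, tsum_eq_sum (s := Finset.range K), trunc]
  · simp [vecComb, map_sum]
  · intro k hk
    rw [Finset.mem_range, not_lt] at hk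
    simp [hb k hk]

lemma _root_.GM.summable_norm_of_eq_zero {b : ℕ → Fin T → ℂ} {K : ℕ}
    (hb : ∀ k, K ≤ k → b k = 0) : Summable fun k => ‖b k‖ :=
  summable_of_ne_finset_zero (s := Finset.range K) fun k hk => by
    rw [Finset.mem_range, not_lt] at hk
    rw [hb k hk, norm_zero]

lemma _root_.GM.exists_blockCoef_eq_zero [NeZero T] (α : ℕ →₀ ℂ) :
    ∃ K, ∀ k, K ≤ k → blockCoef T α k = 0 := by
  obtain ⟨K, hK⟩ := α.support.exists_le
  refine ⟨K + 1, fun k hk => funext fun p => Finsupp.notMem_support_iff.1 fun h => ?_⟩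
  have h1 := hK _ h
  have h2 : k * 1 ≤ k * T := Nat.mul_le_mul_left k (Nat.pos_of_ne_zero (NeZero.ne T))
  omega

lemma D_eq_zero {a : ℕ → Fin T → ℂ} {K : ℕ} (ha : ∀ k, K ≤ k → a k = 0) {k : ℕ} (hk : K ≤ k) :
    γ.D a k = 0 := by
  rw [γ.D_of_eq_zero ha, Nat.sub_eq_zero_of_le hk, Finset.range_zero, Finset.sum_empty]

lemma tendsto_V {Ω : Type*} (ξ : Fin T → ℤ → Ω → ℂ) {bn : ℕ → ℕ → Fin T → ℂ}
    {b : ℕ → Fin T → ℂ} (h : ∀ k, Tendsto (fun n => bn n k) atTop (𝓝 (b k))) (ω : Ω) :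
    Tendsto (fun n => γ.V (bn n) ξ ω) atTop (𝓝 (γ.V b ξ ω)) := by
  refine tendsto_finsetSum _ fun k _ => tendsto_finsetSum _ fun p _ => Tendsto.mul_const _ ?_
  simp only [v, Finset.sum_apply, Pi.smul_apply]
  exact tendsto_finsetSum _ fun l _ => ((tendsto_pi_nhds.1 (h l)) p).const_smul _

lemma aemeasurable_V {Ω : Type*} [MeasurableSpace Ω] {P : Measure Ω} {ζ : ℤ → Ω → ℂ}
    (hζ : ∀ k, AEMeasurable (ζ k) P) (b : ℕ → Fin T → ℂ) :
    AEMeasurable (γ.V b (blocked T ζ)) P := by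
  unfold V
  exact Finset.aemeasurable_fun_sum _ fun k _ => Finset.aemeasurable_fun_sum _ fun p _ =>
    (hζ _).const_mul _

lemma aemeasurable_affineValue {Ω : Type*} [MeasurableSpace Ω] {P : Measure Ω} {ζ : ℤ → Ω → ℂ}
    (hζ : ∀ k, AEMeasurable (ζ k) P) (J : Spec T →ₗᵢ[ℂ] Lp ℂ 2 P) (b : ℕ → Fin T → ℂ)
    (x : Spec T) : AEMeasurable (γ.affineValue J b (blocked T ζ) x) P :=
  (Lp.aestronglyMeasurable _).aemeasurable.sub (γ.aemeasurable_V hζ b)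

lemma _root_.GM.tendsto_apply_of_tendsto_tsum {E : Type*} [NormedAddCommGroup E] {bn : ℕ → ℕ → E}
    {b : ℕ → E} (h : Tendsto (fun n => ∑' k, ‖bn n k - b k‖ₑ) atTop (𝓝 0)) (k : ℕ) :
    Tendsto (fun n => bn n k) atTop (𝓝 (b k)) := by
  rw [tendsto_iff_edist_tendsto_0]
  refine tendsto_of_tendsto_of_tendsto_of_le_of_le tendsto_const_nhds h (fun _ => zero_le)
    fun n => ?_
  simp only [edist_eq_enorm_sub]
  exact ENNReal.le_tsum k

lemma _root_.GM.tendsto_seriesVec {M : ℝ → Matrix (Fin T) (Fin T) ℂ} (hM : MemL2 M)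
    {bn : ℕ → ℕ → Fin T → ℂ} {b : ℕ → Fin T → ℂ} (hbn : ∀ n, Summable fun k => ‖bn n k‖)
    (hb : Summable fun k => ‖b k‖)
    (h : Tendsto (fun n => ∑' k, ‖bn n k - b k‖ₑ) atTop (𝓝 0)) :
    Tendsto (fun n => seriesVec hM (bn n)) atTop (𝓝 (seriesVec hM b)) := by
  rw [tendsto_iff_norm_sub_tendsto_zero]
  have h1 : Tendsto (fun n => (∑' k, ‖bn n k - b k‖ₑ).toReal * ∑ j, ‖vec hM 0 j‖) atTop
      (𝓝 (0 * ∑ j, ‖vec hM 0 j‖)) :=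
    ((ENNReal.tendsto_toReal ENNReal.zero_ne_top).comp h).mul_const _
  rw [zero_mul] at h1
  refine tendsto_of_tendsto_of_tendsto_of_le_of_le tendsto_const_nhds h1
    (fun _ => norm_nonneg _) fun n => ?_
  refine (norm_seriesVec_sub_le hM (hbn n) hb).trans (le_of_eq ?_)
  rw [ENNReal.tsum_toReal_eq fun _ => enorm_ne_top]
  simp only [toReal_enorm]

/-- Truncations converge in `ℓ¹`. -/
lemma _root_.GM.tendsto_tsum_truncate {E : Type*} [NormedAddCommGroup E] {b : ℕ → E}
    (hb : Summable fun k => ‖b k‖) :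
    Tendsto (fun n => ∑' k, ‖(if k < n then b k else 0) - b k‖ₑ) atTop (𝓝 0) := by
  have hfin : ∑' k, ‖b k‖ₑ ≠ ∞ := by
    have := hb.tsum_ofReal_ne_top
    simpa only [ofReal_norm] using this
  refine (ENNReal.tendsto_sum_nat_add _ hfin).congr fun n => ?_
  rw [← Summable.sum_add_tsum_nat_add' (f := fun k => ‖(if k < n then b k else 0) - b k‖ₑ)
    (k := n) ENNReal.summable, Finset.sum_eq_zero, zero_add]
  · refine tsum_congr fun k => ?_
    rw [if_neg (by omega), zero_sub, enorm_neg]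
  · intro k hk
    rw [if_pos (Finset.mem_range.1 hk), sub_self, enorm_zero]

/-- The functional is a limit of finite ones. -/
lemma exists_finite_approximation [NeZero T] {a : ℕ → ℂ} (ha : γ.CoefCond (blockCoef T a)) :
    ∃ α : ℕ → (ℕ →₀ ℂ), Tendsto (fun n => ∑' k, ‖α n k - a k‖ₑ) atTop (𝓝 0) ∧
      Tendsto (fun n => ∑' k, ‖γ.D (blockCoef T (α n)) k - γ.D (blockCoef T a) k‖ₑ) atTop
        (𝓝 0) := by
  set b := γ.D (blockCoef T a) with hb
  let φ := Nat.divModEquiv T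
  have hφ : ∀ (m : ℕ) (p : Fin T), φ (m * T + p) = (m, p) := fun m p => φ.apply_symm_apply (m, p)
  -- truncate `b`, not `a`: the truncations of `a` need not converge after an application of `D`
  let bn : ℕ → ℕ → Fin T → ℂ := fun n k => if k < n then b k else 0
  have hbn : ∀ n k, n ≤ k → bn n k = 0 := fun n k hk => if_neg (not_lt.2 hk)
  have hEn : ∀ n k, n ≤ k → γ.E (bn n) k = 0 := fun n k hk =>
    Finset.sum_eq_zero fun j _ => by rw [hbn n _ (by omega), smul_zero]
  let α : ℕ → (ℕ →₀ ℂ) := fun n => Finsupp.onFinset (Finset.range (n * T))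
    (fun k => γ.E (bn n) (φ k).1 (φ k).2) fun k hk => by
      rw [Finset.mem_range]
      by_contra hlt
      refine hk ?_
      rw [hEn n _ ?_]
      · rfl
      · exact (Nat.le_div_iff_mul_le (Nat.pos_of_ne_zero (NeZero.ne T))).2 (not_lt.1 hlt)
  have hα : ∀ n k, α n k = γ.E (bn n) (φ k).1 (φ k).2 := fun n k => rfl
  have hblk : ∀ n, blockCoef T (α n) = γ.E (bn n) := fun n => by
    funext m p
    rw [blockCoef, hα, hφ]
  have hlim := tendsto_tsum_truncate (b := b) ha.summable_D
  refine ⟨α, ?_, ?_⟩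
  · set K : ℝ≥0∞ := T * ∑ j ∈ Finset.range (γ.n + 1), ‖γ.e j‖ₑ with hK
    have hKtop : K ≠ ∞ := ENNReal.mul_ne_top (ENNReal.natCast_ne_top T)
      (ENNReal.sum_ne_top.2 fun _ _ => enorm_ne_top)
    have h0 := ENNReal.Tendsto.const_mul hlim (Or.inr hKtop)
    rw [mul_zero] at h0
    refine tendsto_of_tendsto_of_tendsto_of_le_of_le tendsto_const_nhds h0 (fun _ => zero_le)
      fun n => ?_
    have h1 : ∀ x : ℕ × Fin T, ‖α n (φ.symm x) - a (φ.symm x)‖ₑ ≤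
        ∑ j ∈ Finset.range (γ.n + 1), ‖γ.e j‖ₑ * ‖bn n (x.1 + j) - b (x.1 + j)‖ₑ := fun x => by
      have h2 : a (φ.symm x) = γ.E b x.1 x.2 := by rw [hb, γ.E_D ha.converges]; rfl
      rw [h2, hα, Equiv.apply_symm_apply, E, E, Finset.sum_apply, Finset.sum_apply,
        ← Finset.sum_sub_distrib]
      refine (enorm_sum_le _ _).trans (Finset.sum_le_sum fun j _ => ?_)
      rw [Pi.smul_apply, Pi.smul_apply, ← smul_sub, enorm_smul]
      refine mul_le_mul_right (a := ‖γ.e j‖ₑ) ?_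
      rw [← ofReal_norm, ← ofReal_norm]
      exact ENNReal.ofReal_le_ofReal (norm_le_pi_norm (bn n (x.1 + j) - b (x.1 + j)) x.2)
    calc ∑' k, ‖α n k - a k‖ₑ = ∑' x, ‖α n (φ.symm x) - a (φ.symm x)‖ₑ :=
          (φ.symm.tsum_eq fun k => ‖α n k - a k‖ₑ).symm
      _ ≤ ∑' x : ℕ × Fin T, ∑ j ∈ Finset.range (γ.n + 1),
          ‖γ.e j‖ₑ * ‖bn n (x.1 + j) - b (x.1 + j)‖ₑ := ENNReal.tsum_le_tsum h1
      _ = T * ∑ j ∈ Finset.range (γ.n + 1),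
          ‖γ.e j‖ₑ * ∑' m, ‖bn n (m + j) - b (m + j)‖ₑ := by
        rw [ENNReal.tsum_prod']
        simp only [tsum_fintype, Finset.sum_const, Finset.card_univ, Fintype.card_fin,
          nsmul_eq_mul, ENNReal.tsum_mul_left]
        rw [Summable.tsum_finsetSum fun _ _ => ENNReal.summable]
        simp only [ENNReal.tsum_mul_left]
      _ ≤ K * ∑' k, ‖bn n k - b k‖ₑ := by
        rw [hK, mul_assoc, Finset.sum_mul]
        refine mul_le_mul_right (a := (T : ℝ≥0∞)) (Finset.sum_le_sum fun j _ =>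
          mul_le_mul_right (a := ‖γ.e j‖ₑ) ?_)
        exact ENNReal.tsum_comp_le_tsum_of_injective (add_left_injective j)
          fun k => ‖bn n k - b k‖ₑ
  · refine hlim.congr fun n => tsum_congr fun k => ?_
    rw [hblk, γ.D_E (hbn n)]

section value

variable {Ω : Type*} [MeasurableSpace Ω] {P : Measure Ω} [NeZero T] {ζ : ℤ → Ω → ℂ}
  {f : ℝ → Matrix (Fin T) (Fin T) ℂ} {hG : MemL2 (γ.incRoot f)} {J : Spec T →ₗᵢ[ℂ] Lp ℂ 2 P}
  (hJ : γ.IsSpectralIsometry P (blocked T ζ) hG J)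

include hJ in
lemma sum_ae_eq_affineValue (α : ℕ →₀ ℂ) :
    (fun ω => α.sum fun k z => z * ζ (k : ℤ) ω) =ᵐ[P]
      γ.affineValue J (γ.D (blockCoef T α)) (blocked T ζ)
        (seriesVec hG (γ.D (blockCoef T α))) := by
  obtain ⟨K, hK⟩ := exists_blockCoef_eq_zero (T := T) α
  have hD : ∀ k, K ≤ k → γ.D (blockCoef T α) k = 0 := fun k hk => γ.D_eq_zero hK hk
  filter_upwards [hJ (trunc (γ.D (blockCoef T α)) K)] with ω hω
  rw [γ.sum_eq_incComb_sub_V ζ α hD (funext fun m => γ.E_D (γ.DConverges_of_eq_zero hK) m),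
    affineValue, seriesVec_eq_vecComb hG hD, hω]

include hJ in
/-- The functional `Aζ` is `∫ Bᵀ χ β⁻¹ dZ - V ξ`. -/
theorem isFunctionalValue_iff [IsFiniteMeasure P] (hζ : ∀ k, AEMeasurable (ζ k) P) {a : ℕ → ℂ}
    (ha : γ.CoefCond (blockCoef T a)) (X : Ω → ℂ) :
    γ.IsFunctionalValue P T ζ a X ↔ X =ᵐ[P] γ.affineValue J (γ.D (blockCoef T a))
      (blocked T ζ) (seriesVec hG (γ.D (blockCoef T a))) := by
  -- along a subsequence, the finite functionals converge almost surely to the right-hand side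
  have key : ∀ α : ℕ → (ℕ →₀ ℂ), Tendsto
      (fun n => ∑' k, ‖γ.D (blockCoef T (α n)) k - γ.D (blockCoef T a) k‖ₑ) atTop (𝓝 0) →
      ∃ ns : ℕ → ℕ, StrictMono ns ∧ ∀ᵐ ω ∂P,
        Tendsto (fun n => (α (ns n)).sum fun k z => z * ζ (k : ℤ) ω) atTop
          (𝓝 (γ.affineValue J (γ.D (blockCoef T a)) (blocked T ζ)
            (seriesVec hG (γ.D (blockCoef T a))) ω)) := fun α hα => by
    have hs : ∀ n, Summable fun k => ‖γ.D (blockCoef T (α n)) k‖ := fun n => by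
      obtain ⟨K, hK⟩ := exists_blockCoef_eq_zero (T := T) (α n)
      exact summable_norm_of_eq_zero fun k hk => γ.D_eq_zero hK hk
    have h1 := (J.continuous.tendsto _).comp (tendsto_seriesVec hG hs ha.summable_D hα)
    obtain ⟨ns, hns, hae⟩ := (tendstoInMeasure_of_tendsto_Lp h1).exists_seq_tendsto_ae
    refine ⟨ns, hns, ?_⟩
    filter_upwards [hae, ae_all_iff.2 fun n => γ.sum_ae_eq_affineValue hJ (α n)] with ω h2 h3
    simp only [h3]
    exact h2.sub ((γ.tendsto_V _ (tendsto_apply_of_tendsto_tsum hα) ω).comp hns.tendsto_atTop)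
  constructor
  · rintro ⟨-, α, -, hα, hX⟩
    obtain ⟨ns, hns, hae⟩ := key α hα
    obtain ⟨ms, hms, hae'⟩ := TendstoInMeasure.exists_seq_tendsto_ae
      (f := fun n ω => (α (ns n)).sum fun k z => z * ζ (k : ℤ) ω)
      (hX.comp hns.tendsto_atTop)
    filter_upwards [hae, hae'] with ω h1 h2
    exact tendsto_nhds_unique h2 (h1.comp hms.tendsto_atTop)
  · intro hX
    refine ⟨(γ.aemeasurable_affineValue hζ J _ _).congr hX.symm, ?_⟩
    obtain ⟨α, h1, h2⟩ := γ.exists_finite_approximation ha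
    obtain ⟨ns, hns, hae⟩ := key α h2
    refine ⟨fun n => α (ns n), h1.comp hns.tendsto_atTop, h2.comp hns.tendsto_atTop, ?_⟩
    refine tendstoInMeasure_of_tendsto_ae (fun n => ?_) ?_
    · simp only [Finsupp.sum]
      exact (Finset.aemeasurable_fun_sum _ fun (k : ℕ) _ => (hζ k).const_mul _).aestronglyMeasurable
    · filter_upwards [hae, hX] with ω h3 h4
      rw [h4]
      exact h3

end value

end Params

/-! ### Convergent partial sums -/

lemma DualPair.inner_vec_right_seriesVec {T : ℕ} {G N : ℝ → Matrix (Fin T) (Fin T) ℂ}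
    (h : DualPair G N) {b : ℕ → Fin T → ℂ} (hb : Summable fun k => ‖b k‖) (j : ℤ) (q : Fin T) :
    inner ℂ (vec h.right j q) (seriesVec h.left b) = ext b (j, q) := by
  have h1 := (hasSum_seriesVec h.left hb).mapL (innerSL ℂ (vec h.right j q))
  refine h1.unique ?_
  have h2 : ∀ k : ℕ, innerSL ℂ (vec h.right j q) (∑ p, b k p • vec h.left k p) =
      if j = k then b k q else 0 := fun k => by
    simp only [innerSL_apply_apply, inner_sum, inner_smul_right, h.inner_vec_right_left]
    split_ifs with hj <;> simp [hj]
  simp only [h2, ext]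
  split_ifs with hj
  · lift j to ℕ using hj
    simp only [Nat.cast_inj, Int.toNat_natCast]
    have h3 := hasSum_single (f := fun k => if j = k then b k q else 0) j
      fun k hk => if_neg (Ne.symm hk)
    simpa only [if_true] using h3
  · have : ∀ k : ℕ, (if j = (k : ℤ) then b k q else 0) = 0 := fun k =>
      if_neg fun h => hj (by omega)
    simp only [this]
    exact hasSum_zero

namespace Params

variable {r : ℕ} (γ : Params r) {T : ℕ}

section value

variable {Ω : Type*} [MeasurableSpace Ω] {P : Measure Ω} [NeZero T] {ζ : ℤ → Ω → ℂ}
  {f : ℝ → Matrix (Fin T) (Fin T) ℂ} (h : DualPair (γ.incRoot f) (γ.dualRoot f))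
  {J : Spec T →ₗᵢ[ℂ] Lp ℂ 2 P} (hJ : γ.IsSpectralIsometry P (blocked T ζ) h.left J)

include hJ in
/-- If the variables are square integrable and the partial sums converge in mean square, their
limit is the value of the functional: the spectral representatives of the blocked partial sums
then converge, and their coefficients in the biorthogonal system converge to `D a`. -/
theorem ae_eq_affineValue_of_tendsto_sum {a : ℕ → ℂ} (ha : γ.CoefCond (blockCoef T a))
    {X : Ω → ℂ} (hζ : ∀ k, MemLp (ζ k) 2 P)
    (hX : Tendsto (fun N => eLpNorm
      (fun ω => X ω - ∑ k ∈ Finset.range N, a k * ζ (k : ℤ) ω) 2 P) atTop (𝓝 0))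
    (hXm : AEMeasurable X P) :
    X =ᵐ[P] γ.affineValue J (γ.D (blockCoef T a)) (blocked T ζ)
      (seriesVec h.left (γ.D (blockCoef T a))) := by
  set b := γ.D (blockCoef T a) with hb
  have hTpos : 0 < T := Nat.pos_of_ne_zero (NeZero.ne T)
  -- the partial sums over whole periods
  let α : ℕ → (ℕ →₀ ℂ) := fun M => Finsupp.onFinset (Finset.range (M * T))
    (fun k => if k < M * T then a k else 0) fun k hk => by
      rw [Finset.mem_range]; by_contra hlt; exact hk (if_neg hlt)
  have hblk : ∀ M k, blockCoef T (α M) k = if k < M then blockCoef T a k else 0 := fun M k => by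
    funext p
    have hiff : k * T + p < M * T ↔ k < M := by
      constructor
      · intro hlt
        by_contra hMk
        have := Nat.mul_le_mul_right T (not_lt.1 hMk)
        omega
      · intro hlt
        have := Nat.mul_le_mul_right T (Nat.succ_le_of_lt hlt)
        have := p.2
        rw [Nat.succ_mul] at *
        omega
    change (if k * T + p < M * T then a (k * T + p) else 0) = _
    simp only [hiff]
    split_ifs <;> rfl
  let bM : ℕ → ℕ → Fin T → ℂ := fun M => γ.D (blockCoef T (α M))
  have hzero : ∀ M k, M ≤ k → blockCoef T (α M) k = 0 := fun M k hk => by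
    rw [hblk, if_neg (not_lt.2 hk)]
  -- `D` of a truncation of `a` is a partial sum of the series for `D a`
  have hbM : ∀ k, Tendsto (fun M => bM M k) atTop (𝓝 (b k)) := fun k => by
    refine ((γ.tendsto_D ha.converges k).comp (tendsto_sub_atTop_nat k)).congr fun M => ?_
    simp only [bM, γ.D_of_eq_zero (hzero M), Function.comp_apply]
    refine Finset.sum_congr rfl fun j hj => ?_
    rw [Finset.mem_range] at hj
    rw [hblk, if_pos (by omega)]
  have hsM : ∀ M, Summable fun k => ‖bM M k‖ := fun M =>
    summable_norm_of_eq_zero fun k hk => γ.D_eq_zero (hzero M) hk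
  have hVm : ∀ b' : ℕ → Fin T → ℂ, MemLp (γ.V b' (blocked T ζ)) 2 P := fun b' => by
    unfold V
    exact memLp_finsetSum _ fun k _ => memLp_finsetSum _ fun p _ => (hζ _).const_mul _
  have hVlim : Tendsto (fun M => (hVm (bM M)).toLp _) atTop (𝓝 ((hVm b).toLp _)) := by
    have hform : ∀ b', (hVm b').toLp _ = ∑ k ∈ Finset.Icc 1 γ.n, ∑ p,
        γ.v b' k p • (hζ (-(k : ℤ) * (T : ℤ) + ((p : Fin T) : ℕ))).toLp _ := fun b' => by
      refine Lp.ext ((MemLp.coeFn_toLp _).trans ?_)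
      refine ((Lp.coeFn_finsetSum _ _).trans ?_).symm
      have h1 : ∀ᵐ ω ∂P, ∀ k ∈ Finset.Icc 1 γ.n, (∑ p, γ.v b' k p •
          (hζ (-(k : ℤ) * (T : ℤ) + ((p : Fin T) : ℕ))).toLp _ : Lp ℂ 2 P) ω =
          ∑ p, γ.v b' k p * ζ (-(k : ℤ) * (T : ℤ) + ((p : Fin T) : ℕ)) ω := by
        refine (eventually_all_finset _).2 fun k _ => ?_
        have h2 : ∀ᵐ ω ∂P, ∀ p : Fin T, (γ.v b' k p •
            (hζ (-(k : ℤ) * (T : ℤ) + ((p : Fin T) : ℕ))).toLp _ : Lp ℂ 2 P) ω =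
            γ.v b' k p * ζ (-(k : ℤ) * (T : ℤ) + ((p : Fin T) : ℕ)) ω := by
          refine ae_all_iff.2 fun p => ?_
          filter_upwards [Lp.coeFn_smul (γ.v b' k p)
            ((hζ (-(k : ℤ) * (T : ℤ) + ((p : Fin T) : ℕ))).toLp _),
            (hζ (-(k : ℤ) * (T : ℤ) + ((p : Fin T) : ℕ))).coeFn_toLp] with ω h3 h4
          rw [h3, Pi.smul_apply, h4, smul_eq_mul]
        filter_upwards [h2, Lp.coeFn_finsetSum Finset.univ fun p : Fin T => (γ.v b' k p •
            (hζ (-(k : ℤ) * (T : ℤ) + ((p : Fin T) : ℕ))).toLp _ : Lp ℂ 2 P)] with ω h3 h4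
        rw [h4, Finset.sum_apply]
        exact Finset.sum_congr rfl fun p _ => h3 p
      filter_upwards [h1] with ω hω
      rw [Finset.sum_apply]
      exact Finset.sum_congr rfl hω
    simp only [hform]
    refine tendsto_finsetSum _ fun k _ => tendsto_finsetSum _ fun p _ => Tendsto.smul_const ?_ _
    simp only [v, Finset.sum_apply, Pi.smul_apply]
    exact tendsto_finsetSum _ fun l _ => ((tendsto_pi_nhds.1 (hbM l)) p).const_smul _
  have hval : ∀ M, (fun ω => ∑ k ∈ Finset.range (M * T), a k * ζ (k : ℤ) ω) =ᵐ[P]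
      ((J (seriesVec h.left (bM M)) - (hVm (bM M)).toLp _ : Lp ℂ 2 P) : Ω → ℂ) := fun M => by
    filter_upwards [γ.sum_ae_eq_affineValue hJ (α M), Lp.coeFn_sub (J (seriesVec h.left (bM M)))
      ((hVm (bM M)).toLp _), (hVm (bM M)).coeFn_toLp] with ω h1 h2 h3
    rw [h2, Pi.sub_apply, h3]
    refine Eq.trans ?_ h1
    rw [Finsupp.onFinset_sum _ fun _ => zero_mul _]
    refine Finset.sum_congr rfl fun k hk => ?_
    rw [if_pos (Finset.mem_range.1 hk)]
  obtain ⟨x, hxX, hx⟩ := exists_Lp_of_tendsto_eLpNorm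
    (fun M => J (seriesVec h.left (bM M)) - (hVm (bM M)).toLp _) hXm.aestronglyMeasurable (by
      have hmul : Tendsto (fun M : ℕ => M * T) atTop atTop :=
        tendsto_id.atTop_mul_const' hTpos
      refine (hX.comp hmul).congr fun M => ?_
      rw [Function.comp_apply, ← eLpNorm_neg]
      refine eLpNorm_congr_ae ?_
      filter_upwards [hval M] with ω hω
      simp only [Pi.neg_apply]
      rw [hω, neg_sub])
  have hJlim : Tendsto (fun M => J (seriesVec h.left (bM M))) atTop (𝓝 (x + (hVm b).toLp _)) :=
    (hx.add hVlim).congr fun M => sub_add_cancel _ _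
  obtain ⟨y, hy, hJy⟩ := exists_tendsto_of_tendsto_map J hJlim
  -- coefficientwise convergence identifies the limit, as the dual system is total
  have hyb : y = seriesVec h.left b := by
    rw [← sub_eq_zero]
    refine h.symm.eq_zero_of_inner_vec_eq_zero fun k q => ?_
    rw [inner_sub_right, sub_eq_zero, h.inner_vec_right_seriesVec ha.summable_D]
    have h1 : Tendsto (fun M => inner ℂ (vec h.right k q) (seriesVec h.left (bM M))) atTop
        (𝓝 (inner ℂ (vec h.right k q) y)) :=
      ((innerSL ℂ (vec h.right k q)).continuous.tendsto y).comp hy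
    refine tendsto_nhds_unique h1 ?_
    simp only [h.inner_vec_right_seriesVec (hsM _), ext]
    split_ifs
    · exact (tendsto_pi_nhds.1 (hbM _)) q
    · exact tendsto_const_nhds
  rw [hyb] at hJy
  filter_upwards [hxX, Lp.coeFn_add x ((hVm b).toLp _), (hVm b).coeFn_toLp] with ω h1 h2 h3
  rw [affineValue, hJy, h2, Pi.add_apply, h1, h3, add_sub_cancel_right]

/-! ### Linear estimates -/

include hJ in
/-- The linear estimates of the functional are `∫ x dZ - V ξ`, with `x` in the closed span of the
past increments. -/
theorem isLinearEstimate_iff (hζ : ∀ k, AEMeasurable (ζ k) P) {a : ℕ → ℂ}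
    (ha : γ.CoefCond (blockCoef T a)) (X : Ω → ℂ) :
    γ.IsLinearEstimate P T ζ a X ↔ ∃ x ∈ h.past,
      X =ᵐ[P] γ.affineValue J (γ.D (blockCoef T a)) (blocked T ζ) x := by
  set b := γ.D (blockCoef T a) with hb
  have hval : ∀ (w : ℤ →₀ ℂ) (c : (ℤ × Fin T) →₀ ℂ), (∀ x, 0 ≤ x.1 → c x = 0) →
      (∀ x, w ((Int.divModEquiv T).symm x) = if 0 ≤ x.1 then 0 else
        -(γ.fwd (ext b) x + γ.fwd c x)) →
      (fun ω => w.sum fun k z => z * ζ k ω) =ᵐ[P]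
        γ.affineValue J b (blocked T ζ) (vecComb h.left (-c)) := fun w c hc hw => by
    filter_upwards [hJ c, Lp.coeFn_neg (J (vecComb h.left c))] with ω h1 h2
    rw [γ.sum_eq_neg_incComb_sub_V ζ hc hw, affineValue, map_neg, map_neg, h2, Pi.neg_apply, h1]
  constructor
  · rintro ⟨hXm, w, hw, hlim⟩
    have hw' := fun n => (γ.admissible_iff ha (w n)).1 (hw n)
    choose c hc hwc using hw'
    obtain ⟨y, hyX, hy⟩ := exists_Lp_of_tendsto_eLpNorm (fun n => J (vecComb h.left (-c n)))
      (Y := fun ω => X ω + γ.V b (blocked T ζ) ω)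
      (hXm.add (γ.aemeasurable_V hζ b)).aestronglyMeasurable (by
        refine hlim.congr fun n => eLpNorm_congr_ae ?_
        filter_upwards [hval (w n) (c n) (hc n) (hwc n)] with ω hω
        rw [hω, affineValue]
        ring)
    obtain ⟨x, hx, hJx⟩ := exists_tendsto_of_tendsto_map J hy
    refine ⟨x, ?_, ?_⟩
    · refine (Submodule.isClosed_topologicalClosure _).mem_of_tendsto hx
        (Eventually.of_forall fun n => Submodule.le_topologicalClosure _ ⟨-c n, ?_, rfl⟩)
      refine (Finsupp.mem_supported ℂ _).2 fun z hz => ?_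
      by_contra hz'
      refine (Finsupp.mem_support_iff.1 hz) ?_
      rw [Finsupp.neg_apply, hc n z (by simp only [Set.mem_ofPred_eq] at hz'; omega), neg_zero]
    · filter_upwards [hyX] with ω hω
      rw [affineValue, hJx, hω, add_sub_cancel_right]
  · rintro ⟨x, hx, hX⟩
    refine ⟨(γ.aemeasurable_affineValue hζ J b x).congr hX.symm, ?_⟩
    obtain ⟨u, hu, hux⟩ := mem_closure_iff_seq_limit.1 hx
    choose c hc hcu using hu
    have hc' : ∀ n x, 0 ≤ x.1 → (-c n) x = 0 := fun n z hz => by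
      rw [Finsupp.neg_apply, neg_eq_zero]
      by_contra hne
      have := (Finsupp.mem_supported ℂ _).1 (hc n) (Finsupp.mem_support_iff.2 hne)
      simp only [Set.mem_ofPred_eq] at this
      omega
    choose w hw hwc using fun n => γ.exists_admissible ha (hc' n)
    refine ⟨w, hw, ?_⟩
    have h1 := (J.continuous.tendsto x).comp hux
    rw [Lp.tendsto_Lp_iff_tendsto_eLpNorm'] at h1
    refine h1.congr fun n => eLpNorm_congr_ae ?_
    filter_upwards [hval (w n) (-c n) (hc' n) (hwc n), hX] with ω h2 h3
    rw [h2, h3, Pi.sub_apply, neg_neg, hcu, affineValue, affineValue, Function.comp_apply]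
    ring

omit [NeZero T] in
lemma mse_affineValue (J : Spec T →ₗᵢ[ℂ] Lp ℂ 2 P) (b : ℕ → Fin T → ℂ)
    (ξ : Fin T → ℤ → Ω → ℂ) (x y : Spec T) :
    mse P (γ.affineValue J b ξ x) (γ.affineValue J b ξ y) = ENNReal.ofReal (‖x - y‖ ^ 2) := by
  have h1 : eLpNorm (J x - J y : Lp ℂ 2 P) 2 P ^ 2 = ENNReal.ofReal (‖x - y‖ ^ 2) := by
    rw [← Lp.enorm_def, ← map_sub, ← ofReal_norm, J.norm_map, ENNReal.ofReal_pow (norm_nonneg _)]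
  rw [← h1, eLpNorm_eq_lintegral_rpow_enorm_toReal (by norm_num) (by norm_num)]
  have h2 : ∀ x : ℝ≥0∞, (x ^ (1 / (2 : ℝ≥0∞).toReal)) ^ 2 = x := fun x => by
    rw [← ENNReal.rpow_natCast, ← ENNReal.rpow_mul]; norm_num
  rw [h2, mse]
  refine lintegral_congr_ae ?_
  filter_upwards [Lp.coeFn_sub (J x) (J y)] with ω hω
  rw [hω, Pi.sub_apply, affineValue, affineValue, sub_sub_sub_cancel_right]
  norm_num

omit [NeZero T] in
lemma mse_congr {Y X X' : Ω → ℂ} (hX : X =ᵐ[P] X') : mse P Y X = mse P Y X' :=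
  lintegral_congr_ae (by filter_upwards [hX] with ω h1; rw [h1])

include hJ in
/-- The optimal estimate corresponds to the orthogonal projection on the past. -/
theorem isOptimalEstimate_iff (hζ : ∀ k, AEMeasurable (ζ k) P) {a : ℕ → ℂ}
    (ha : γ.CoefCond (blockCoef T a)) (y : Spec T) (X : Ω → ℂ) :
    γ.IsOptimalEstimate P T ζ a
        (γ.affineValue J (γ.D (blockCoef T a)) (blocked T ζ) y) X ↔
      X =ᵐ[P] γ.affineValue J (γ.D (blockCoef T a)) (blocked T ζ)
        (h.past.starProjection y) := by
  set b := γ.D (blockCoef T a) with hb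
  set x₀ := h.past.starProjection y with hx₀
  have hx₀m : x₀ ∈ h.past := Submodule.starProjection_apply_mem _ _
  have hpyth : ∀ x ∈ h.past, ‖y - x‖ ^ 2 = ‖y - x₀‖ ^ 2 + ‖x₀ - x‖ ^ 2 := fun x hx => by
    have h0 := norm_add_sq_eq_norm_sq_add_norm_sq_of_inner_eq_zero (𝕜 := ℂ) (y - x₀) (x₀ - x)
      ((Submodule.mem_orthogonal' _ _).1 (Submodule.sub_starProjection_mem_orthogonal y) _
        (Submodule.sub_mem _ hx₀m hx))
    rw [sub_add_sub_cancel] at h0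
    simpa only [sq] using h0
  constructor
  · rintro ⟨h1, h2⟩
    obtain ⟨x, hx, hX⟩ := (γ.isLinearEstimate_iff h hJ hζ ha X).1 h1
    have h3 := h2 _ ((γ.isLinearEstimate_iff h hJ hζ ha _).2 ⟨x₀, hx₀m, ae_eq_refl _⟩)
    rw [mse_congr hX, mse_affineValue, mse_affineValue,
      ENNReal.ofReal_le_ofReal_iff (by positivity), hpyth x hx] at h3
    have h4 : ‖x₀ - x‖ ^ 2 = 0 := le_antisymm (by linarith) (by positivity)
    have h5 : x₀ = x := sub_eq_zero.1 (norm_eq_zero.1 (by simpa using h4))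
    rw [h5]
    exact hX
  · intro hX
    refine ⟨(γ.isLinearEstimate_iff h hJ hζ ha X).2 ⟨x₀, hx₀m, hX⟩, fun X' hX' => ?_⟩
    obtain ⟨x, hx, hX2⟩ := (γ.isLinearEstimate_iff h hJ hζ ha X').1 hX'
    rw [mse_congr hX, mse_congr hX2, mse_affineValue, mse_affineValue, hpyth x hx]
    exact ENNReal.ofReal_le_ofReal (by linarith [sq_nonneg ‖x₀ - x‖])

end value

end Params

/-! ### Weighted spaces and their representation -/

lemma tendsto_sq_zero_iff {x : ℕ → ℝ≥0∞} :
    Tendsto (fun n => x n ^ 2) atTop (𝓝 0) ↔ Tendsto x atTop (𝓝 0) := by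
  constructor
  · intro h
    have h1 := ((ENNReal.continuous_rpow_const (y := 1 / 2)).tendsto 0).comp h
    rw [ENNReal.zero_rpow_of_pos (by norm_num)] at h1
    refine h1.congr fun n => ?_
    rw [Function.comp_apply, ← ENNReal.rpow_natCast, ← ENNReal.rpow_mul]
    norm_num
  · intro h
    have h1 := ((ENNReal.continuous_pow 2).tendsto 0).comp h
    rwa [zero_pow two_ne_zero] at h1

section act

variable {T : ℕ} {κ : Type*} [Fintype κ]

lemma act_sub (M : ℝ → Matrix (Fin T) κ ℂ) (u v : ℝ → κ → ℂ) (l : ℝ) :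
    act M (fun l => u l - v l) l = act M u l - act M v l := by
  simp only [act, Matrix.mulVec_sub, WithLp.toLp_sub]

/-- Convergence in a weighted space is convergence of the representatives. -/
lemma tendsto_weightedSq_iff {M W : ℝ → Matrix (Fin T) (Fin T) ℂ}
    (hW : ∀ᵐ l ∂freq, (M l)ᴴ * M l = (W l)ᵀ) {x : ℕ → Spec T} {u : ℕ → ℝ → Fin T → ℂ}
    (hx : ∀ n, x n =ᵐ[freq] act M (u n)) (v : ℝ → Fin T → ℂ) :
    Tendsto (fun n => weightedSq W fun l => v l - u n l) atTop (𝓝 0) ↔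
      Tendsto (fun n => eLpNorm (fun l => x n l - act M v l) 2 freq) atTop (𝓝 0) := by
  have h1 : ∀ n, weightedSq W (fun l => v l - u n l) =
      eLpNorm (fun l => x n l - act M v l) 2 freq ^ 2 := fun n => by
    rw [weightedSq_eq hW, ← eLpNorm_neg]
    congr 1
    refine eLpNorm_congr_ae ?_
    filter_upwards [hx n] with l hl
    rw [Pi.neg_apply, act_sub, hl, neg_sub]
  simp only [h1, tendsto_sq_zero_iff]

end act

namespace DualPair

variable {T : ℕ} {G N : ℝ → Matrix (Fin T) (Fin T) ℂ} (h : DualPair G N)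

include h in
lemma ae_mul_conjTranspose : ∀ᵐ l ∂freq, N l * (G l)ᴴ = 1 := by
  filter_upwards [h.dual] with l hl
  exact mul_eq_one_comm.1 hl

lemma inner_left_polyComb (g : ℕ →₀ (Fin T → ℂ)) (k : ℕ) (p : Fin T) :
    inner ℂ (vec h.left k p) (polyComb h.right g) = g k p := by
  rw [← seriesVec_finsupp, h.symm.inner_vec_right_seriesVec
    (summable_of_hasFiniteSupport (g.hasFiniteSupport.subset fun k hk => by simpa using hk))]
  simp [ext]

/-- The future is orthogonal to the past. -/
lemma inner_left_eq_zero_of_mem_future {y : Spec T} (hy : y ∈ h.future) {k : ℤ} (hk : k ≤ -1)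
    (p : Fin T) : inner ℂ (vec h.left k p) y = 0 := by
  refine h.inner_future_eq_zero (fun j q => ?_) hy
  rw [h.symm.inner_vec_right_left, if_neg]
  rintro ⟨rfl, -⟩
  omega

lemma inner_right_eq_zero_of_mem_past {x : Spec T} (hx : x ∈ h.past) (j : ℕ) (q : Fin T) :
    inner ℂ (vec h.right j q) x = 0 := by
  refine h.inner_past_eq_zero (fun k hk p => ?_) hx
  rw [h.inner_vec_right_left, if_neg]
  rintro ⟨rfl, -⟩
  omega

end DualPair

/-! ### The inverse of the operator `F` -/

namespace Params

variable {r : ℕ} (γ : Params r) {T : ℕ}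

section inverse

variable {f : ℝ → Matrix (Fin T) (Fin T) ℂ} (h : DualPair (γ.incRoot f) (γ.dualRoot f))
  (hN : ∀ᵐ l ∂freq, (γ.dualRoot f l)ᴴ * γ.dualRoot f l = (γ.invWeight f l)ᵀ)

include hN in
/-- The blocks `F(j,k)` form the Gram matrix of the dual system. -/
lemma inner_right_right (j k : ℕ) (p q : Fin T) :
    inner ℂ (vec h.right j p) (vec h.right k q) = γ.F f j k p q := by
  rw [inner_vec_vec, F, Matrix.of_apply]
  refine integral_congr_ae ?_
  filter_upwards [hN] with l hl
  rw [hl, invWeight, Matrix.transpose_smul, Matrix.smul_apply, smul_eq_mul, mul_assoc]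

include hN in
lemma inner_right_polyComb (g : ℕ →₀ (Fin T → ℂ)) (j : ℕ) (p : Fin T) :
    inner ℂ (vec h.right j p) (polyComb h.right g) =
      (g.sum fun k z => γ.F f j k *ᵥ z) p := by
  rw [polyComb_apply, Finsupp.sum, Finsupp.sum, inner_sum, Finset.sum_apply]
  refine Finset.sum_congr rfl fun k _ => ?_
  rw [inner_sum, Matrix.mulVec, dotProduct]
  refine Finset.sum_congr rfl fun q _ => ?_
  rw [inner_smul_right, γ.inner_right_right h hN, mul_comm]

include hN in
/-- Solutions of `F c = b` correspond to the elements of the future with prescribed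
coefficients in the dual system. -/
theorem isFInverse_iff (b c : ℕ → Fin T → ℂ) (C : ℝ → Fin T → ℂ) :
    γ.IsFInverse f b c C ↔ AEMeasurable C freq ∧ ∃ y ∈ h.future,
      y =ᵐ[freq] act (γ.dualRoot f) C ∧
      (∀ (j : ℕ) q, inner ℂ (vec h.right j q) y = b j q) ∧
      ∀ (k : ℕ) p, inner ℂ (vec h.left k p) y = c k p := by
  have hcont : ∀ (z : Spec T) {g : ℕ → (ℕ →₀ (Fin T → ℂ))} {y : Spec T},
      Tendsto (fun n => polyComb h.right (g n)) atTop (𝓝 y) →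
      Tendsto (fun n => inner ℂ z (polyComb h.right (g n))) atTop (𝓝 (inner ℂ z y)) :=
    fun z g y hy => ((innerSL ℂ z).continuous.tendsto y).comp hy
  refine and_congr_right fun hC => ⟨?_, ?_⟩
  · rintro ⟨g, h1, h2, h3⟩
    rw [tendsto_weightedSq_iff hN fun n => coeFn_polyComb h.right (g n)] at h1
    obtain ⟨y, hyC, hy⟩ := exists_Lp_of_tendsto_eLpNorm _ (aestronglyMeasurable_act h.right hC) h1
    refine ⟨y, (Submodule.isClosed_topologicalClosure _).mem_of_tendsto hy
      (Eventually.of_forall fun n => Submodule.le_topologicalClosure _ ⟨g n, rfl⟩), hyC,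
      fun j q => ?_, fun k p => ?_⟩
    · refine tendsto_nhds_unique (hcont _ hy) ?_
      simp only [γ.inner_right_polyComb h hN]
      exact (tendsto_pi_nhds.1 (h3 j)) q
    · refine tendsto_nhds_unique (hcont _ hy) ?_
      simp only [h.inner_left_polyComb]
      exact (tendsto_pi_nhds.1 (h2 k)) p
  · rintro ⟨y, hyf, hyC, h2, h3⟩
    obtain ⟨u, hu, huy⟩ := mem_closure_iff_seq_limit.1 hyf
    choose g hg using hu
    have hlim : Tendsto (fun n => polyComb h.right (g n)) atTop (𝓝 y) :=
      huy.congr fun n => (hg n).symm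
    refine ⟨g, ?_, fun k => tendsto_pi_nhds.2 fun p => ?_, fun j => tendsto_pi_nhds.2 fun q => ?_⟩
    · rw [tendsto_weightedSq_iff hN fun n => coeFn_polyComb h.right (g n)]
      refine ((Lp.tendsto_Lp_iff_tendsto_eLpNorm' _ _).1 hlim).congr fun n =>
        eLpNorm_congr_ae ?_
      filter_upwards [hyC] with l hl
      rw [Pi.sub_apply, hl]
    · have := hcont (vec h.left k p) hlim
      simpa only [h.inner_left_polyComb, h3] using this
    · have := hcont (vec h.right j q) hlim
      simpa only [γ.inner_right_polyComb h hN, h2] using this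

include hN in
/-- If `F` is bounded on `ℓ²`, a solution of `F c = b` there is the solution in the energy space: the
energy norm is then dominated by the `ℓ²` norm, so the finite sections of `c` converge in both. -/
theorem eq_of_hasMatrixF
    {Fop : lp (fun _ : ℕ => EuclideanSpace ℂ (Fin T)) 2 →L[ℂ]
      lp (fun _ : ℕ => EuclideanSpace ℂ (Fin T)) 2} (hF : γ.HasMatrixF f Fop)
    (c : lp (fun _ : ℕ => EuclideanSpace ℂ (Fin T)) 2) {y : Spec T} (hy : y ∈ h.future)
    (hc : ∀ (j : ℕ) q, inner ℂ (vec h.right j q) y = Fop c j q) (k : ℕ) (p : Fin T) :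
    c k p = inner ℂ (vec h.left k p) y := by
  let u : (ℕ →₀ (Fin T → ℂ)) →ₗ[ℂ] lp (fun _ : ℕ => EuclideanSpace ℂ (Fin T)) 2 :=
    Finsupp.lsum ℂ fun k => (lp.lsingle 2 k).comp (WithLp.linearEquiv 2 ℂ (Fin T → ℂ)).symm.toLinearMap
  have hu : ∀ g : ℕ →₀ (Fin T → ℂ), u g = ∑ k ∈ g.support, lp.single 2 k (WithLp.toLp 2 (g k)) :=
    fun g => rfl
  -- the quadratic form of `F` is the square of the norm in the energy space
  have hFu : ∀ (g : ℕ →₀ (Fin T → ℂ)) (j : ℕ) (q : Fin T),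
      inner ℂ (vec h.right j q) (polyComb h.right g) = Fop (u g) j q := fun g j q => by
    rw [γ.inner_right_polyComb h hN, hu, map_sum, Finsupp.sum, Finset.sum_apply,
      lp.coeFn_sum, Finset.sum_apply, WithLp.ofLp_sum, Finset.sum_apply]
    refine Finset.sum_congr rfl fun k _ => ?_
    exact (hF j k (WithLp.toLp 2 (g k)) q).symm
  have hform : ∀ (g : ℕ →₀ (Fin T → ℂ)) (z : Spec T)
      (w : lp (fun _ : ℕ => EuclideanSpace ℂ (Fin T)) 2),
      (∀ (j : ℕ) q, inner ℂ (vec h.right j q) z = w j q) →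
      inner ℂ (polyComb h.right g) z = inner ℂ (u g) w := fun g z w hw => by
    rw [hu, polyComb_apply, Finsupp.sum, sum_inner, sum_inner]
    refine Finset.sum_congr rfl fun k _ => ?_
    rw [lp.inner_single_left, sum_inner, EuclideanSpace.inner_eq_star_dotProduct, dotProduct]
    refine Finset.sum_congr rfl fun q _ => ?_
    rw [inner_smul_left, hw, Pi.star_apply, mul_comm]
    rfl
  have hbound : ∀ g, ‖polyComb h.right g‖ ^ 2 ≤ ‖Fop‖ * ‖u g‖ ^ 2 := fun g => by
    have h1 := hform g _ _ (hFu g)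
    rw [inner_self_eq_norm_sq_to_K] at h1
    have h2 : ‖polyComb h.right g‖ ^ 2 = ‖(inner ℂ (u g) (Fop (u g)) : ℂ)‖ := by
      rw [← h1]; simp
    rw [h2]
    refine (norm_inner_le_norm _ _).trans ?_
    nlinarith [Fop.le_opNorm (u g), norm_nonneg (u g)]
  -- the finite sections of `c` converge in the energy space
  let g : ℕ → (ℕ →₀ (Fin T → ℂ)) := fun n =>
    Finsupp.onFinset (Finset.range n) (fun k => if k < n then (c k).ofLp else 0) fun k hk => by
      rw [Finset.mem_range]; by_contra hlt; exact hk (if_neg hlt)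
  have hug : Tendsto (fun n => u (g n)) atTop (𝓝 c) := by
    refine (lp.hasSum_single (by norm_num) c).tendsto_sum_nat.congr fun n => ?_
    rw [hu]
    symm
    have : ∀ k ∈ Finset.range n, lp.single 2 k (c k) =
        lp.single (E := fun _ : ℕ => EuclideanSpace ℂ (Fin T)) 2 k (WithLp.toLp 2 (g n k)) :=
      fun k hk => by
        have : g n k = (c k).ofLp := if_pos (Finset.mem_range.1 hk)
        rw [this]
    rw [Finset.sum_congr rfl this]
    refine Finset.sum_subset Finsupp.support_onFinset_subset fun k _ hk => ?_
    rw [Finsupp.notMem_support_iff.1 hk, WithLp.toLp_zero, lp.single_zero]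
  have hcauchy : CauchySeq fun n => polyComb h.right (g n) := by
    rw [Metric.cauchySeq_iff']
    intro δ hδ
    have hpos : 0 < δ / (√‖Fop‖ + 1) := by positivity
    obtain ⟨M, hM⟩ := Metric.cauchySeq_iff'.1 hug.cauchySeq _ hpos
    refine ⟨M, fun n hn => ?_⟩
    have h1 := hM n hn
    rw [dist_eq_norm, ← map_sub] at h1 ⊢
    rw [lt_div_iff₀ (by positivity)] at h1
    have h2 : ‖polyComb h.right (g n - g M)‖ ≤ √‖Fop‖ * ‖u (g n - g M)‖ := by
      refine abs_le_of_sq_le_sq' ?_ (by positivity) |>.2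
      rw [mul_pow, Real.sq_sqrt (norm_nonneg _)]
      exact hbound _
    nlinarith [norm_nonneg (u (g n - g M))]
  obtain ⟨y', hy'⟩ := cauchySeq_tendsto_of_complete hcauchy
  have hy'f : y' ∈ h.future := (Submodule.isClosed_topologicalClosure _).mem_of_tendsto hy'
      (Eventually.of_forall fun n => Submodule.le_topologicalClosure _ ⟨g n, rfl⟩)
  have heval : ∀ {v : ℕ → lp (fun _ : ℕ => EuclideanSpace ℂ (Fin T)) 2} {v₀}, Tendsto v atTop (𝓝 v₀) →
      ∀ (j : ℕ) q, Tendsto (fun n => v n j q) atTop (𝓝 (v₀ j q)) := fun hv j q => by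
    have h1 := ((lp.evalCLM ℂ (fun _ : ℕ => EuclideanSpace ℂ (Fin T)) 2 j).continuous.tendsto _).comp hv
    exact (((EuclideanSpace.proj (𝕜 := ℂ) q).continuous.tendsto _).comp h1)
  have hyy : y' = y := h.eq_of_mem_future hy'f hy fun j q => by
    rw [hc]
    refine tendsto_nhds_unique (((innerSL ℂ (vec h.right j q)).continuous.tendsto y').comp hy') ?_
    refine (heval ((Fop.continuous.tendsto c).comp hug) j q).congr fun n => ?_
    exact (hFu (g n) j q).symm
  rw [← hyy]
  refine tendsto_nhds_unique (heval hug k p)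
    ((((innerSL ℂ (vec h.left k p)).continuous.tendsto y').comp hy').congr' ?_)
  have h1 : ∀ n, (innerSL ℂ (vec h.left k p)) (polyComb h.right (g n)) = g n k p := fun n =>
    h.inner_left_polyComb (g n) k p
  have h2 : ∀ n, u (g n) k = WithLp.toLp 2 (g n k) := fun n => by
    rw [hu, lp.coeFn_sum, Finset.sum_apply]
    rw [Finset.sum_eq_single k]
    · exact lp.single_apply_self 2 k _
    · intro j _ hj; exact lp.single_apply_ne 2 j _ hj.symm
    · intro hk; rw [Finsupp.notMem_support_iff.1 hk, WithLp.toLp_zero, lp.single_zero]; rfl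
  refine Eventually.of_forall fun n => ?_
  rw [Function.comp_apply, h1]
  exact (congrArg (fun z : EuclideanSpace ℂ (Fin T) => z p) (h2 n)).symm

end inverse

end Params

/-! ### Spectral characteristics -/

namespace Params

variable {r : ℕ} (γ : Params r) {T : ℕ} {f : ℝ → Matrix (Fin T) (Fin T) ℂ}

lemma act_rootT_trig (c : (ℤ × Fin T) →₀ ℂ) (l : ℝ) :
    act (rootT f) (γ.trig c) l = act (γ.incRoot f) (trigVec c) l := by
  have : γ.trig c l = (γ.chi l / γ.beta l) • trigVec c l := by
    funext q
    rw [Pi.smul_apply, smul_eq_mul, trig, trigVec, Finsupp.sum, Finsupp.sum, Finset.mul_sum]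
    refine Finset.sum_congr rfl fun x _ => ?_
    split_ifs
    · ring
    · rw [mul_zero]
  simp only [act, this, incRoot, Matrix.mulVec_smul, Matrix.smul_mulVec]

variable {Ω : Type*} [MeasurableSpace Ω] {P : Measure Ω} {ξ : Fin T → ℤ → Ω → ℂ}

/-- The spectral characteristic of `∫ x dZ - V ξ` is the function represented by `x`. -/
theorem isSpectralCharacteristic_iff (h : DualPair (γ.incRoot f) (γ.dualRoot f))
    (hS : MemL2 (rootT f)) (hSf : ∀ᵐ l ∂freq, (rootT f l)ᴴ * rootT f l = (f l)ᵀ)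
    {J : Spec T →ₗᵢ[ℂ] Lp ℂ 2 P} (hJ : γ.IsSpectralIsometry P ξ h.left J)
    (b : ℕ → Fin T → ℂ) {x : Spec T} (hx : x ∈ h.past) (u : ℝ → Fin T → ℂ) :
    γ.IsSpectralCharacteristic P ξ f b (γ.affineValue J b ξ x) u ↔
      AEMeasurable u freq ∧ x =ᵐ[freq] act (rootT f) u := by
  have hcoe : ∀ c : (ℤ × Fin T) →₀ ℂ, vecComb h.left c =ᵐ[freq] act (rootT f) (γ.trig c) :=
    fun c => (coeFn_vecComb h.left c).trans (ae_of_all _ fun l => (γ.act_rootT_trig c l).symm)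
  refine and_congr_right fun hu => ⟨?_, ?_⟩
  · rintro ⟨-, Y, ⟨hYm, c, hc1, hc2⟩, hXY⟩
    rw [tendsto_weightedSq_iff hSf fun n => hcoe (c n)] at hc1
    obtain ⟨y, hyu, hy⟩ := exists_Lp_of_tendsto_eLpNorm _ (aestronglyMeasurable_act hS hu) hc1
    obtain ⟨z, hzY, hz⟩ := exists_Lp_of_tendsto_eLpNorm (fun n => J (vecComb h.left (c n)))
      hYm.aestronglyMeasurable (by
        refine hc2.congr fun n => ?_
        rw [← eLpNorm_neg]
        refine eLpNorm_congr_ae ?_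
        filter_upwards [hJ (c n)] with ω hω
        rw [Pi.neg_apply, hω, neg_sub])
    have hJy : J y = z := tendsto_nhds_unique ((J.continuous.tendsto y).comp hy) hz
    have hJx : J x = J y := Lp.ext (by
      filter_upwards [hXY, hzY] with ω h1 h2
      rw [hJy, h2]
      simpa [affineValue] using h1)
    rw [J.injective hJx]
    exact hyu
  · intro hxu
    obtain ⟨v, hv, hvx⟩ := mem_closure_iff_seq_limit.1 hx
    choose c hc hcv using hv
    have hlim : Tendsto (fun n => vecComb h.left (c n)) atTop (𝓝 x) :=
      hvx.congr fun n => (hcv n).symm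
    have hw : Tendsto (fun n => weightedSq f fun l => u l - γ.trig (c n) l) atTop (𝓝 0) := by
      rw [tendsto_weightedSq_iff hSf fun n => hcoe (c n)]
      refine ((Lp.tendsto_Lp_iff_tendsto_eLpNorm' _ _).1 hlim).congr fun n => eLpNorm_congr_ae ?_
      filter_upwards [hxu] with l hl
      rw [Pi.sub_apply, hl]
    refine ⟨⟨c, fun n z hz => (Finsupp.mem_supported ℂ _).1 (hc n) hz, hw⟩, J x,
      ⟨(Lp.aestronglyMeasurable _).aemeasurable, c, hw, ?_⟩, ae_eq_refl _⟩
    refine ((Lp.tendsto_Lp_iff_tendsto_eLpNorm' _ _).1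
      ((J.continuous.tendsto x).comp hlim)).congr fun n => ?_
    rw [← eLpNorm_neg]
    refine eLpNorm_congr_ae ?_
    filter_upwards [hJ (c n)] with ω hω
    rw [Pi.neg_apply, Pi.sub_apply, Function.comp_apply, hω, neg_sub]

/-- An element of `L₂(f)` is determined by its representative. -/
lemma ae_eq_act_rootT_iff (hmin : γ.Minimality f) {x : ℝ → EuclideanSpace ℂ (Fin T)}
    (u : ℝ → Fin T → ℂ) :
    x =ᵐ[freq] act (rootT f) u ↔ u =ᵐ[freq] fun l => (rootT f l)⁻¹ *ᵥ (x l).ofLp := by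
  constructor
  · intro hx
    filter_upwards [hx, hmin.1] with l hl hpos
    rw [hl]
    simp only [act, Matrix.mulVec_mulVec, Matrix.nonsing_inv_mul _ (isUnit_det_rootT hpos),
      Matrix.one_mulVec]
  · intro hu
    filter_upwards [hu, hmin.1] with l hl hpos
    simp only [act, hl, Matrix.mulVec_mulVec, Matrix.mul_nonsing_inv _ (isUnit_det_rootT hpos),
      Matrix.one_mulVec]

lemma isSpectralCharacteristic_iff_ae_eq (hf : ∀ p q, Integrable (fun l => f l p q) freq)
    (hmin : γ.Minimality f) (h : DualPair (γ.incRoot f) (γ.dualRoot f))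
    {J : Spec T →ₗᵢ[ℂ] Lp ℂ 2 P} (hJ : γ.IsSpectralIsometry P ξ h.left J)
    (b : ℕ → Fin T → ℂ) {x : Spec T} (hx : x ∈ h.past) {u₀ : ℝ → Fin T → ℂ}
    (hu₀ : x =ᵐ[freq] act (rootT f) u₀) (u : ℝ → Fin T → ℂ) :
    γ.IsSpectralCharacteristic P ξ f b (γ.affineValue J b ξ x) u ↔ u =ᵐ[freq] u₀ := by
  rw [γ.isSpectralCharacteristic_iff h (γ.memL2_rootT hf hmin) (γ.ae_rootT hmin) hJ b hx,
    γ.ae_eq_act_rootT_iff hmin]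
  rw [γ.ae_eq_act_rootT_iff hmin] at hu₀
  constructor
  · rintro ⟨-, hu⟩
    exact hu.trans hu₀.symm
  · intro hu
    have hu' := hu.trans hu₀
    refine ⟨AEMeasurable.congr ?_ hu'.symm, hu'⟩
    refine aemeasurable_pi_lambda _ fun p => ?_
    simp only [Matrix.mulVec, dotProduct]
    refine Finset.aemeasurable_fun_sum _ fun q _ => ?_
    refine (aemeasurable_matInv (aemeasurable_rootT hf) p q).mul ?_
    exact (((PiLp.continuous_ofLp 2 _).measurable.comp_aemeasurable
      (Lp.aestronglyMeasurable x).aemeasurable).eval q)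

/-- The representative of the function in the formula for the spectral characteristic. -/
lemma act_rootT_charFormula (hmin : γ.Minimality f) (b : ℕ → Fin T → ℂ)
    (C : ℝ → Fin T → ℂ) :
    act (rootT f) (γ.charFormula f b C) =ᵐ[freq]
      fun l => act (γ.incRoot f) (Bfun b) l - act (γ.dualRoot f) C l := by
  filter_upwards [hmin.1] with l hpos
  have h1 : rootT f l * ((f l)⁻¹)ᵀ = (rootT f l)⁻¹ := by
    have hd := isUnit_det_rootT hpos
    rw [Matrix.transpose_nonsing_inv, ← rootT_mul_self hpos.posSemidef, Matrix.mul_inv_rev,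
      ← Matrix.mul_assoc, Matrix.mul_nonsing_inv _ hd, Matrix.one_mul]
  simp only [act, charFormula, incRoot, dualRoot, Matrix.mulVec_sub, Matrix.mulVec_smul,
    Matrix.smul_mulVec, WithLp.toLp_sub]
  rw [← Matrix.mulVec_transpose, Matrix.mulVec_mulVec, h1]

end Params

/-! ### The optimal error -/

namespace DualPair

variable {T : ℕ} {G N : ℝ → Matrix (Fin T) (Fin T) ℂ} (h : DualPair G N)

/-- The component of the series with the coefficients `b` that is orthogonal to the past. -/
def error (b : ℕ → Fin T → ℂ) : Spec T :=
  seriesVec h.left b - h.past.starProjection (seriesVec h.left b)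

lemma error_mem_past_orthogonal (b : ℕ → Fin T → ℂ) : h.error b ∈ h.pastᗮ :=
  Submodule.sub_starProjection_mem_orthogonal _

lemma error_mem_future (b : ℕ → Fin T → ℂ) : h.error b ∈ h.future :=
  h.mem_future_of_mem_past_orthogonal (h.error_mem_past_orthogonal b)

/-- The coefficients of the error in the dual system are those of the whole series, since the
projection on the past does not contribute. -/
lemma inner_right_error {b : ℕ → Fin T → ℂ} (hb : Summable fun k => ‖b k‖) (j : ℕ) (q : Fin T) :
    inner ℂ (vec h.right j q) (h.error b) = b j q := by
  rw [error, inner_sub_right, h.inner_vec_right_seriesVec hb,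
    h.inner_right_eq_zero_of_mem_past (Submodule.starProjection_apply_mem _ _), sub_zero]
  simp [ext]

lemma inner_error_series (b : ℕ → Fin T → ℂ) :
    inner ℂ (h.error b) (seriesVec h.left b) = ((‖h.error b‖ ^ 2 : ℝ) : ℂ) := by
  have h1 : seriesVec h.left b = h.error b + h.past.starProjection (seriesVec h.left b) :=
    (sub_add_cancel _ _).symm
  rw [h1, inner_add_right, (Submodule.mem_orthogonal' _ _).1 (h.error_mem_past_orthogonal b) _
    (Submodule.starProjection_apply_mem _ _), add_zero, inner_self_eq_norm_sq_to_K]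
  push_cast
  rfl

/-- The mean square error is `⟨b, c⟩`, because the error is orthogonal to the projection. -/
lemma hasSum_error {b : ℕ → Fin T → ℂ} (hb : Summable fun k => ‖b k‖) :
    HasSum (fun k : ℕ => b k ⬝ᵥ star fun p => inner ℂ (vec h.left k p) (h.error b))
      ((‖h.error b‖ ^ 2 : ℝ) : ℂ) := by
  rw [← h.inner_error_series]
  refine ((hasSum_seriesVec h.left hb).mapL (innerSL ℂ (h.error b))).congr_fun ?_
  intro k
  rw [innerSL_apply_apply, inner_sum, dotProduct]
  refine Finset.sum_congr rfl fun p _ => ?_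
  rw [inner_smul_right, Pi.star_apply, ← inner_conj_symm (h.error b)]
  rfl

/-- The function `C = Gᴴ E`, whose Fourier coefficients are the solution of `F c = b`. -/
def errorFun (b : ℕ → Fin T → ℂ) (l : ℝ) : Fin T → ℂ := (G l)ᴴ *ᵥ (h.error b l).ofLp

lemma integrable_errorFun (b : ℕ → Fin T → ℂ) (p : Fin T) :
    Integrable (fun l => h.errorFun b l p) freq :=
  integrable_conjTranspose_mulVec h.left p _

lemma integral_errorFun (b : ℕ → Fin T → ℂ) (p : Fin T) (k : ℤ) :
    ∫ l, expi (-k) l * h.errorFun b l p ∂freq =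
      if 0 ≤ k then inner ℂ (vec h.left (k.toNat : ℤ) p) (h.error b) else 0 := by
  have h1 := (inner_vec h.left k p (h.error b)).symm
  refine h1.trans ?_
  split_ifs with hk
  · rw [Int.toNat_of_nonneg hk]
  · exact h.inner_left_eq_zero_of_mem_future (h.error_mem_future b) (by omega) p

lemma error_ae_eq (b : ℕ → Fin T → ℂ) : h.error b =ᵐ[freq] act N (h.errorFun b) := by
  filter_upwards [h.ae_mul_conjTranspose] with l hl
  simp only [act, errorFun, Matrix.mulVec_mulVec, hl, Matrix.one_mulVec]

lemma ae_eq_errorFun {b : ℕ → Fin T → ℂ} {C : ℝ → Fin T → ℂ}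
    (hC : h.error b =ᵐ[freq] act N C) : C =ᵐ[freq] h.errorFun b := by
  filter_upwards [hC, h.dual] with l h1 h2
  rw [errorFun, h1]
  simp only [act, Matrix.mulVec_mulVec, h2, Matrix.one_mulVec]

/-- The density of the mean square error, with `W` the weight of the energy norm. -/
lemma weighted_errorFun (b : ℕ → Fin T → ℂ) {W : ℝ → Matrix (Fin T) (Fin T) ℂ}
    (hW : ∀ᵐ l ∂freq, (N l)ᴴ * N l = (W l)ᵀ) :
    (fun l => h.errorFun b l ᵥ* W l ⬝ᵥ star (h.errorFun b l)) =ᵐ[freq]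
      fun l => inner ℂ (h.error b l) (h.error b l) := by
  filter_upwards [h.error_ae_eq b, hW] with l h1 h2
  rw [h1, EuclideanSpace.inner_eq_star_dotProduct]
  simp only [act]
  rw [Matrix.star_mulVec, dotProduct_comm (N l *ᵥ _),
    ← Matrix.dotProduct_mulVec (star _), Matrix.mulVec_mulVec, h2,
    Matrix.mulVec_transpose, dotProduct_comm]

lemma integrable_weighted_errorFun (b : ℕ → Fin T → ℂ) {W : ℝ → Matrix (Fin T) (Fin T) ℂ}
    (hW : ∀ᵐ l ∂freq, (N l)ᴴ * N l = (W l)ᵀ) :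
    Integrable (fun l => h.errorFun b l ᵥ* W l ⬝ᵥ star (h.errorFun b l)) freq :=
  (L2.integrable_inner _ _).congr (h.weighted_errorFun b hW).symm

lemma integral_weighted_errorFun (b : ℕ → Fin T → ℂ) {W : ℝ → Matrix (Fin T) (Fin T) ℂ}
    (hW : ∀ᵐ l ∂freq, (N l)ᴴ * N l = (W l)ᵀ) :
    ((‖h.error b‖ ^ 2 : ℝ) : ℂ) =
      ∫ l, h.errorFun b l ᵥ* W l ⬝ᵥ star (h.errorFun b l) ∂freq := by
  rw [integral_congr_ae (h.weighted_errorFun b hW), ← L2.inner_def, inner_self_eq_norm_sq_to_K]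
  push_cast
  rfl

end DualPair

/-! ### Fourier series in `L₂` -/

/-- The class of `e^{ikλ}` in `L₂`. -/
def expL (k : ℤ) : Lp ℂ 2 freq := (memLp_expi k 2).toLp _

lemma coeFn_expL (k : ℤ) : expL k =ᵐ[freq] expi k := MemLp.coeFn_toLp _

lemma inner_expL (k : ℤ) (U : Lp ℂ 2 freq) :
    inner ℂ (expL k) U = ∫ l, expi (-k) l * U l ∂freq := by
  rw [L2.inner_def]
  refine integral_congr_ae ?_
  filter_upwards [coeFn_expL k] with l hl
  rw [hl, ← star_expi, mul_comm]
  rfl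

lemma inner_expL_expL (j k : ℤ) : inner ℂ (expL j) (expL k) = if j = k then 1 else 0 := by
  have h1 : ∫ l, expi (-j) l * expL k l ∂freq = ∫ l, expi (k - j) l ∂freq := by
    refine integral_congr_ae ?_
    filter_upwards [coeFn_expL k] with l hl
    rw [hl, ← expi_add, neg_add_eq_sub]
  rw [inner_expL, h1, integral_expi]
  simp only [sub_eq_zero, eq_comm]

lemma orthonormal_expL : Orthonormal ℂ expL :=
  orthonormal_iff_ite.2 inner_expL_expL

/-- The exponentials are total in `L₂`, by uniqueness of Fourier coefficients. -/
lemma span_expL_orthogonal : (Submodule.span ℂ (Set.range expL))ᗮ = ⊥ := by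
  rw [Submodule.eq_bot_iff]
  intro U hU
  rw [Lp.eq_zero_iff_ae_eq_zero]
  refine ae_eq_zero_of_integral_expi_eq_zero ((Lp.memLp U).integrable (by norm_num)) fun k => ?_
  have := (Submodule.mem_orthogonal _ _).1 hU _ (Submodule.subset_span ⟨-k, rfl⟩)
  rwa [inner_expL, neg_neg] at this

/-- The trigonometric basis. -/
def expBasis : HilbertBasis ℤ ℂ (Lp ℂ 2 freq) :=
  HilbertBasis.mkOfOrthogonalEqBot orthonormal_expL span_expL_orthogonal

lemma expBasis_apply (k : ℤ) : expBasis k = expL k :=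
  congrFun (HilbertBasis.coe_mkOfOrthogonalEqBot _ _) k

lemma coeFn_sum_smul_expL (u : ℕ → ℂ) (σ : ℤ) (n : ℕ) :
    ((∑ k ∈ Finset.range n, u k • expL (σ * (k : ℤ)) : Lp ℂ 2 freq) : ℝ → ℂ) =ᵐ[freq]
      fun l => ∑ k ∈ Finset.range n, u k * expi (σ * (k : ℤ)) l := by
  refine (Lp.coeFn_finsetSum _ _).trans ?_
  have h1 : ∀ᵐ l ∂freq, ∀ k ∈ Finset.range n, (u k • expL (σ * (k : ℤ)) : Lp ℂ 2 freq) l =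
      u k * expi (σ * (k : ℤ)) l := (eventually_all_finset _).2 fun k _ => by
    filter_upwards [Lp.coeFn_smul (u k) (expL (σ * (k : ℤ))), coeFn_expL (σ * (k : ℤ))]
      with l h1 h2
    rw [h1, Pi.smul_apply, h2, smul_eq_mul]
  filter_upwards [h1] with l hl
  rw [Finset.sum_apply]
  exact Finset.sum_congr rfl hl

lemma IsL2Series.integral_eq {u : ℕ → ℂ} {U : ℝ → ℂ} (h : IsL2Series (-1) u U) (m : ℤ) :
    ∫ l, expi m l * U l ∂freq = if 0 ≤ m then u m.toNat else 0 := by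
  obtain ⟨y, hyU, hy⟩ := exists_Lp_of_tendsto_eLpNorm
    (fun n => (∑ k ∈ Finset.range n, u k • expL (-1 * (k : ℤ)) : Lp ℂ 2 freq))
    h.1.aestronglyMeasurable (by
      refine h.2.congr fun n => ?_
      rw [← eLpNorm_neg]
      refine eLpNorm_congr_ae ?_
      filter_upwards [coeFn_sum_smul_expL u (-1) n] with l hl
      rw [Pi.neg_apply, hl, neg_sub])
  have h1 : ∫ l, expi m l * U l ∂freq = inner ℂ (expL (-m)) y := by
    rw [inner_expL, neg_neg]
    exact integral_congr_ae (by filter_upwards [hyU] with l hl; rw [hl])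
  rw [h1]
  refine tendsto_nhds_unique (((innerSL ℂ (expL (-m))).continuous.tendsto y).comp hy)
    (tendsto_const_nhds.congr' ?_)
  filter_upwards [eventually_gt_atTop m.toNat] with n hn
  rw [Function.comp_apply, innerSL_apply_apply, inner_sum]
  simp only [inner_smul_right, inner_expL_expL]
  split_ifs with hm
  · rw [Finset.sum_eq_single m.toNat]
    · rw [if_pos (by omega), mul_one]
    · intro k _ hk; rw [if_neg (by omega), mul_zero]
    · intro h0; exact absurd (Finset.mem_range.2 hn) h0
  · refine (Finset.sum_eq_zero fun k _ => ?_).symm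
    rw [if_neg (by omega), mul_zero]

/-- A square integrable function without negative frequencies is the sum of its Fourier series, and
Parseval's identity holds. -/
lemma isL2Series_of_integral_eq {u : ℕ → ℂ} {U : ℝ → ℂ} (hU : MemLp U 2 freq)
    (h : ∀ k : ℤ, ∫ l, expi (-k) l * U l ∂freq = if 0 ≤ k then u k.toNat else 0) :
    IsL2Series 1 u U ∧ HasSum (fun k => ‖u k‖ ^ 2) (∫ l, ‖U l‖ ^ 2 ∂freq) := by
  set y := hU.toLp U with hy
  have hyU : y =ᵐ[freq] U := hU.coeFn_toLp
  have hcoef : ∀ k : ℤ, inner ℂ (expL k) y = if 0 ≤ k then u k.toNat else 0 := fun k => by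
    rw [← h, inner_expL]
    exact integral_congr_ae (by filter_upwards [hyU] with l hl; rw [hl])
  have hout : ∀ k : ℤ, k ∉ Set.range ((↑) : ℕ → ℤ) → inner ℂ (expL k) y = 0 := fun k hk => by
    rw [hcoef, if_neg]
    exact fun h0 => hk ⟨k.toNat, Int.toNat_of_nonneg h0⟩
  constructor
  · refine ⟨hU, ?_⟩
    have h1 := expBasis.hasSum_repr y
    simp only [HilbertBasis.repr_apply_apply, expBasis_apply] at h1
    rw [← (Nat.cast_injective (R := ℤ)).hasSum_iff fun k hk => by rw [hout k hk, zero_smul]] at h1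
    have h2 := (Lp.tendsto_Lp_iff_tendsto_eLpNorm' _ _).1 h1.tendsto_sum_nat
    refine h2.congr fun n => ?_
    rw [← eLpNorm_neg]
    refine eLpNorm_congr_ae ?_
    have h3 : (∑ k ∈ Finset.range n, ((fun k : ℤ => inner ℂ (expL k) y • expL k) ∘ Nat.cast) k :
        Lp ℂ 2 freq) = ∑ k ∈ Finset.range n, u k • expL (1 * (k : ℤ)) :=
      Finset.sum_congr rfl fun k _ => by simp [hcoef]
    rw [h3]
    filter_upwards [coeFn_sum_smul_expL u 1 n, hyU] with l h4 h5
    rw [Pi.neg_apply, Pi.sub_apply, h4, h5, neg_sub]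
  · have h1 := expBasis.hasSum_inner_mul_inner y y
    simp only [expBasis_apply] at h1
    rw [← (Nat.cast_injective (R := ℤ)).hasSum_iff fun k hk => by rw [hout k hk, mul_zero]] at h1
    have h2 : inner ℂ y y = ((∫ l, ‖U l‖ ^ 2 ∂freq : ℝ) : ℂ) := by
      rw [L2.inner_def, ← integral_complex_ofReal]
      refine integral_congr_ae ?_
      filter_upwards [hyU] with l hl
      rw [hl, inner_self_eq_norm_sq_to_K]
      push_cast
      rfl
    rw [h2] at h1
    refine Complex.hasSum_ofReal.1 (h1.congr_fun fun k => ?_)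
    rw [Function.comp_apply, ← inner_conj_symm y, hcoef, if_pos (by positivity),
      Complex.conj_mul', Int.toNat_natCast]
    push_cast
    rfl

/-! ### The canonical factorization -/

namespace DualPair

variable {T q : ℕ} {G N : ℝ → Matrix (Fin T) (Fin T) ℂ} (h : DualPair G N)
  {Φ : ℝ → Matrix (Fin T) (Fin q) ℂ}

/-- The matrix function `N (Φᵀ)ᴴ`, whose columns represent the innovations. -/
def _root_.GM.innov (N : ℝ → Matrix (Fin T) (Fin T) ℂ) (Φ : ℝ → Matrix (Fin T) (Fin q) ℂ) (l : ℝ) :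
    Matrix (Fin T) (Fin q) ℂ := N l * ((Φ l)ᵀ)ᴴ

include h in
lemma innov_conjTranspose_mul :
    ∀ᵐ l ∂freq, (innov N Φ l)ᴴ * G l = (Φ l)ᵀ := by
  filter_upwards [h.dual_symm] with l hl
  rw [innov, Matrix.conjTranspose_mul, Matrix.conjTranspose_conjTranspose, Matrix.mul_assoc, hl,
    Matrix.mul_one]

include h in
/-- The matrices `innov` are coisometric, so the passage to innovation coordinates preserves norms. -/
lemma innov_mul_conjTranspose (hΦ : ∀ᵐ l ∂freq, (G l)ᴴ * G l = (Φ l * (Φ l)ᴴ)ᵀ) :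
    ∀ᵐ l ∂freq, innov N Φ l * (innov N Φ l)ᴴ = 1 := by
  filter_upwards [h.ae_mul_conjTranspose, hΦ] with l h1 h2
  have h3 : ((Φ l)ᵀ)ᴴ * (Φ l)ᵀ = (G l)ᴴ * G l := by
    rw [h2, Matrix.transpose_mul]
    rfl
  have h4 : G l * (N l)ᴴ = 1 := by
    have := congrArg Matrix.conjTranspose h1
    simpa using this
  rw [innov, Matrix.conjTranspose_mul, Matrix.conjTranspose_conjTranspose, Matrix.mul_assoc,
    ← Matrix.mul_assoc _ _ ((N l)ᴴ), h3, Matrix.mul_assoc, h4, Matrix.mul_one, h1]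

include h in
lemma aemeasurable_innov (hΦm : ∀ p j, AEMeasurable (fun l => Φ l p j) freq) (p : Fin T)
    (j : Fin q) : AEMeasurable (fun l => innov N Φ l p j) freq := by
  simp only [innov, Matrix.mul_apply, Matrix.conjTranspose_apply, Matrix.transpose_apply]
  exact Finset.aemeasurable_fun_sum _ fun i _ =>
    (h.right p i).aestronglyMeasurable.aemeasurable.mul
      (Complex.continuous_conj.measurable.comp_aemeasurable (hΦm i j))

lemma _root_.GM.norm_apply_le_one_of_mul_conjTranspose {A : Matrix (Fin T) (Fin q) ℂ}
    (hA : A * Aᴴ = 1) (p : Fin T) (j : Fin q) : ‖A p j‖ ≤ 1 := by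
  have h1 := congrFun (congrFun hA p) p
  rw [Matrix.mul_apply, Matrix.one_apply_eq] at h1
  have h2 : ∑ i, ‖A p i‖ ^ 2 = (1 : ℝ) := by
    rw [← Complex.ofReal_inj]
    push_cast
    rw [← h1]
    refine Finset.sum_congr rfl fun i _ => ?_
    rw [Matrix.conjTranspose_apply, Complex.star_def, Complex.mul_conj']
  have h3 : ‖A p j‖ ^ 2 ≤ 1 := h2 ▸ Finset.single_le_sum (f := fun i => ‖A p i‖ ^ 2)
    (fun _ _ => by positivity) (Finset.mem_univ j)
  nlinarith [norm_nonneg (A p j)]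

include h in
lemma memL2_innov (hΦm : ∀ p j, AEMeasurable (fun l => Φ l p j) freq)
    (hΦ : ∀ᵐ l ∂freq, (G l)ᴴ * G l = (Φ l * (Φ l)ᴴ)ᵀ) : MemL2 (innov N Φ) := fun p j => by
  refine MemLp.of_bound (h.aemeasurable_innov hΦm p j).aestronglyMeasurable 1 ?_
  filter_upwards [h.innov_mul_conjTranspose hΦ] with l hl
  exact norm_apply_le_one_of_mul_conjTranspose hl p j

include h in
/-- The moving average coefficients are the coordinates of the increments in the innovations. -/
lemma inner_innov_left (hW : MemL2 (innov N Φ)) {φ : ℕ → Matrix (Fin T) (Fin q) ℂ}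
    (hφ : ∀ p j, IsL2Series (-1) (fun k => φ k p j) fun l => Φ l p j) (u m : ℤ) (j : Fin q)
    (p : Fin T) : inner ℂ (vec hW u j) (vec h.left m p) =
      if u ≤ m then φ (m - u).toNat p j else 0 := by
  rw [inner_vec_vec]
  have h1 : ∫ l, expi (m - u) l * ((innov N Φ l)ᴴ * G l) j p ∂freq =
      ∫ l, expi (m - u) l * Φ l p j ∂freq := by
    refine integral_congr_ae ?_
    filter_upwards [h.innov_conjTranspose_mul (Φ := Φ)] with l hl
    rw [hl, Matrix.transpose_apply]
  rw [h1, (hφ p j).integral_eq (m - u)]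
  simp only [sub_nonneg]

/-- The coordinates of `E` in the innovations, as a function of the frequency. -/
def _root_.GM.innovFun (N : ℝ → Matrix (Fin T) (Fin T) ℂ) (Φ : ℝ → Matrix (Fin T) (Fin q) ℂ)
    (E : Spec T) (l : ℝ) : Fin q → ℂ := (innov N Φ l)ᴴ *ᵥ (E l).ofLp

include h in
lemma memLp_innovFun (hΦm : ∀ p j, AEMeasurable (fun l => Φ l p j) freq)
    (hΦ : ∀ᵐ l ∂freq, (G l)ᴴ * G l = (Φ l * (Φ l)ᴴ)ᵀ) (E : Spec T) (j : Fin q) :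
    MemLp (fun l => innovFun N Φ E l j) 2 freq := by
  simp only [innovFun, Matrix.mulVec, dotProduct, Matrix.conjTranspose_apply]
  refine memLp_finsetSum _ fun p _ => ?_
  refine MemLp.of_le (g := fun l => E l) (Lp.memLp E) ?_ ?_
  · refine AEStronglyMeasurable.mul ?_ ?_
    · exact (Complex.continuous_conj.measurable.comp_aemeasurable
        (h.aemeasurable_innov hΦm p j)).aestronglyMeasurable
    · exact (((PiLp.continuous_ofLp 2 _).measurable.comp_aemeasurable
        (Lp.aestronglyMeasurable E).aemeasurable).eval p).aestronglyMeasurable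
  · filter_upwards [h.innov_mul_conjTranspose hΦ] with l hl
    rw [norm_mul, norm_star]
    exact (mul_le_of_le_one_left (norm_nonneg _)
      (norm_apply_le_one_of_mul_conjTranspose hl p j)).trans (PiLp.norm_apply_le (E l) p)

include h in
lemma sum_norm_sq_innovFun (hΦ : ∀ᵐ l ∂freq, (G l)ᴴ * G l = (Φ l * (Φ l)ᴴ)ᵀ) (E : Spec T) :
    ∀ᵐ l ∂freq, ∑ j, ‖innovFun N Φ E l j‖ ^ 2 = ‖E l‖ ^ 2 := by
  filter_upwards [h.innov_mul_conjTranspose hΦ] with l hl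
  have h1 : star (innovFun N Φ E l) ⬝ᵥ innovFun N Φ E l = star (E l).ofLp ⬝ᵥ (E l).ofLp := by
    rw [innovFun, Matrix.star_mulVec, Matrix.conjTranspose_conjTranspose,
      ← Matrix.dotProduct_mulVec, Matrix.mulVec_mulVec, hl, Matrix.one_mulVec]
  rw [EuclideanSpace.norm_sq_eq, ← Complex.ofReal_inj]
  simp only [dotProduct, Pi.star_apply, Complex.star_def, Complex.conj_mul'] at h1
  push_cast
  exact h1

/-- If the innovations of negative index belong to the past, the Fourier coefficients of the
error in the innovation coordinates are the coefficients of the series in these coordinates, at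
nonnegative indices, and vanish at negative ones. -/
lemma integral_innovFun_error (hW : MemL2 (innov N Φ)) {φ : ℕ → Matrix (Fin T) (Fin q) ℂ}
    (hφ : ∀ p j, IsL2Series (-1) (fun k => φ k p j) fun l => Φ l p j)
    (hpast : ∀ u : ℤ, u ≤ -1 → ∀ j, vec hW u j ∈ h.past)
    {b : ℕ → Fin T → ℂ} (hb : Summable fun k => ‖b k‖) (k : ℤ) (j : Fin q) :
    ∫ l, expi (-k) l * innovFun N Φ (h.error b) l j ∂freq =
      if 0 ≤ k then (∑' m, (φ m)ᵀ *ᵥ b (m + k.toNat)) j else 0 := by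
  have h0 := (inner_vec hW k j (h.error b)).symm
  refine h0.trans ?_
  split_ifs with hk
  · lift k to ℕ using hk
    have h1 : inner ℂ (vec hW k j) (h.past.starProjection (seriesVec h.left b)) = 0 := by
      refine h.inner_past_eq_zero (fun m hm p => ?_) (Submodule.starProjection_apply_mem _ _)
      rw [h.inner_innov_left hW hφ, if_neg (by omega)]
    rw [error, inner_sub_right, h1, sub_zero, Int.toNat_natCast]
    have h2 : ∀ j, HasSum (fun m => ((φ m)ᵀ *ᵥ b (m + k)) j)
        (inner ℂ (vec hW k j) (seriesVec h.left b)) := fun j => by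
      have h3 := (hasSum_seriesVec h.left hb).mapL (innerSL ℂ (vec hW k j))
      rw [← hasSum_nat_add_iff' k, Finset.sum_eq_zero, sub_zero] at h3
      · refine h3.congr_fun fun m => ?_
        rw [innerSL_apply_apply, inner_sum, Matrix.mulVec, dotProduct]
        refine Finset.sum_congr rfl fun p _ => ?_
        rw [inner_smul_right, h.inner_innov_left hW hφ, if_pos (by omega), mul_comm]
        have h4 : (((m + k : ℕ) : ℤ) - k).toNat = m := by omega
        rw [h4, Matrix.transpose_apply]
      · intro m hm
        rw [Finset.mem_range] at hm
        rw [innerSL_apply_apply, inner_sum]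
        refine Finset.sum_eq_zero fun p _ => ?_
        rw [inner_smul_right, h.inner_innov_left hW hφ, if_neg (by omega), mul_zero]
    rw [(Pi.hasSum.2 h2).tsum_eq]
  · exact (Submodule.mem_orthogonal _ _).1 (h.error_mem_past_orthogonal b) _
      (hpast k (by omega) j)

end DualPair

namespace Params

variable {r : ℕ} (γ : Params r) {T q : ℕ} {f : ℝ → Matrix (Fin T) (Fin T) ℂ}
  {Ω : Type*} [MeasurableSpace Ω] {P : Measure Ω} {ξ : Fin T → ℤ → Ω → ℂ}
  {ε : Fin q → ℤ → Ω → ℂ} {φ φμ : ℕ → Matrix (Fin T) (Fin q) ℂ}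
  {Φ Φμ : ℝ → Matrix (Fin T) (Fin q) ℂ}

/-- The coefficients `r_k` are given by `b = D a`. -/
lemma DA_eq (a : ℕ → Fin T → ℂ) (k : ℕ) :
    γ.DA a φμ k = ∑' m, (φμ m)ᵀ *ᵥ γ.D a (m + k) := by
  simp only [DA, D, add_assoc]

/-- The innovations of negative index are represented by elements of the past. -/
lemma innov_mem_past (cf : γ.CanonicalFactorization P ξ f ε φ φμ Φ Φμ)
    (h : DualPair (γ.incRoot f) (γ.dualRoot f)) {J : Spec T →ₗᵢ[ℂ] Lp ℂ 2 P}
    (hJ : γ.IsSpectralIsometry P ξ h.left J) (hW : MemL2 (innov (γ.dualRoot f) Φμ))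
    {u : ℤ} (hu : u ≤ -1) (j : Fin q) : vec hW u j ∈ h.past := by
  let εL : Fin q → ℤ → Lp ℂ 2 P := fun i v => (cf.memLp i v).toLp _
  have hεL : ∀ i v, εL i v =ᵐ[P] ε i v := fun i v => MemLp.coeFn_toLp _
  have hinner : ∀ i v, inner ℂ (εL j u) (εL i v) = if i = j ∧ v = u then 1 else 0 := fun i v => by
    rw [← cf.orthonormal i j v u, L2.inner_def]
    refine integral_congr_ae ?_
    filter_upwards [hεL i v, hεL j u] with ω h1 h2
    rw [h1, h2]
    rfl
  have hJvec : ∀ m p, J (vec h.left m p) =ᵐ[P] γ.inc ξ p m := fun m p => by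
    have h1 := hJ (Finsupp.single (m, p) 1)
    have h2 : vecComb h.left (Finsupp.single (m, p) 1) = vec h.left m p := by simp [vecComb]
    rw [h2] at h1
    filter_upwards [h1] with ω hω
    rw [hω, incComb, Finsupp.sum_single_index (zero_mul _), one_mul]
  -- the innovation is a mean square limit of combinations of past increments
  have hmem : ε j u ∈ closedSpan P {X | ∃ p, ∃ k ≤ (-1 : ℤ), X = γ.inc ξ p k} := by
    rw [cf.same_past]
    exact ⟨cf.memLp j u, fun δ hδ => ⟨ε j u, Submodule.subset_span ⟨j, u, hu, rfl⟩, by simpa⟩⟩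
  have hspan : ∀ Y ∈ Submodule.span ℂ {X | ∃ p, ∃ k ≤ (-1 : ℤ), X = γ.inc ξ p k},
      ∃ x ∈ h.past, J x =ᵐ[P] Y := fun Y hY => by
    induction hY using Submodule.span_induction with
    | mem Y hY =>
      obtain ⟨p, k, hk, rfl⟩ := hY
      exact ⟨_, h.vec_mem_past hk p, hJvec k p⟩
    | zero => exact ⟨0, Submodule.zero_mem _, by rw [map_zero]; exact Lp.coeFn_zero _ _ _⟩
    | add Y Y' _ _ hY hY' =>
      obtain ⟨x, hx, hxY⟩ := hY
      obtain ⟨x', hx', hxY'⟩ := hY'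
      refine ⟨x + x', Submodule.add_mem _ hx hx', ?_⟩
      rw [map_add]
      exact (Lp.coeFn_add _ _).trans (hxY.add hxY')
    | smul c Y _ hY =>
      obtain ⟨x, hx, hxY⟩ := hY
      refine ⟨c • x, Submodule.smul_mem _ c hx, ?_⟩
      rw [map_smul]
      exact (Lp.coeFn_smul _ _).trans (hxY.const_smul c)
  have hex : ∀ n : ℕ, ∃ x ∈ h.past, eLpNorm (fun ω => J x ω - ε j u ω) 2 P < ((n : ℝ≥0∞) + 1)⁻¹ :=
    fun n => by
      obtain ⟨Y, hY, hlt⟩ := hmem.2 ((n : ℝ≥0∞) + 1)⁻¹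
        (ENNReal.inv_pos.2 (ENNReal.add_ne_top.2 ⟨ENNReal.natCast_ne_top n, ENNReal.one_ne_top⟩))
      obtain ⟨x, hx, hxY⟩ := hspan Y hY
      refine ⟨x, hx, lt_of_eq_of_lt ?_ hlt⟩
      rw [← eLpNorm_neg]
      refine eLpNorm_congr_ae ?_
      filter_upwards [hxY] with ω hω
      rw [Pi.neg_apply, hω, neg_sub]
  choose x hx hxlt using hex
  have hlim0 : Tendsto (fun n => eLpNorm (fun ω => J (x n) ω - ε j u ω) 2 P) atTop (𝓝 0) := by
    refine tendsto_of_tendsto_of_tendsto_of_le_of_le tendsto_const_nhds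
      (ENNReal.tendsto_inv_nat_nhds_zero.comp (tendsto_add_atTop_nat 1)) (fun _ => zero_le)
      fun n => ?_
    simpa using (hxlt n).le
  obtain ⟨y, hyε, hy⟩ := exists_Lp_of_tendsto_eLpNorm (fun n => J (x n))
    (cf.memLp j u).aestronglyMeasurable hlim0
  obtain ⟨z, hz, hJz⟩ := exists_tendsto_of_tendsto_map J hy
  have hzp : z ∈ h.past := (Submodule.isClosed_topologicalClosure _).mem_of_tendsto hz
    (Eventually.of_forall hx)
  have hJzε : J z = εL j u := Lp.ext (by
    rw [hJz]; exact hyε.trans (hεL j u).symm)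
  -- this limit has the same inner products with the increments as the column of `innov`
  have hcoef : ∀ m p, inner ℂ z (vec h.left m p) =
      if u ≤ m then φμ (m - u).toNat p j else 0 := fun m p => by
    rw [← J.inner_map_map, hJzε]
    obtain ⟨y', hy'1, hy'2⟩ := exists_Lp_of_tendsto_eLpNorm
      (fun n => (∑ k ∈ Finset.range n, ∑ i, φμ k p i • εL i (m - (k : ℤ)) : Lp ℂ 2 P))
      (Lp.aestronglyMeasurable (J (vec h.left m p))) (by
        refine (cf.moving_average p m).congr fun n => ?_
        rw [← eLpNorm_neg]
        refine eLpNorm_congr_ae ?_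
        have h1 : ((∑ k ∈ Finset.range n, ∑ i, φμ k p i • εL i (m - (k : ℤ)) : Lp ℂ 2 P) :
            Ω → ℂ) =ᵐ[P] fun ω => ∑ k ∈ Finset.range n, ∑ i, φμ k p i * ε i (m - (k : ℤ)) ω := by
          rw [← Finset.sum_product']
          refine (Lp.coeFn_finsetSum _ _).trans ?_
          have h2 : ∀ᵐ ω ∂P, ∀ x ∈ Finset.range n ×ˢ (Finset.univ : Finset (Fin q)),
              (φμ x.1 p x.2 • εL x.2 (m - (x.1 : ℤ)) : Lp ℂ 2 P) ω =
                φμ x.1 p x.2 * ε x.2 (m - (x.1 : ℤ)) ω :=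
            (eventually_all_finset _).2 fun x _ => by
              filter_upwards [Lp.coeFn_smul (φμ x.1 p x.2) (εL x.2 (m - (x.1 : ℤ))),
                hεL x.2 (m - (x.1 : ℤ))] with ω h1 h2
              rw [h1, Pi.smul_apply, h2, smul_eq_mul]
          filter_upwards [h2] with ω hω
          rw [Finset.sum_apply, Finset.sum_congr rfl hω, Finset.sum_product]
        filter_upwards [h1, hJvec m p] with ω h2 h3
        rw [Pi.neg_apply, h2, h3, neg_sub])
    have hy'J : y' = J (vec h.left m p) := Lp.ext hy'1
    rw [← hy'J]
    refine tendsto_nhds_unique (((innerSL ℂ (εL j u)).continuous.tendsto y').comp hy'2)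
      (tendsto_const_nhds.congr' ?_)
    filter_upwards [eventually_gt_atTop (m - u).toNat] with n hn
    rw [Function.comp_apply, innerSL_apply_apply, inner_sum]
    have h1 : ∀ k ∈ Finset.range n, inner ℂ (εL j u) (∑ i, φμ k p i • εL i (m - (k : ℤ))) =
        if (k : ℤ) = m - u then φμ k p j else 0 := fun k _ => by
      rw [inner_sum]
      simp only [inner_smul_right, hinner]
      rw [Finset.sum_eq_single j]
      · have : m - (k : ℤ) = u ↔ (k : ℤ) = m - u := by omega
        simp only [true_and, this]
        split_ifs <;> simp
      · intro i _ hi; rw [if_neg fun h => hi h.1, mul_zero]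
      · intro h0; exact absurd (Finset.mem_univ j) h0
    rw [Finset.sum_congr rfl h1]
    split_ifs with hum
    · rw [Finset.sum_eq_single (m - u).toNat]
      · rw [if_pos (by omega)]
      · intro k _ hk; rw [if_neg (by omega)]
      · intro h0; exact absurd (Finset.mem_range.2 hn) h0
    · exact (Finset.sum_eq_zero fun k _ => if_neg (by omega)).symm
  have hzw : z = vec hW u j := by
    rw [← sub_eq_zero]
    refine h.eq_zero_of_inner_vec_eq_zero fun m p => ?_
    rw [← inner_conj_symm, inner_sub_left, hcoef, h.inner_innov_left hW cf.seriesμ, sub_self,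
      map_zero]
  exact hzw ▸ hzp

/-- The representative of the second formula for the spectral characteristic. -/
lemma act_rootT_charFormula' {N : ℝ → Matrix (Fin T) (Fin T) ℂ} (h : DualPair (γ.incRoot f) N)
    (hΦ : ∀ᵐ l ∂freq, (γ.incRoot f l)ᴴ * γ.incRoot f l = (Φμ l * (Φμ l)ᴴ)ᵀ)
    {Ψ : ℝ → Matrix (Fin q) (Fin T) ℂ} (hΨ : ∀ᵐ l ∂freq, Ψ l * Φμ l = 1) (b : ℕ → Fin T → ℂ)
    (E : Spec T) :
    act (rootT f) (γ.charFormula' b Ψ (innovFun N Φμ E)) =ᵐ[freq]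
      fun l => act (γ.incRoot f) (Bfun b) l - E l := by
  filter_upwards [h.dual_symm, h.ae_mul_conjTranspose, hΦ, hΨ] with l h0 h1 h2 h3
  -- `Φμ` is right invertible because the density is invertible, so `Ψ` is a two-sided inverse
  have h4 : γ.incRoot f l * (N l)ᴴ = 1 := by
    have := congrArg Matrix.conjTranspose h1
    simpa using this
  have h5 : Φμ l * ((Φμ l)ᴴ * ((N l)ᴴ * N l)ᵀ) = 1 := by
    rw [← Matrix.mul_assoc, ← Matrix.transpose_transpose (Φμ l * (Φμ l)ᴴ), ← h2,
      ← Matrix.transpose_mul, Matrix.mul_assoc, ← Matrix.mul_assoc (N l), h1, Matrix.one_mul, h0,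
      Matrix.transpose_one]
  have h6 : Φμ l * Ψ l = 1 := by
    calc Φμ l * Ψ l = Φμ l * Ψ l * (Φμ l * ((Φμ l)ᴴ * ((N l)ᴴ * N l)ᵀ)) := by
          rw [h5, Matrix.mul_one]
      _ = Φμ l * (Ψ l * Φμ l) * ((Φμ l)ᴴ * ((N l)ᴴ * N l)ᵀ) := by
          simp only [Matrix.mul_assoc]
      _ = 1 := by rw [h3, Matrix.mul_one, h5]
  have h7 : γ.incRoot f l * ((Ψ l)ᵀ * (innov N Φμ l)ᴴ) = 1 := by
    rw [innov, Matrix.conjTranspose_mul, Matrix.conjTranspose_conjTranspose,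
      ← Matrix.mul_assoc (Ψ l)ᵀ, ← Matrix.transpose_mul, h6, Matrix.transpose_one,
      Matrix.one_mul, h4]
  have h8 : act (rootT f) (γ.charFormula' b Ψ (innovFun N Φμ E)) l =
      act (γ.incRoot f) (fun l => Bfun b l - (Ψ l)ᵀ *ᵥ innovFun N Φμ E l) l := by
    simp only [act, charFormula', incRoot, Matrix.mulVec_smul, Matrix.smul_mulVec]
  rw [h8, act_sub]
  congr 1
  simp only [act, innovFun, Matrix.mulVec_mulVec]
  rw [h7, Matrix.one_mulVec]

end Params

end GM

end

theorem mainTheorem4 {Ω : Type*} [MeasurableSpace Ω] (P : Measure Ω) [IsProbabilityMeasure P]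
    (T : ℕ) (hT : 0 < T) {r : ℕ} (γ : GM.Params r)
    (ζ : ℤ → Ω → ℂ) (hζ : ∀ k, AEMeasurable (ζ k) P)
    (hstat : GM.PeriodicallyStationary P T γ.s γ.d ζ)
    (f : ℝ → Matrix (Fin T) (Fin T) ℂ)
    (hf : GM.IsSpectralDensity P γ.s γ.d (GM.blocked T ζ) f)
    (hmin : γ.Minimality f)
    (a : ℕ → ℂ) (ha : γ.CoefCond (GM.blockCoef T a)) :
    ∃ (Aζ Ahat : Ω → ℂ) (c : ℕ → Fin T → ℂ) (C : ℝ → Fin T → ℂ) (Δ : ℝ),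
      -- the functional is well defined, and is the sum of its series if that converges
      (∀ X, γ.IsFunctionalValue P T ζ a X ↔ X =ᵐ[P] Aζ) ∧
      (∀ X, (∀ k, MemLp (ζ k) 2 P) →
        Tendsto (fun N => eLpNorm
          (fun ω => X ω - ∑ k ∈ Finset.range N, a k * ζ (k : ℤ) ω) 2 P) atTop (𝓝 0) →
        AEMeasurable X P → X =ᵐ[P] Aζ) ∧
      -- the optimal estimate exists and is unique
      (∀ X, γ.IsOptimalEstimate P T ζ a Aζ X ↔ X =ᵐ[P] Ahat) ∧
      -- `c = F⁻¹ D a` exists and is unique, and `C` is the sum of its Fourier series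
      γ.IsFInverse f (γ.D (GM.blockCoef T a)) c C ∧
      (∀ c' C', γ.IsFInverse f (γ.D (GM.blockCoef T a)) c' C' → c' = c ∧ C' =ᵐ[GM.freq] C) ∧
      (∀ p, Integrable (fun l => C l p) GM.freq ∧ ∀ k : ℤ,
        ∫ l, GM.expi (-k) l * C l p ∂GM.freq = if 0 ≤ k then c k.toNat p else 0) ∧
      -- it is the solution in `ℓ²` if `F` is a bounded operator there and a solution exists
      (∀ Fop, γ.HasMatrixF f Fop → ∀ c' : lp (fun _ : ℕ => EuclideanSpace ℂ (Fin T)) 2,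
        (∀ j p, Fop c' j p = γ.D (GM.blockCoef T a) j p) → ∀ k p, c' k p = c k p) ∧
      -- spectral characteristic and mean square error
      (∀ h, γ.IsSpectralCharacteristic P (GM.blocked T ζ) f (γ.D (GM.blockCoef T a)) Ahat h ↔
        h =ᵐ[GM.freq] γ.charFormula f (γ.D (GM.blockCoef T a)) C) ∧
      0 ≤ Δ ∧ GM.mse P Aζ Ahat = ENNReal.ofReal Δ ∧
      Integrable (fun l => C l ᵥ* γ.invWeight f l ⬝ᵥ star (C l)) GM.freq ∧
      (Δ : ℂ) = ∫ l, C l ᵥ* γ.invWeight f l ⬝ᵥ star (C l) ∂GM.freq ∧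
      HasSum (fun k => γ.D (GM.blockCoef T a) k ⬝ᵥ star (c k)) (Δ : ℂ) ∧
      -- the case of a canonical factorization
      (∀ (q : ℕ) (ε : Fin q → ℤ → Ω → ℂ) (φ φμ : ℕ → Matrix (Fin T) (Fin q) ℂ)
        (Φ Φμ : ℝ → Matrix (Fin T) (Fin q) ℂ) (Ψ : ℝ → Matrix (Fin q) (Fin T) ℂ),
        γ.CanonicalFactorization P (GM.blocked T ζ) f ε φ φμ Φ Φμ →
        (∀ᵐ l ∂GM.freq, Ψ l * Φμ l = 1) →
        ∃ R : ℝ → Fin q → ℂ,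
          (∀ j, GM.IsL2Series 1 (fun k => γ.DA (GM.blockCoef T a) φμ k j) (fun l => R l j)) ∧
          (∀ h, γ.IsSpectralCharacteristic P (GM.blocked T ζ) f (γ.D (GM.blockCoef T a)) Ahat h ↔
            h =ᵐ[GM.freq] γ.charFormula' (γ.D (GM.blockCoef T a)) Ψ R) ∧
          Δ = ∫ l, ∑ j, ‖R l j‖ ^ 2 ∂GM.freq ∧
          HasSum (fun k => ∑ j, ‖γ.DA (GM.blockCoef T a) φμ k j‖ ^ 2) Δ) := by
  have : NeZero T := ⟨hT.ne'⟩
  have h := γ.dualPair hf.integrable hmin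
  obtain ⟨J, hJ⟩ := γ.exists_isSpectralIsometry hstat hf hmin
  have hN := γ.ae_dualRoot hmin
  set b := γ.D (GM.blockCoef T a) with hb
  have hbs : Summable fun k => ‖b k‖ := ha.summable_D
  set x₀ := h.past.starProjection (GM.seriesVec h.left b) with hx₀
  have hx₀p : x₀ ∈ h.past := Submodule.starProjection_apply_mem _ _
  have hCm : AEMeasurable (h.errorFun b) GM.freq := aemeasurable_pi_lambda _ fun p =>
    (h.integrable_errorFun b p).aestronglyMeasurable.aemeasurable
  have hopt := γ.isOptimalEstimate_iff h hJ hζ ha (GM.seriesVec h.left b)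
  -- the projection is the series less the error, and the error is `N C`
  have hchar : x₀ =ᵐ[GM.freq] GM.act (GM.Params.rootT f) (γ.charFormula f b (h.errorFun b)) := by
    filter_upwards [γ.act_rootT_charFormula hmin b (h.errorFun b), h.error_ae_eq b,
      GM.coeFn_seriesVec h.left hbs,
      Lp.coeFn_sub (GM.seriesVec h.left b) (h.past.starProjection (GM.seriesVec h.left b))]
      with l h1 h2 h3 h4
    rw [h1, ← h2, ← h3, GM.DualPair.error, h4, Pi.sub_apply, sub_sub_cancel]
  refine ⟨γ.affineValue J b (GM.blocked T ζ) (GM.seriesVec h.left b),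
    γ.affineValue J b (GM.blocked T ζ) x₀,
    fun k p => inner ℂ (GM.vec h.left k p) (h.error b), h.errorFun b, ‖h.error b‖ ^ 2,
    γ.isFunctionalValue_iff hJ hζ ha,
    fun X hζ2 hX hXm => γ.ae_eq_affineValue_of_tendsto_sum h hJ ha hζ2 hX hXm, hopt,
    (γ.isFInverse_iff h hN _ _ _).2 ⟨hCm, h.error b, h.error_mem_future b, h.error_ae_eq b,
      h.inner_right_error hbs, fun _ _ => rfl⟩, ?_,
    fun p => ⟨h.integrable_errorFun b p, h.integral_errorFun b p⟩, ?_,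
    γ.isSpectralCharacteristic_iff_ae_eq hf.integrable hmin h hJ b hx₀p hchar, by positivity,
    γ.mse_affineValue J b _ _ _, h.integrable_weighted_errorFun b hN,
    h.integral_weighted_errorFun b hN, h.hasSum_error hbs, ?_⟩
  -- every solution comes from an element of the future with the coefficients of the error
  · intro c' C' hc'
    obtain ⟨-, y, hyf, hyC, h1, h2⟩ := (γ.isFInverse_iff h hN _ _ _).1 hc'
    have hy : y = h.error b := h.eq_of_mem_future hyf (h.error_mem_future b) fun k p => by
      rw [h1, h.inner_right_error hbs]
    rw [hy] at hyC h2
    exact ⟨funext fun k => funext fun p => (h2 k p).symm, h.ae_eq_errorFun hyC⟩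
  · intro Fop hF c' hc' k p
    exact γ.eq_of_hasMatrixF h hN hF c' (h.error_mem_future b)
      (fun j q => by rw [h.inner_right_error hbs, hc']) k p
  · intro q ε φ φμ Φ Φμ Ψ cf hΨ
    have hΦm : ∀ p j, AEMeasurable (fun l => Φμ l p j) GM.freq := fun p j =>
      (cf.seriesμ p j).1.aestronglyMeasurable.aemeasurable
    have hΦ : ∀ᵐ l ∂GM.freq, (γ.incRoot f l)ᴴ * γ.incRoot f l = (Φμ l * (Φμ l)ᴴ)ᵀ := by
      filter_upwards [γ.ae_incRoot hmin, cf.factorμ] with l h1 h2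
      rw [h1, h2]
    have hW := h.memL2_innov hΦm hΦ
    have hseries := fun j => GM.isL2Series_of_integral_eq
      (u := fun k => γ.DA (GM.blockCoef T a) φμ k j) (h.memLp_innovFun hΦm hΦ (h.error b) j)
      fun k => by
        rw [h.integral_innovFun_error hW cf.seriesμ
          (fun u hu j => γ.innov_mem_past cf h hJ hW hu j) hbs]
        simp only [γ.DA_eq]
        rfl
    -- the norm of the error can be computed in the coordinates given by the innovations
    have hΔ : ‖h.error b‖ ^ 2 = ∑ j, ∫ l, ‖GM.innovFun (γ.dualRoot f) Φμ (h.error b) l j‖ ^ 2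
        ∂GM.freq := by
      rw [← integral_finsetSum _ fun j _ => (memLp_two_iff_integrable_sq_norm
          (h.memLp_innovFun hΦm hΦ (h.error b) j).aestronglyMeasurable).1
            (h.memLp_innovFun hΦm hΦ (h.error b) j),
        integral_congr_ae (h.sum_norm_sq_innovFun hΦ (h.error b)), ← Complex.ofReal_inj,
        ← integral_complex_ofReal]
      have h1 : inner ℂ (h.error b) (h.error b) = ((‖h.error b‖ ^ 2 : ℝ) : ℂ) := by
        rw [inner_self_eq_norm_sq_to_K]; push_cast; rfl
      rw [← h1, L2.inner_def]
      refine integral_congr_ae (ae_of_all _ fun l => ?_)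
      simp only [inner_self_eq_norm_sq_to_K]
      push_cast
      rfl
    refine ⟨GM.innovFun (γ.dualRoot f) Φμ (h.error b), fun j => (hseries j).1, ?_, ?_, ?_⟩
    · refine γ.isSpectralCharacteristic_iff_ae_eq hf.integrable hmin h hJ b hx₀p ?_
      filter_upwards [γ.act_rootT_charFormula' h hΦ hΨ b (h.error b),
        GM.coeFn_seriesVec h.left hbs,
        Lp.coeFn_sub (GM.seriesVec h.left b) (h.past.starProjection (GM.seriesVec h.left b))]
        with l h1 h3 h4
      rw [h1, ← h3, GM.DualPair.error, h4, Pi.sub_apply, sub_sub_cancel]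
    · rw [hΔ, integral_finsetSum _ fun j _ => (memLp_two_iff_integrable_sq_norm
          (h.memLp_innovFun hΦm hΦ (h.error b) j).aestronglyMeasurable).1
            (h.memLp_innovFun hΦm hΦ (h.error b) j)]
    · rw [hΔ]
      exact hasSum_sum fun j _ => (hseries j).2
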